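/- **Conventions.** $\mathrm{Sp}(2,\mathbb C)$ is the group of $A\in GL(4,\mathbb C)$ preserving $\omega=dz^1\wedge dz^3+dz^2\wedge dz^4$; $A_j$ is the $j$-th column of $A$, and $\varphi=A^{-1}dA=(\varphi^i_j)$ ($i$ the row, $j$ the column) is the Maurer–Cartan form. $\mathbb Q_3$ is the manifold of Lagrangian planes of $\mathbb C^4$. $\mathrm{SL}(2,\mathbb C)_1\subset \mathrm{SL}(2,\mathbb C)$ is the group of upper triangular matrices. $\mathtt S:\mathrm{SL}(2,\mathbb C)\to \mathrm{Sp}(2,\mathbb C)$ is the third symmetric power representation, where $S^3(\mathbb C^2)$ with the basis $\mathbf a_{111},\mathbf a_{112},\mathbf a_{122},\mathbf a_{222}$ of symmetric products of the standard basis vectors is identified with $\mathbb C^4$ by $\mathbf a_{111}\mapsto \mathbf e_1$, $\mathbf a_{112}\mapsto -\sqrt[3]{2/9}\,\mathbf e_2$, $\mathbf a_{122}\mapsto \sqrt[3]{1/6}\,\mathbf e_4$, $\mathbf a_{222}\mapsto \mathbf e_3$; put $\mathrm H_1=\mathtt S(\mathrm{SL}(2,\mathbb C)_1)$. A *projective structure*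 on a Riemann surface is a holomorphic principal $\mathrm{SL}(2,\mathbb C)_1$-bundle $P$ with a holomorphic $\mathfrak{sl}(2,\mathbb C)$-valued Cartan connection $\eta$. A *meromorphic projective structure* on $S$ with singularities in a closed discrete set $D\subset S$ is a projective structure $(P,\eta)$ on $S\setminus D$ such that every $p_0\in D$ has an open neighbourhood $U$ with $U\cap D=\{p_0\}$ and a holomorphic section $\mathfrak p:U\setminus\{p_0\}\to P$ for which $\mathfrak p^*\eta$ is meromorphic at $p_0$. An *isotropic curve* is a nonconstant holomorphic map $f:M\to\mathbb Q_3$ from a connected Riemann surface such that $\varphi^3_1\varphi^4_2-(\varphi^4_1)^2=0$ for every local holomorphic symplectic frame $A$ along $f$ (i.e. $f=[A_1\wedge A_2]$), and such that no nonzero vector of $\mathbb C^4$ lies in all the planes $f(q)$. An *adapted frame* of $f$ is a local holomorphic symplectic frame along $f$ with $$\varphi^3_1=\varphi^4_1=\varphi^2_1-\varphi^4_2=\varphi^1_1-3\varphi^2_2=4\varphi^1_2-3\varphi^2_4=\varphi^1_4=0,\qquad \varphi^4_2\ne0\ \text{everywhere}.$$ Let $\mathcal F_f\subset M\times \mathrm{Sp}(2,\mathbb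 C)$ be the set of all $(q,A(q))$ with $A$ an adapted frame near $q$. The *projective structure of $f$* is the $\mathrm H_1$-bundle $\mathcal F_f$ with the form $$\eta_f=\begin{pmatrix}\varphi^2_2& -(3/32)^{1/3}\varphi^2_4\\ -6^{-1/3}\varphi^4_2&-\varphi^2_2\end{pmatrix},$$ and the *quartic differential* $\delta_f$ of $f$ is given by $\delta_f=\varphi^1_3(\varphi^4_2)^3$ in every adapted frame. The curve $f$ is *generic* (of general type) if $\delta_f\not\equiv0$. **Statement.** Let $S$ be a connected Riemann surface, $(P,\eta)$ a meromorphic projective structure on $S$ with singularities in the closed discrete set $D$, and $\delta$ a nonzero meromorphic quartic differential on $S$; let $|\Delta_\delta|$ be its set of zeros and poles. Let $\mathtt p:S_\star\to S\setminus(D\cup|\Delta_\delta|)$ be a universal covering. Then there is a generic isotropic curve $f:S_\star\to\mathbb Q_3$ such that 1. its projective structure is equivalent to $(\mathtt p^*P,\mathtt p^*\eta)$: there is a holomorphic isomorphism $\Phi:\mathtt p^*P\to\mathcal F_f$ over the identity of $S_\star$ (so $\mathcal F_f$ lies over all of $S_\star$) with $\Phi(y\cdot x)=\Phi(y)\cdot\mathtt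 S(x)$ for all $x\in \mathrm{SL}(2,\mathbb C)_1$ and $\Phi^*\eta_f=\mathtt p^*\eta$; 2. $\delta_f=\mathtt p^*\delta$ on $S_\star$. -/

import Mathlib

open scoped Manifold ContDiff Topology

/-! Throughout, "holomorphic" is `ContMDiff _ _ ω` over `ℂ` (complex analytic), and a Riemann surface
is a connected Hausdorff complex manifold modelled on `ℂ`. -/

namespace IsoCurve

/-! ### The group of upper triangular unimodular matrices -/

/-- `SL(2,ℂ)₁`: the upper triangular `2 × 2` matrices of determinant one. -/
def Borel : Subgroup (Matrix.SpecialLinearGroup (Fin 2) ℂ) where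
  carrier := {x | x 1 0 = 0}
  mul_mem' := by
    intro x y hx hy
    simp only [Set.mem_ofPred_eq] at hx hy ⊢
    simp [Matrix.mul_apply, Fin.sum_univ_two, hx, hy]
  one_mem' := by simp
  inv_mem' := by
    intro x hx
    simp only [Set.mem_ofPred_eq] at hx ⊢
    simp [Matrix.SpecialLinearGroup.SL2_inv_expl, hx]

/-- The underlying `2 × 2` matrix of an element of `SL(2,ℂ)₁`. -/
def bmat (x : Borel) : Matrix (Fin 2) (Fin 2) ℂ := (x : Matrix.SpecialLinearGroup (Fin 2) ℂ).1

/-- The global coordinates `(a, b) ∈ ℂˣ × ℂ` on the complex Lie group `SL(2,ℂ)₁`: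
the matrix with rows `(a, b)` and `(0, a⁻¹)`. -/
def Borel.mk (a : ℂˣ) (b : ℂ) : Borel :=
  ⟨⟨!![(a : ℂ), b; 0, ((a⁻¹ : ℂˣ) : ℂ)], by simp [Matrix.det_fin_two]⟩, by
    change (!![(a : ℂ), b; 0, ((a⁻¹ : ℂˣ) : ℂ)] : Matrix (Fin 2) (Fin 2) ℂ) 1 0 = 0
    simp⟩

theorem bmat_mk (a : ℂˣ) (b : ℂ) :
    bmat (Borel.mk a b) = !![(a : ℂ), b; 0, ((a⁻¹ : ℂˣ) : ℂ)] := rfl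

/-- A holomorphic curve in `SL(2,ℂ)₁` through the identity at `t = 0`, with velocity there the
matrix with rows `(h, k)` and `(0, -h)`. -/
noncomputable def Borel.curve (h k t : ℂ) : Borel :=
  Borel.mk (Units.mk0 (Complex.exp (t * h)) (Complex.exp_ne_zero _)) (t * k)

/-! ### Meromorphic projective structures -/

section Projective

variable (S : Type*) [TopologicalSpace S] [ChartedSpace ℂ S]
  (P : Type*) [TopologicalSpace P] [ChartedSpace (Fin 3 → ℂ) P]
  [IsManifold 𝓘(ℂ, Fin 3 → ℂ) ω P]

/-- A holomorphic principal `SL(2,ℂ)₁`-bundle, with (three-dimensional) total space `P`, over the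
open subset `U` of `S`. -/
structure PrincipalBundle (U : Set S) where
  proj : P → S
  /-- the right action of the structure group -/
  act : P → Borel → P
  isOpen_base : IsOpen U
  proj_mem : ∀ y, proj y ∈ U
  proj_holo : ContMDiff 𝓘(ℂ, Fin 3 → ℂ) 𝓘(ℂ) ω proj
  act_one : ∀ y, act y 1 = y
  act_mul : ∀ y x x', act y (x * x') = act (act y x) x'
  act_holo : ContMDiff (𝓘(ℂ, Fin 3 → ℂ).prod (𝓘(ℂ).prod 𝓘(ℂ))) 𝓘(ℂ, Fin 3 → ℂ) ω
    (fun w : P × ℂˣ × ℂ => act w.1 (Borel.mk w.2.1 w.2.2))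
  proj_act : ∀ y x, proj (act y x) = proj y
  act_free : ∀ y x, act y x = y → x = 1
  /-- Local triviality: near every point of the base there is a holomorphic section `σ`, and
  `(q, x) ↦ σ q · x` has the holomorphic inverse `y ↦ (proj y, g y)`. -/
  locally_trivial : ∀ q₀ ∈ U, ∃ (V : Set S) (σ : S → P) (g : P → Borel),
    IsOpen V ∧ q₀ ∈ V ∧ V ⊆ U ∧
    ContMDiffOn 𝓘(ℂ) 𝓘(ℂ, Fin 3 → ℂ) ω σ V ∧
    (∀ q ∈ V, proj (σ q) = q) ∧
    (∀ y, proj y ∈ V → act (σ (proj y)) (g y) = y) ∧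
    ∀ i j, ContMDiffOn 𝓘(ℂ, Fin 3 → ℂ) 𝓘(ℂ) ω (fun y => bmat (g y) i j) (proj ⁻¹' V)

/-- A (complex) projective structure on the open subset `U` of `S`: a holomorphic principal
`SL(2,ℂ)₁`-bundle with a holomorphic `𝔰𝔩(2,ℂ)`-valued Cartan connection `conn`. -/
structure ProjectiveStructure (U : Set S) extends PrincipalBundle S P U where
  conn : ∀ y : P, TangentSpace 𝓘(ℂ, Fin 3 → ℂ) y →ₗ[ℂ] Matrix (Fin 2) (Fin 2) ℂ
  /-- The form is holomorphic: it is a holomorphic function on the tangent bundle of `P`. -/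
  conn_holo : ∀ i j, ContMDiff 𝓘(ℂ, Fin 3 → ℂ).tangent 𝓘(ℂ) ω
    (fun w : TangentBundle 𝓘(ℂ, Fin 3 → ℂ) P => conn w.proj w.snd i j)
  /-- Each `conn y` is a linear isomorphism of the tangent space onto `𝔰𝔩(2,ℂ)`. -/
  conn_injective : ∀ y, Function.Injective (conn y)
  conn_range : ∀ y (X : Matrix (Fin 2) (Fin 2) ℂ), X ∈ Set.range (conn y) ↔ X.trace = 0
  /-- Fundamental vector fields are reproduced. -/
  conn_fundamental : ∀ (y : P) (h k : ℂ),
    conn (act y (Borel.curve h k 0))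
      (mfderiv 𝓘(ℂ) 𝓘(ℂ, Fin 3 → ℂ) (fun t : ℂ => act y (Borel.curve h k t)) 0 (1 : ℂ))
      = !![h, k; 0, -h]
  /-- `R_x^* η = Ad(x⁻¹) η`. -/
  conn_equivariant : ∀ (y : P) (x : Borel) (v : TangentSpace 𝓘(ℂ, Fin 3 → ℂ) y),
    conn (act y x) (mfderiv 𝓘(ℂ, Fin 3 → ℂ) 𝓘(ℂ, Fin 3 → ℂ) (fun y' => act y' x) y v)
      = bmat x⁻¹ * conn y v * bmat x

/-- A meromorphic projective structure on `S`: a projective structure on the complement of a closed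
discrete set `D`, such that near every `p₀ ∈ D` some section over a punctured neighbourhood pulls the
Cartan connection back to a form which is meromorphic at `p₀` (its coefficients in the local
coordinate at `p₀` are meromorphic). -/
structure MeromorphicProjectiveStructure (D : Set S) extends ProjectiveStructure S P Dᶜ where
  meromorphic : ∀ p₀ ∈ D, ∃ (V : Set S) (σ : S → P),
    IsOpen V ∧ V ∩ D = {p₀} ∧
    ContMDiffOn 𝓘(ℂ) 𝓘(ℂ, Fin 3 → ℂ) ω σ (V \ {p₀}) ∧
    (∀ q ∈ V \ {p₀}, proj (σ q) = q) ∧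
    ∀ i j, MeromorphicAt
      (fun z : ℂ => conn (σ ((chartAt ℂ p₀).symm z))
        (mfderiv 𝓘(ℂ) 𝓘(ℂ, Fin 3 → ℂ) σ ((chartAt ℂ p₀).symm z)
          (mfderiv 𝓘(ℂ) 𝓘(ℂ) (chartAt ℂ p₀).symm z (1 : ℂ))) i j)
      (chartAt ℂ p₀ p₀)

end Projective

/-! ### Meromorphic quartic differentials -/

/-- The coefficient `Z` of a quartic differential `δ = Z dz⁴` in the preferred local coordinate `z`
at `p`. -/
noncomputable def quarticCoeff {S : Type*} [TopologicalSpace S] [ChartedSpace ℂ S]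
    (δ : ∀ q : S, TangentSpace 𝓘(ℂ) q → ℂ) (p : S) : ℂ → ℂ := fun z =>
  δ ((chartAt ℂ p).symm z) (mfderiv 𝓘(ℂ) 𝓘(ℂ) (chartAt ℂ p).symm z (1 : ℂ))

/-- A meromorphic quartic differential on `S`, as a function on tangent vectors that is homogeneous
of degree four; its coefficients are meromorphic. The values at the poles carry no information and
are normalized to `0`: this is what "normal form" says. -/
structure QuarticDifferential (S : Type*) [TopologicalSpace S] [ChartedSpace ℂ S] where
  toFun : ∀ q : S, TangentSpace 𝓘(ℂ) q → ℂ
  homogeneous : ∀ (q : S) (c : ℂ) (v : TangentSpace 𝓘(ℂ) q), toFun q (c • v) = c ^ 4 * toFun q v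
  meromorphic : ∀ p : S, MeromorphicNFAt (quarticCoeff toFun p) (chartAt ℂ p p)

/-- `|Δ_δ|`: the support of the divisor of `δ`, that is, the set of its zeros and poles. -/
def QuarticDifferential.divisorSupport {S : Type*} [TopologicalSpace S] [ChartedSpace ℂ S]
    (δ : QuarticDifferential S) : Set S :=
  {p | meromorphicOrderAt (quarticCoeff δ.toFun p) (chartAt ℂ p p) ≠ 0}

/-- `δ` is not identically zero. -/
def QuarticDifferential.IsNonzero {S : Type*} [TopologicalSpace S] [ChartedSpace ℂ S]
    (δ : QuarticDifferential S) : Prop := ∃ q v, δ.toFun q v ≠ 0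

/-! ### The symplectic group and the Lagrangian quadric

The index set of the coordinates of `ℂ⁴` is `Fin 2 ⊕ Fin 2`; the indices `1, 2, 3, 4` are
`i1, i2, i3, i4`. -/

abbrev Ix := Fin 2 ⊕ Fin 2
abbrev i1 : Ix := Sum.inl 0
abbrev i2 : Ix := Sum.inl 1
abbrev i3 : Ix := Sum.inr 0
abbrev i4 : Ix := Sum.inr 1

/-- The symplectic form `dz¹ ∧ dz³ + dz² ∧ dz⁴` on `ℂ⁴`. -/
def sympl (x y : Ix → ℂ) : ℂ := x i1 * y i3 - x i3 * y i1 + (x i2 * y i4 - x i4 * y i2)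

/-- `Sp(2,ℂ)`, as a set of `4 × 4` matrices. -/
abbrev Sp : Set (Matrix Ix Ix ℂ) := (Matrix.symplecticGroup (Fin 2) ℂ : Set (Matrix Ix Ix ℂ))

/-- A sanity check: the matrices in `Sp` are those preserving the symplectic form. -/
theorem mem_Sp_iff (A : Matrix Ix Ix ℂ) :
    A ∈ Sp ↔ ∀ x y, sympl (A.mulVec x) (A.mulVec y) = sympl x y := by
  have key : ∀ x y : Ix → ℂ, sympl x y = - (x ⬝ᵥ (Matrix.J (Fin 2) ℂ).mulVec y) := by
    intro x y
    simp [sympl, Matrix.J, Matrix.mulVec, dotProduct, Fintype.sum_sum_type, Fin.sum_univ_two,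
      Matrix.fromBlocks, Matrix.one_apply]
    ring
  have key2 : ∀ x y : Ix → ℂ, sympl (A.mulVec x) (A.mulVec y)
      = - (x ⬝ᵥ (A.transpose * Matrix.J (Fin 2) ℂ * A).mulVec y) := by
    intro x y
    rw [key, ← Matrix.mulVec_mulVec, ← Matrix.mulVec_mulVec, Matrix.dotProduct_mulVec x,
      Matrix.vecMul_transpose]
  change A ∈ Matrix.symplecticGroup (Fin 2) ℂ ↔ _
  rw [SymplecticGroup.mem_iff']
  constructor
  · intro h x y
    rw [key2, h, key]
  · intro h
    refine Matrix.ext_of_mulVec_single fun j => ?_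
    ext i
    have := h (Pi.single i 1) (Pi.single j 1)
    rw [key2, key, neg_inj] at this
    simpa using this

/-- `ℚ₃`: the Lagrangian planes of `ℂ⁴`. -/
def Quadric : Type :=
  {W : Submodule ℂ (Ix → ℂ) // Module.finrank ℂ W = 2 ∧ ∀ x ∈ W, ∀ y ∈ W, sympl x y = 0}

/-! ### The isomorphism of `SL(2,ℂ)` with the group `H ⊂ Sp(2,ℂ)` -/

/-- The third symmetric power of the matrix with rows `(a, b)` and `(c, d)`, acting on `S³(ℂ²)` with
the basis `𝐚₁₁₁, 𝐚₁₁₂, 𝐚₂₂₂, 𝐚₁₂₂` (in this order) of symmetric products of the standard basis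
vectors of `ℂ²`. For instance `𝐚₁₁₂` goes to `(a 𝐚₁ + c 𝐚₂)² (b 𝐚₁ + d 𝐚₂)`. -/
def symCube (x : Matrix (Fin 2) (Fin 2) ℂ) : Matrix Ix Ix ℂ :=
  let a := x 0 0
  let b := x 0 1
  let c := x 1 0
  let d := x 1 1
  Matrix.fromBlocks
    !![a ^ 3, a ^ 2 * b; 3 * a ^ 2 * c, a ^ 2 * d + 2 * a * b * c]
    !![b ^ 3, a * b ^ 2; 3 * b ^ 2 * d, 2 * a * b * d + b ^ 2 * c]
    !![c ^ 3, c ^ 2 * d; 3 * a * c ^ 2, 2 * a * c * d + b * c ^ 2]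
    !![d ^ 3, c * d ^ 2; 3 * b * d ^ 2, a * d ^ 2 + 2 * b * c * d]

theorem symCube_mul (x y : Matrix (Fin 2) (Fin 2) ℂ) :
    symCube (x * y) = symCube x * symCube y := by
  ext i j
  rcases i with i | i <;> rcases j with j | j <;> fin_cases i <;> fin_cases j <;>
    simp [symCube, Matrix.mul_apply, Fintype.sum_sum_type, Fin.sum_univ_two] <;> ring

/-- The real cube root of a nonnegative real number, as a complex number. -/
noncomputable def cbrt (r : ℝ) : ℂ := ((r ^ (1 / 3 : ℝ) : ℝ) : ℂ)

/-- The identification `𝙵 : S³(ℂ²) → ℂ⁴`: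
`𝐚₁₁₁ ↦ 𝐞₁`, `𝐚₁₁₂ ↦ -(2/9)^{1/3} 𝐞₂`, `𝐚₂₂₂ ↦ 𝐞₃`, `𝐚₁₂₂ ↦ (1/6)^{1/3} 𝐞₄`. -/
noncomputable def cubeIso : Matrix Ix Ix ℂ :=
  Matrix.diagonal (Sum.elim ![1, -cbrt (2 / 9)] ![1, cbrt (1 / 6)])

/-- The monomorphism `𝚂 : SL(2,ℂ) → Sp(2,ℂ)`, `x ↦ 𝙵 ∘ S³(x) ∘ 𝙵⁻¹`. It identifies
`SL(2,ℂ)₁` with the structure group `H₁` of the projective structure of an isotropic curve. -/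
noncomputable def symRep (x : Matrix (Fin 2) (Fin 2) ℂ) : Matrix Ix Ix ℂ :=
  cubeIso * symCube x * cubeIso⁻¹

/-! ### Isotropic curves, their projective structure and their quartic differential -/

/-- The pull-back `A⁻¹ dA` of the Maurer–Cartan form by a matrix valued map `A`, evaluated on a
tangent vector. Its entry `i j` is `φ^i_j`, so that `dA_j = φ^i_j A_i` for the columns `A_j`. -/
noncomputable def maurerCartan {E N : Type*} [NormedAddCommGroup E] [NormedSpace ℂ E]
    [TopologicalSpace N] [ChartedSpace E N] (A : N → Matrix Ix Ix ℂ) (q : N)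
    (v : TangentSpace 𝓘(ℂ, E) q) : Matrix Ix Ix ℂ :=
  (A q)⁻¹ * Matrix.of fun i j => (mfderiv 𝓘(ℂ, E) 𝓘(ℂ) (fun q' => A q' i j) q v : ℂ)

/-- The `𝔰𝔩(2,ℂ)`-valued form `η = φ²₂ (𝐚₁¹ - 𝐚₂²) - 6^{-1/3} φ⁴₂ 𝐚₂¹ - (3/32)^{1/3} φ²₄ 𝐚₁²`, in which
`𝐚ᵢʲ` has its entry one in the place `(i, j)`. -/
noncomputable def frameConn (φ : Matrix Ix Ix ℂ) : Matrix (Fin 2) (Fin 2) ℂ :=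
  !![φ i2 i2, -(cbrt (3 / 32) * φ i2 i4); -(cbrt (1 / 6) * φ i4 i2), -φ i2 i2]

section Curves

variable {M : Type*} [TopologicalSpace M] [ChartedSpace ℂ M]

/-- A holomorphic symplectic frame along `f` over the open set `U`: a holomorphic
`A : U → Sp(2,ℂ)` with `f = [A₁ ∧ A₂]`. -/
def IsSymplecticFrame (f : M → Quadric) (U : Set M) (A : M → Matrix Ix Ix ℂ) : Prop :=
  IsOpen U ∧ (∀ i j, ContMDiffOn 𝓘(ℂ) 𝓘(ℂ) ω (fun q => A q i j) U) ∧
    ∀ q ∈ U, A q ∈ Sp ∧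
      (f q).1 = Submodule.span ℂ {(fun i => A q i i1), (fun i => A q i i2)}

/-- `f : M → ℚ₃` is holomorphic: locally it is spanned by two holomorphic vectors. -/
def IsHolomorphicCurve (f : M → Quadric) : Prop :=
  ∀ q₀, ∃ (U : Set M) (u₁ u₂ : M → Ix → ℂ), IsOpen U ∧ q₀ ∈ U ∧
    (∀ i, ContMDiffOn 𝓘(ℂ) 𝓘(ℂ) ω (fun q => u₁ q i) U) ∧
    (∀ i, ContMDiffOn 𝓘(ℂ) 𝓘(ℂ) ω (fun q => u₂ q i) U) ∧
    ∀ q ∈ U, (f q).1 = Submodule.span ℂ {u₁ q, u₂ q}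

/-- An isotropic curve: a nonconstant holomorphic map to `ℚ₃` which is null for the conformal
structure (represented by `φ³₁ φ⁴₂ - (φ⁴₁)²` in any symplectic frame) and whose image does not lie in
a null ray, that is, in the pencil of the Lagrangian planes through one point of `ℂℙ³`. -/
structure IsIsotropicCurve (f : M → Quadric) : Prop where
  holomorphic : IsHolomorphicCurve f
  nonconstant : ∃ q q', f q ≠ f q'
  isotropic : ∀ U A, IsSymplecticFrame f U A → ∀ q ∈ U, ∀ v : TangentSpace 𝓘(ℂ) q,
    maurerCartan A q v i3 i1 * maurerCartan A q v i4 i2 - maurerCartan A q v i4 i1 ^ 2 = 0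
  not_null_ray : ¬ ∃ ξ : Ix → ℂ, ξ ≠ 0 ∧ ∀ q, ξ ∈ (f q).1

/-- A symplectic frame along `f` that is adapted to fourth order: it satisfies
`φ³₁ = φ⁴₁ = φ²₁ - φ⁴₂ = φ¹₁ - 3 φ²₂ = 4 φ¹₂ - 3 φ²₄ = φ¹₄ = 0` and `φ⁴₂ ≠ 0` (nowhere zero). -/
def IsAdaptedFrame (f : M → Quadric) (U : Set M) (A : M → Matrix Ix Ix ℂ) : Prop :=
  IsSymplecticFrame f U A ∧ ∀ q ∈ U, ∀ v : TangentSpace 𝓘(ℂ) q,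
    let φ := maurerCartan A q v
    φ i3 i1 = 0 ∧ φ i4 i1 = 0 ∧ φ i2 i1 - φ i4 i2 = 0 ∧ φ i1 i1 - 3 * φ i2 i2 = 0 ∧
      4 * φ i1 i2 - 3 * φ i2 i4 = 0 ∧ φ i1 i4 = 0 ∧ (v ≠ 0 → φ i4 i2 ≠ 0)

/-- The reduced `H₁`-bundle `𝓕_f ⊂ M × Sp(2,ℂ)` of an isotropic curve, given by its fibres:
it consists of all values of adapted frames. It lies over the points at which neither `f` nor its
Legendre associate is ramified, since adapted frames exist locally exactly there. -/
def adaptedFibre (f : M → Quadric) (q : M) : Set (Matrix Ix Ix ℂ) :=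
  {B | ∃ U A, IsAdaptedFrame f U A ∧ q ∈ U ∧ A q = B}

/-- `δ` is the quartic differential `δ_f` of `f`: its pull-back by every adapted frame is
`φ¹₃ (φ⁴₂)³`. -/
def IsQuarticDifferentialOf (f : M → Quadric) (δ : ∀ q : M, TangentSpace 𝓘(ℂ) q → ℂ) : Prop :=
  ∀ U A, IsAdaptedFrame f U A → ∀ q ∈ U, ∀ v : TangentSpace 𝓘(ℂ) q,
    δ q v = maurerCartan A q v i1 i3 * maurerCartan A q v i4 i2 ^ 3

/-- The isotropic curve `f` is of general type (generic): its quartic differential is not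
identically zero. -/
def IsGeneralType (f : M → Quadric) : Prop :=
  ∃ U A, IsAdaptedFrame f U A ∧ ∃ q ∈ U, ∃ v : TangentSpace 𝓘(ℂ) q,
    maurerCartan A q v i1 i3 * maurerCartan A q v i4 i2 ^ 3 ≠ 0

end Curves

/-! ### Pull-backs -/

section Pullback

variable {S : Type*} [TopologicalSpace S] [ChartedSpace ℂ S]
  {P : Type*} [TopologicalSpace P] [ChartedSpace (Fin 3 → ℂ) P] [IsManifold 𝓘(ℂ, Fin 3 → ℂ) ω P]
  {M : Type*} [TopologicalSpace M] [ChartedSpace ℂ M]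

/-- The pull-back `𝚙^*(δ)` of a quartic differential. -/
noncomputable def pullbackQuartic (p : M → S) (δ : QuarticDifferential S) :
    ∀ q : M, TangentSpace 𝓘(ℂ) q → ℂ :=
  fun q v => δ.toFun (p q) (mfderiv 𝓘(ℂ) 𝓘(ℂ) p q v)

/-- The projective structure `(𝓕_f, η_f)` of `f : M → ℚ₃` is equivalent to the pull-back
`(𝚙^*(P), 𝚙^*(η))` of the projective structure `T = (P, η)` by a local biholomorphism `p : M → S`.

The total space of `𝚙^*(P)` is `{(q, y) | p q = proj y}`, and `𝚙^*(η)` is the pull-back of `η` by the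
second projection, which is a local biholomorphism; its local inverses are the maps
`y ↦ (r (proj y), y)`, for the local inverses `r` of `p`. An equivalence is a holomorphic isomorphism
`(q, y) ↦ (q, Ψ q y)` of principal bundles, with the structure groups identified by `symRep`, that
pulls `η_f` back to `𝚙^*(η)`. -/
def IsEquivalentToPullback {U : Set S} (T : ProjectiveStructure S P U) (p : M → S)
    (f : M → Quadric) : Prop :=
  ∃ Ψ : M → P → Matrix Ix Ix ℂ,
    (∀ q, Set.BijOn (Ψ q) {y | T.proj y = p q} (adaptedFibre f q)) ∧
    (∀ q y x, T.proj y = p q → Ψ q (T.act y x) = Ψ q y * symRep (bmat x)) ∧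
    ∀ (V : Set S) (r : S → M), IsOpen V → ContMDiffOn 𝓘(ℂ) 𝓘(ℂ) ω r V → (∀ s ∈ V, p (r s) = s) →
      (∀ i j, ContMDiffOn 𝓘(ℂ, Fin 3 → ℂ) 𝓘(ℂ) ω (fun y => Ψ (r (T.proj y)) y i j)
        (T.proj ⁻¹' V)) ∧
      ∀ y, T.proj y ∈ V → ∀ v : TangentSpace 𝓘(ℂ, Fin 3 → ℂ) y,
        frameConn (maurerCartan (fun y' => Ψ (r (T.proj y')) y') y v) = T.conn y v

/-- `p : M → S` is a holomorphic universal covering of the subset `X` of `S`. -/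
structure IsUniversalCovering (p : M → S) (X : Set S) : Prop where
  simplyConnected : SimplyConnectedSpace M
  holomorphic : ContMDiff 𝓘(ℂ) 𝓘(ℂ) ω p
  range_eq : Set.range p = X
  covering : IsCoveringMapOn p X

end Pullback

end IsoCurve

open IsoCurve

/-! The Cartan connection `η` and the quartic differential `δ` determine an `𝔰𝔭(2,ℂ)`-valued form
on `P` (`spForm`): it has the shape of the Maurer-Cartan form of an adapted frame, its
`𝔰𝔩(2,ℂ)`-part is the image of `η` under the third symmetric power representation, and its remaining
entry is `φ¹₃ = δ / (φ⁴₂)³`. A curve with the required projective structure and quartic differential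
is the same as a map `Ψ : 𝚙^*P → Sp(2,ℂ)` with `dΨ = Ψ · spForm`; such a map sends the points of
`𝚙^*P` to adapted frames, and `f` is spanned by the first two columns of `Ψ`.

*Existence of `Ψ`.* On a Riemann surface there is no integrability condition: over a local section of
`P` outside `D ∪ |Δ_δ|` the equation `dF = F · σ^*spForm` is a holomorphic linear ordinary differential
equation, solved by a convergent power series (`exists_parallelAt`). Two solutions differ by a
constant of `Sp(2,ℂ)` (`eventually_mul_J_mul_transpose_eq`), and the solutions over two sections
`σ` and `σ · x` correspond to each other under right multiplication by `symRep x`, because `spForm` is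
equivariant like a connection form (`ParallelAt.act`, which rests on `adaptedForm_gauge`). So the
obstruction to a global solution is a locally constant cocycle with values in `Sp(2,ℂ)`, and it is a
coboundary on the simply connected surface `S_⋆` (`exists_mul_inv_locally_constant`,
`exists_global_frame`).

*Every adapted frame comes from `Ψ`.* Two adapted frames along the same curve differ by a function
`h` with `h φ' = φ h + dh`. The equations of adapted frames, used entry by entry and differentiated
in between, determine all the entries of `h` in terms of two of them and give `h ∈ 𝚂(SL(2,ℂ)₁)`
(`IsAdaptedTransition.exists_eq_symRep`); the last entry of the same matrix equation is the
invariance of `φ¹₃ (φ⁴₂)³` (`IsAdaptedTransition.quartic_eq`). Hence `Ψ` is a bijection onto the bundle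
of adapted frames, and since `Ψ⁻¹ dΨ = spForm`, it pulls `η_f` and `δ_f` back to `η` and `δ`
(`frameConn_spForm`, `spForm_quartic`).

*The curve is isotropic.* The covering is an immersion (`IsUniversalCovering.mfderiv_ne_zero`), so that
`φ⁴₂` has no zeros; a curve with an adapted frame is null (`IsAdaptedFrame.null`), and its planes
have no common nonzero vector (`IsAdaptedFrame.eq_zero_of_mem`). -/

namespace IsoCurve

/-! ### The third symmetric power and its derivative -/

theorem cbrt_mul {r s : ℝ} (hr : 0 ≤ r) (hs : 0 ≤ s) : cbrt r * cbrt s = cbrt (r * s) := by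
  simp only [cbrt]
  rw [Real.mul_rpow hr hs]
  push_cast
  ring

theorem cbrt_cube {r : ℝ} (hr : 0 ≤ r) : cbrt (r ^ 3) = r := by
  simp only [cbrt]
  rw [← Real.rpow_natCast, ← Real.rpow_mul hr]
  norm_num

theorem cbrt_sixth_pow : cbrt (1 / 6) ^ 3 = 1 / 6 := by
  have h : cbrt (1 / 6) ^ 3 = cbrt ((1 / 6 : ℝ) ^ 3) := by
    rw [pow_three, cbrt_mul (by norm_num) (by norm_num), cbrt_mul (by norm_num) (by norm_num)]
    norm_num
  rw [h, cbrt_cube (by norm_num)]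
  norm_num

theorem cbrt_sixth_ne_zero : cbrt (1 / 6) ≠ 0 := by
  intro h
  have := cbrt_sixth_pow
  rw [h] at this
  norm_num at this

/-- This and the next lemma express all cube roots through `k = (1/6)^{1/3}`, so that the identities
below are polynomial identities in `k` modulo `k³ = 1/6`. -/
theorem cbrt_two_ninths : cbrt (2 / 9) = 2 * cbrt (1 / 6) ^ 2 := by
  have h : cbrt (2 / 9) = cbrt (2 ^ 3) * (cbrt (1 / 6) * cbrt (1 / 6)) := by
    rw [cbrt_mul (by norm_num) (by norm_num), cbrt_mul (by norm_num) (by norm_num)]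
    norm_num
  rw [h, cbrt_cube (by norm_num)]
  push_cast
  ring

theorem cbrt_three_thirtyseconds : cbrt (3 / 32) = 3 / 2 * cbrt (1 / 6) ^ 2 := by
  have h : cbrt (3 / 32) = cbrt ((3 / 2) ^ 3) * (cbrt (1 / 6) * cbrt (1 / 6)) := by
    rw [cbrt_mul (by norm_num) (by norm_num), cbrt_mul (by norm_num) (by norm_num)]
    norm_num
  rw [h, cbrt_cube (by norm_num)]
  push_cast
  ring

theorem cubeIso_inv :
    cubeIso⁻¹ = Matrix.diagonal
      (Sum.elim ![1, -(3 * cbrt (1 / 6))] ![1, 6 * cbrt (1 / 6) ^ 2]) := by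
  have h := cbrt_sixth_pow
  refine Matrix.inv_eq_right_inv ?_
  rw [cubeIso, Matrix.diagonal_mul_diagonal, ← Matrix.diagonal_one, cbrt_two_ninths]
  generalize cbrt (1 / 6) = k at h
  congr 1
  ext i
  rcases i with i | i <;> fin_cases i <;> simp <;> linear_combination 6 * h

theorem cubeIso_inv_mul_cancel : cubeIso⁻¹ * cubeIso = 1 := by
  have h := cbrt_sixth_pow
  rw [cubeIso_inv, cubeIso, Matrix.diagonal_mul_diagonal, ← Matrix.diagonal_one, cbrt_two_ninths]
  generalize cbrt (1 / 6) = k at h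
  congr 1
  ext i
  rcases i with i | i <;> fin_cases i <;> simp <;> linear_combination 6 * h

theorem symRep_mul (x y : Matrix (Fin 2) (Fin 2) ℂ) : symRep (x * y) = symRep x * symRep y := by
  simp only [symRep, symCube_mul]
  calc _ = cubeIso * symCube x * 1 * symCube y * cubeIso⁻¹ := by simp only [mul_assoc, one_mul]
    _ = _ := by rw [← cubeIso_inv_mul_cancel]; simp only [mul_assoc]

/-- The differential of `symCube` at `x` in the direction `ξ`. -/
def symCubeDeriv (x ξ : Matrix (Fin 2) (Fin 2) ℂ) : Matrix Ix Ix ℂ :=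
  let a := x 0 0
  let b := x 0 1
  let c := x 1 0
  let d := x 1 1
  let a' := ξ 0 0
  let b' := ξ 0 1
  let c' := ξ 1 0
  let d' := ξ 1 1
  Matrix.fromBlocks
    !![3 * a ^ 2 * a', 2 * a * a' * b + a ^ 2 * b';
      6 * a * a' * c + 3 * a ^ 2 * c',
      2 * a * a' * d + a ^ 2 * d' + 2 * a' * b * c + 2 * a * b' * c + 2 * a * b * c']
    !![3 * b ^ 2 * b', a' * b ^ 2 + 2 * a * b * b';
      6 * b * b' * d + 3 * b ^ 2 * d',
      2 * a' * b * d + 2 * a * b' * d + 2 * a * b * d' + 2 * b * b' * c + b ^ 2 * c']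
    !![3 * c ^ 2 * c', 2 * c * c' * d + c ^ 2 * d';
      3 * a' * c ^ 2 + 6 * a * c * c',
      2 * a' * c * d + 2 * a * c' * d + 2 * a * c * d' + b' * c ^ 2 + 2 * b * c * c']
    !![3 * d ^ 2 * d', c' * d ^ 2 + 2 * c * d * d';
      3 * b' * d ^ 2 + 6 * b * d * d',
      a' * d ^ 2 + 2 * a * d * d' + 2 * b' * c * d + 2 * b * c' * d + 2 * b * c * d']

theorem symCubeDeriv_mul_left (x η : Matrix (Fin 2) (Fin 2) ℂ) :
    symCubeDeriv x (η * x) = symCubeDeriv 1 η * symCube x := by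
  ext i j
  rcases i with i | i <;> rcases j with j | j <;> fin_cases i <;> fin_cases j <;>
    simp [symCube, symCubeDeriv, Matrix.mul_apply, Fintype.sum_sum_type, Fin.sum_univ_two] <;> ring

theorem symCubeDeriv_mul_right (x η : Matrix (Fin 2) (Fin 2) ℂ) :
    symCubeDeriv x (x * η) = symCube x * symCubeDeriv 1 η := by
  ext i j
  rcases i with i | i <;> rcases j with j | j <;> fin_cases i <;> fin_cases j <;>
    simp [symCube, symCubeDeriv, Matrix.mul_apply, Fintype.sum_sum_type, Fin.sum_univ_two] <;> ring

theorem symCubeDeriv_add (x ξ ξ' : Matrix (Fin 2) (Fin 2) ℂ) :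
    symCubeDeriv x (ξ + ξ') = symCubeDeriv x ξ + symCubeDeriv x ξ' := by
  ext i j
  rcases i with i | i <;> rcases j with j | j <;> fin_cases i <;> fin_cases j <;>
    simp [symCubeDeriv] <;> ring

/-- The differential of `symRep` at `x` in the direction `ξ`. -/
noncomputable def symRepDeriv (x ξ : Matrix (Fin 2) (Fin 2) ℂ) : Matrix Ix Ix ℂ :=
  cubeIso * symCubeDeriv x ξ * cubeIso⁻¹

theorem symRepDeriv_mul_left (x η : Matrix (Fin 2) (Fin 2) ℂ) :
    symRepDeriv x (η * x) = symRepDeriv 1 η * symRep x := by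
  simp only [symRep, symRepDeriv, symCubeDeriv_mul_left]
  calc _ = cubeIso * symCubeDeriv 1 η * 1 * symCube x * cubeIso⁻¹ := by
        simp only [mul_assoc, one_mul]
    _ = _ := by rw [← cubeIso_inv_mul_cancel]; simp only [mul_assoc]

theorem symRepDeriv_mul_right (x η : Matrix (Fin 2) (Fin 2) ℂ) :
    symRepDeriv x (x * η) = symRep x * symRepDeriv 1 η := by
  simp only [symRep, symRepDeriv, symCubeDeriv_mul_right]
  calc _ = cubeIso * symCube x * 1 * symCubeDeriv 1 η * cubeIso⁻¹ := by
        simp only [mul_assoc, one_mul]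
    _ = _ := by rw [← cubeIso_inv_mul_cancel]; simp only [mul_assoc]

theorem symRepDeriv_add (x ξ ξ' : Matrix (Fin 2) (Fin 2) ℂ) :
    symRepDeriv x (ξ + ξ') = symRepDeriv x ξ + symRepDeriv x ξ' := by
  simp only [symRepDeriv, symCubeDeriv_add, mul_add, add_mul]

/-- The elementary matrix with its entry one in the place `(1, 3)`. Its line is invariant under the
adjoint action of `𝚂(SL(2,ℂ)₁)`; this is where the quartic differential enters. -/
def rootMatrix : Matrix Ix Ix ℂ := Matrix.single i1 i3 1

/-- The value of the Maurer-Cartan form of an adapted frame whose projective connection has the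
value `η` and for which `φ¹₃ = d`. -/
noncomputable def adaptedForm (η : Matrix (Fin 2) (Fin 2) ℂ) (d : ℂ) : Matrix Ix Ix ℂ :=
  symRepDeriv 1 η + d • rootMatrix

/-- The entries of `symRep x`. -/
theorem symRep_eq (x : Matrix (Fin 2) (Fin 2) ℂ) :
    symRep x =
      let k := cbrt (1 / 6)
      let a := x 0 0
      let b := x 0 1
      let c := x 1 0
      let d := x 1 1
      Matrix.fromBlocks
        !![a ^ 3, -(3 * k * a ^ 2 * b);
          -(6 * k ^ 2 * a ^ 2 * c), a ^ 2 * d + 2 * a * b * c]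
        !![b ^ 3, 6 * k ^ 2 * a * b ^ 2;
          -(6 * k ^ 2 * b ^ 2 * d), -(2 * k * (2 * a * b * d + b ^ 2 * c))]
        !![c ^ 3, -(3 * k * c ^ 2 * d);
          3 * k * a * c ^ 2, -(3 * k ^ 2 * (2 * a * c * d + b * c ^ 2))]
        !![d ^ 3, 6 * k ^ 2 * c * d ^ 2;
          3 * k * b * d ^ 2, a * d ^ 2 + 2 * b * c * d] := by
  have h := cbrt_sixth_pow
  rw [symRep, cubeIso_inv, cubeIso, cbrt_two_ninths]
  generalize cbrt (1 / 6) = k at h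
  ext i j
  rw [Matrix.mul_diagonal, Matrix.diagonal_mul]
  rcases i with i | i <;> rcases j with j | j <;> fin_cases i <;> fin_cases j <;>
    simp [symCube] <;> grind

/-- The entries of `adaptedForm η d`. -/
theorem adaptedForm_eq (η : Matrix (Fin 2) (Fin 2) ℂ) (d : ℂ) :
    adaptedForm η d =
      let k := cbrt (1 / 6)
      Matrix.fromBlocks
        !![3 * η 0 0, -(3 * k * η 0 1); -(6 * k ^ 2 * η 1 0), 2 * η 0 0 + η 1 1]
        !![d, 0; 0, -(4 * k * η 0 1)]
        !![0, 0; 0, -(6 * k ^ 2 * η 1 0)]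
        !![3 * η 1 1, 6 * k ^ 2 * η 1 0; 3 * k * η 0 1, η 0 0 + 2 * η 1 1] := by
  have h := cbrt_sixth_pow
  rw [adaptedForm, symRepDeriv, rootMatrix, cubeIso_inv, cubeIso, cbrt_two_ninths]
  generalize cbrt (1 / 6) = k at h
  ext i j
  rw [Matrix.add_apply, Matrix.mul_diagonal, Matrix.diagonal_mul]
  rcases i with i | i <;> rcases j with j | j <;> fin_cases i <;> fin_cases j <;>
    simp [symCubeDeriv] <;> grind

theorem bmat_one_zero (x : Borel) : bmat x 1 0 = 0 := x.2

theorem bmat_mul (x y : Borel) : bmat (x * y) = bmat x * bmat y := rfl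

theorem bmat_one : bmat 1 = 1 := rfl

theorem bmat_mul_inv (x : Borel) : bmat x * bmat x⁻¹ = 1 := by
  rw [← bmat_mul, mul_inv_cancel, bmat_one]

theorem bmat_injective : Function.Injective bmat := fun _ _ h => Subtype.ext (Subtype.ext h)

theorem bmat_diag_mul (x : Borel) : bmat x 0 0 * bmat x 1 1 = 1 := by
  have h := (x : Matrix.SpecialLinearGroup (Fin 2) ℂ).2
  rw [Matrix.det_fin_two] at h
  have h0 := x.2
  change (x : Matrix.SpecialLinearGroup (Fin 2) ℂ).1 1 0 = 0 at h0
  rw [h0] at h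
  simpa [bmat] using h

theorem bmat_zero_zero_ne_zero (x : Borel) : bmat x 0 0 ≠ 0 :=
  left_ne_zero_of_mul_eq_one (bmat_diag_mul x)

/-- The coordinates of `Borel.mk`, read off an element of `SL(2,ℂ)₁`. -/
theorem Borel.exists_eq_mk (x : Borel) :
    x = Borel.mk (Units.mk0 (bmat x 0 0) (bmat_zero_zero_ne_zero x)) (bmat x 0 1) := by
  apply bmat_injective
  rw [bmat_mk]
  ext i j
  fin_cases i <;> fin_cases j <;> simp [bmat_one_zero]
  exact eq_inv_of_mul_eq_one_right (bmat_diag_mul x)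

theorem mem_Sp_of_sympl_columns {A : Matrix Ix Ix ℂ}
    (h : ∀ i j, sympl (fun k => A k i) (fun k => A k j) = -Matrix.J (Fin 2) ℂ i j) : A ∈ Sp := by
  change A ∈ Matrix.symplecticGroup (Fin 2) ℂ
  rw [SymplecticGroup.mem_iff']
  ext i j
  have := h i j
  rw [← neg_eq_iff_eq_neg] at this
  rw [← this]
  simp [sympl, Matrix.mul_apply, Fintype.sum_sum_type, Fin.sum_univ_two, Matrix.J]
  ring

theorem symRep_bmat_mem (x : Borel) : symRep (bmat x) ∈ Sp := by
  have h := cbrt_sixth_pow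
  have h0 := bmat_one_zero x
  have h1 := bmat_diag_mul x
  apply mem_Sp_of_sympl_columns
  rw [symRep_eq]
  intro i j
  dsimp only
  rw [h0]
  generalize cbrt (1 / 6) = k at h
  generalize bmat x 0 0 = a at *
  generalize bmat x 0 1 = b at *
  generalize bmat x 1 1 = d at *
  rcases i with i | i <;> rcases j with j | j <;> fin_cases i <;> fin_cases j <;>
    simp [sympl, Matrix.J] <;> grind

theorem eq_one_of_symRep_eq_one {x : Borel} (h : symRep (bmat x) = 1) : x = 1 := by
  have hk := cbrt_sixth_ne_zero
  have h1 := bmat_diag_mul x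
  have e1 := congrFun (congrFun h i1) i1
  have e2 := congrFun (congrFun h i2) i2
  have e3 := congrFun (congrFun h i1) i2
  rw [symRep_eq] at e1 e2 e3
  simp [bmat_one_zero] at e1 e2 e3
  have ha : bmat x 0 0 = 1 := by linear_combination e2 - bmat x 0 0 * h1
  have hb : bmat x 0 1 = 0 := by
    rcases e3 with (h' | h') | h'
    · exact absurd h' (by simpa using hk)
    · exact absurd h' (bmat_zero_zero_ne_zero x)
    · exact h'
  apply bmat_injective
  ext i j
  fin_cases i <;> fin_cases j <;> simp [bmat_one_zero, bmat_one, ha, hb]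
  simpa [ha] using h1

theorem symRep_mul_rootMatrix (x : Borel) :
    symRep (bmat x) * rootMatrix = bmat x 0 0 ^ 3 • rootMatrix := by
  rw [symRep_eq, bmat_one_zero]
  ext i j
  rcases i with i | i <;> rcases j with j | j <;> fin_cases i <;> fin_cases j <;>
    simp [rootMatrix, Matrix.mul_apply, Fintype.sum_sum_type, Fin.sum_univ_two]

theorem rootMatrix_mul_symRep (x : Borel) :
    rootMatrix * symRep (bmat x) = bmat x 1 1 ^ 3 • rootMatrix := by
  rw [symRep_eq, bmat_one_zero]
  ext i j
  rcases i with i | i <;> rcases j with j | j <;> fin_cases i <;> fin_cases j <;>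
    simp [rootMatrix, Matrix.mul_apply, Fintype.sum_sum_type, Fin.sum_univ_two]

/-- The gauge transformation rule of `adaptedForm` under the structure group: the symmetric power
part transforms like `η`, and the coefficient `d` of the root matrix by the character `a⁶`, as the
function `(φ⁴₂)⁻³` does. -/
theorem adaptedForm_gauge (x : Borel) {η η' ξ : Matrix (Fin 2) (Fin 2) ℂ} {d d' : ℂ}
    (hη : bmat x * η' = η * bmat x + ξ) (hd : d = bmat x 0 0 ^ 6 * d') :
    adaptedForm η d * symRep (bmat x) + symRepDeriv (bmat x) ξ
      = symRep (bmat x) * adaptedForm η' d' := by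
  have h1 := bmat_diag_mul x
  rw [adaptedForm, adaptedForm, add_mul, mul_add, ← symRepDeriv_mul_right, hη, symRepDeriv_add,
    symRepDeriv_mul_left, smul_mul_assoc, rootMatrix_mul_symRep, mul_smul_comm,
    symRep_mul_rootMatrix, smul_smul, smul_smul]
  have : d * bmat x 1 1 ^ 3 = d' * bmat x 0 0 ^ 3 := by
    rw [hd]
    linear_combination (bmat x 0 0 ^ 3 * d') * ((bmat x 0 0 * bmat x 1 1) ^ 2 +
      bmat x 0 0 * bmat x 1 1 + 1) * h1
  rw [this]
  abel

/-- `adaptedForm` takes its values in the Lie algebra of the symplectic group. -/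
theorem adaptedForm_mul_J {η : Matrix (Fin 2) (Fin 2) ℂ} (hη : η.trace = 0) (d : ℂ) :
    adaptedForm η d * Matrix.J (Fin 2) ℂ
      + Matrix.J (Fin 2) ℂ * (adaptedForm η d).transpose = 0 := by
  rw [Matrix.trace_fin_two] at hη
  rw [adaptedForm_eq]
  ext i j
  rcases i with i | i <;> rcases j with j | j <;> fin_cases i <;> fin_cases j <;>
    simp [Matrix.J, Matrix.mul_apply, Fintype.sum_sum_type, Fin.sum_univ_two] <;> grind

/-! ### Trivial monodromy on simply connected spaces -/

/-- A cocycle of the form `K i * (K j)⁻¹` that is locally constant on a simply connected space is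
the coboundary of locally constant functions: the covering space with fibre `G` that it defines has
a global section. -/
theorem exists_mul_inv_locally_constant {X G : Type*} [TopologicalSpace X] [SimplyConnectedSpace X]
    [LocallyPathConnectedSpace X] [Group G] (U : X → Set X) (hU : ∀ i, IsOpen (U i))
    (hmem : ∀ x, x ∈ U x) (K : X → X → G)
    (hK : ∀ i j, ∀ x ∈ U i ∩ U j, ∀ᶠ y in 𝓝 x, K i y * (K j y)⁻¹ = K i x * (K j x)⁻¹) :
    ∃ L : X → G, ∀ i, ∀ x ∈ U i, ∀ᶠ y in 𝓝 x, L y * (K i y)⁻¹ = L x * (K i x)⁻¹ := by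
  let _ : TopologicalSpace G := ⊥
  have : DiscreteTopology G := ⟨rfl⟩
  -- the principal covering with the transition functions `K i * (K j)⁻¹`
  let Z : FiberBundleCore X X G :=
    { baseSet := U
      isOpen_baseSet := hU
      indexAt := id
      mem_baseSet_at := hmem
      coordChange := fun i j x v => v * (K i x * (K j x)⁻¹)
      coordChange_self := fun i x _ v => by simp
      continuousOn_coordChange := fun i j => by
        rintro ⟨x, v⟩ ⟨hx, -⟩
        refine ContinuousAt.continuousWithinAt ?_
        have h1 : ∀ᶠ w : X × G in 𝓝 (x, v),
            K i w.1 * (K j w.1)⁻¹ = K i x * (K j x)⁻¹ :=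
          (continuous_fst.tendsto (x, v)).eventually (hK i j x hx)
        have h2 : ContinuousAt (fun w : X × G => w.2 * (K i x * (K j x)⁻¹)) (x, v) :=
          (continuous_of_discreteTopology
            (f := fun g : G => g * (K i x * (K j x)⁻¹))).continuousAt.comp
            continuous_snd.continuousAt
        refine h2.congr ?_
        filter_upwards [h1] with w hw
        simp only [hw]
      coordChange_comp := fun i j k x _ v => by group }
  have cov : IsCoveringMap (Bundle.TotalSpace.proj : Bundle.TotalSpace G Z.Fiber → X) :=
    FiberBundle.isCoveringMap
  obtain ⟨x₀⟩ : Nonempty X := inferInstance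
  obtain ⟨F, ⟨-, hF⟩, -⟩ := cov.existsUnique_continuousMap_lifts (ContinuousMap.id X) x₀
    ⟨x₀, (1 : G)⟩ rfl
  have hF' : ∀ x, (F x).1 = x := fun x => congrFun hF x
  -- In the trivialization `i`, the section is the function `L * (K i)⁻¹`.
  refine ⟨fun x => (show G from (F x).2) * K (F x).1 (F x).1, fun i x hx => ?_⟩
  have hc : ContinuousAt (fun y => (Z.localTriv i (F y)).2) x := by
    have h1 : ContinuousAt (Z.localTriv i) (F x) := by
      refine (Z.localTriv i).continuousAt ?_
      rw [Z.mem_localTriv_source]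
      change (F x).1 ∈ U i
      rwa [hF']
    exact continuous_snd.continuousAt.comp (h1.comp F.continuous.continuousAt)
  have hev : ∀ᶠ y in 𝓝 x, (Z.localTriv i (F y)).2 = (Z.localTriv i (F x)).2 :=
    hc.eventually ((isOpen_discrete {(Z.localTriv i (F x)).2}).mem_nhds rfl)
  have key : ∀ y, (Z.localTriv i (F y)).2
      = (show G from (F y).2) * K (F y).1 (F y).1 * (K i y)⁻¹ := by
    intro y
    rw [Z.localTriv_apply]
    change (show G from (F y).2) * (K (F y).1 (F y).1 * (K i (F y).1)⁻¹) = _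
    conv_lhs => rw [← mul_assoc]
    rw [congrArg (K i) (hF' y)]
  filter_upwards [hev] with y hy
  rw [key, key] at hy
  exact hy

/-! ### Holomorphic linear differential equations -/

section LinearODE

variable {𝔸 : Type*} [NormedRing 𝔸] [NormedAlgebra ℂ 𝔸]

/-- The coefficients of the formal power series solution of `F' = F Z`, `F 0 = 1`, where `c` is the
sequence of coefficients of `Z`. -/
noncomputable def odeCoeff (c : ℕ → 𝔸) : ℕ → 𝔸
  | 0 => 1
  | n + 1 => ((n + 1 : ℂ)⁻¹) • ∑ k : Fin (n + 1), odeCoeff c k * c (n - k)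

theorem odeCoeff_succ (c : ℕ → 𝔸) (n : ℕ) :
    ((n + 1 : ℕ) : ℂ) • odeCoeff c (n + 1)
      = ∑ k ∈ Finset.range (n + 1), odeCoeff c k * c (n - k) := by
  rw [odeCoeff, smul_smul, Finset.sum_range]
  push_cast
  rw [mul_inv_cancel₀ (by exact_mod_cast n.succ_ne_zero), one_smul]

theorem norm_odeCoeff_le (c : ℕ → 𝔸) {C L : ℝ} (hC : 0 ≤ C) (hCL : C ≤ L)
    (hc : ∀ n, ‖c n‖ ≤ C * L ^ n) (n : ℕ) : ‖odeCoeff c n‖ ≤ ‖(1 : 𝔸)‖ * L ^ n := by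
  have hL : 0 ≤ L := hC.trans hCL
  induction n using Nat.strong_induction_on with
  | _ n ih =>
    rcases n with _ | n
    · simp [odeCoeff]
    · rw [odeCoeff, norm_smul]
      have h1 : ∀ k : Fin (n + 1), ‖odeCoeff c k * c (n - k)‖ ≤ ‖(1 : 𝔸)‖ * L ^ (n + 1) := by
        intro k
        have hk : (k : ℕ) + (n - k) = n := by omega
        calc ‖odeCoeff c k * c (n - k)‖ ≤ ‖odeCoeff c k‖ * ‖c (n - k)‖ := norm_mul_le _ _
          _ ≤ (‖(1 : 𝔸)‖ * L ^ (k : ℕ)) * (L * L ^ (n - (k : ℕ))) := by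
              refine mul_le_mul (ih k k.2) ((hc _).trans ?_) (norm_nonneg _) (by positivity)
              gcongr
          _ = ‖(1 : 𝔸)‖ * L ^ (n + 1) := by
              have : L ^ n = L ^ (k : ℕ) * L ^ (n - (k : ℕ)) := by rw [← pow_add, hk]
              rw [pow_succ, this]; ring
      have h2 : ‖∑ k : Fin (n + 1), odeCoeff c k * c (n - k)‖
          ≤ (n + 1) * (‖(1 : 𝔸)‖ * L ^ (n + 1)) := by
        refine (norm_sum_le _ _).trans ((Finset.sum_le_sum fun k _ => h1 k).trans ?_)
        simp
      have h3 : ‖((n + 1 : ℂ)⁻¹)‖ = ((n + 1 : ℝ))⁻¹ := by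
        rw [norm_inv]
        congr 1
        exact_mod_cast Complex.norm_natCast (n + 1)
      rw [h3]
      calc ((n + 1 : ℝ))⁻¹ * ‖∑ k : Fin (n + 1), odeCoeff c k * c (n - k)‖
          ≤ ((n + 1 : ℝ))⁻¹ * ((n + 1) * (‖(1 : 𝔸)‖ * L ^ (n + 1))) := by gcongr
        _ = _ := by rw [inv_mul_cancel_left₀]; positivity

/-- The formal solution converges where it is dominated by a geometric series of ratio `1/2`, and it
may be differentiated term by term there. -/
theorem hasDerivAt_tsum_odeCoeff [CompleteSpace 𝔸] {c : ℕ → 𝔸} {C L : ℝ} (hC : 0 < C)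
    (hCL : C ≤ L) (hc : ∀ n, ‖c n‖ ≤ C * L ^ n) {z : ℂ} (hz : ‖z‖ < 1 / (2 * L)) :
    HasDerivAt (fun z : ℂ => ∑' n, z ^ n • odeCoeff c n)
      ((∑' n, z ^ n • odeCoeff c n) * ∑' n, z ^ n • c n) z := by
  have hL : 0 < L := hC.trans_le hCL
  have ha := norm_odeCoeff_le c hC.le hCL hc
  generalize ha_def : odeCoeff c = a at *
  generalize ‖(1 : 𝔸)‖ = B at *
  have hB0 : 0 ≤ B := by simpa using (norm_nonneg _).trans (ha 0)
  have hρL : 1 / (2 * L) * L = 1 / 2 := by field_simp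
  have hρ0 : 0 < 1 / (2 * L) := by positivity
  generalize 1 / (2 * L) = ρ at *
  have hzt : z ∈ Metric.ball (0 : ℂ) ρ := by simpa using hz
  have hpow : ∀ z ∈ Metric.ball (0 : ℂ) ρ, ∀ n : ℕ, ‖z‖ ^ n * L ^ n ≤ (1 / 2) ^ n := by
    intro z hz n
    rw [mem_ball_zero_iff] at hz
    rw [← mul_pow, ← hρL]
    gcongr
  have hsum : ∀ (b : ℕ → 𝔸) (B : ℝ), 0 ≤ B → (∀ n, ‖b n‖ ≤ B * L ^ n) →
      ∀ z ∈ Metric.ball (0 : ℂ) ρ, Summable fun n => ‖z ^ n • b n‖ := by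
    intro b B hB hb z hz
    refine Summable.of_nonneg_of_le (fun _ => norm_nonneg _) (fun n => ?_)
      ((summable_geometric_two).mul_left B)
    rw [norm_smul, norm_pow]
    calc ‖z‖ ^ n * ‖b n‖ ≤ ‖z‖ ^ n * (B * L ^ n) := by gcongr; exact hb n
      _ = B * (‖z‖ ^ n * L ^ n) := by ring
      _ ≤ B * (1 / 2) ^ n := by gcongr; exact hpow z hz n
  have hu : Summable fun n : ℕ => B * (2 * L) * ((n : ℝ) ^ 1 * (1 / 2 : ℝ) ^ n) := by
    have h : ‖(1 / 2 : ℝ)‖ < 1 := by norm_num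
    exact (summable_pow_mul_geometric_of_norm_lt_one (R := ℝ) 1 h).mul_left (B * (2 * L))
  have hbound : ∀ (n : ℕ), ∀ y ∈ Metric.ball (0 : ℂ) ρ,
      ‖((n : ℂ) * y ^ (n - 1)) • a n‖ ≤ B * (2 * L) * ((n : ℝ) ^ 1 * (1 / 2 : ℝ) ^ n) := by
    intro n y hy
    rw [norm_smul, norm_mul, norm_pow, Complex.norm_natCast]
    rcases n with _ | n
    · simp
    · calc ((n + 1 : ℕ) : ℝ) * ‖y‖ ^ n * ‖a (n + 1)‖
          ≤ ((n + 1 : ℕ) : ℝ) * ‖y‖ ^ n * (B * L ^ (n + 1)) := by gcongr; exact ha _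
        _ = ((n + 1 : ℕ) : ℝ) * B * L * (‖y‖ ^ n * L ^ n) := by ring
        _ ≤ ((n + 1 : ℕ) : ℝ) * B * L * (1 / 2) ^ n := by gcongr; exact hpow y hy n
        _ = _ := by ring
  have hder := hasDerivAt_tsum_of_isPreconnected (t := Metric.ball (0 : ℂ) ρ)
    (g := fun n z => z ^ n • a n) (g' := fun n z => ((n : ℂ) * z ^ (n - 1)) • a n)
    hu Metric.isOpen_ball (convex_ball 0 ρ).isPreconnected
    (fun n y _ => (hasDerivAt_pow n y).smul_const (a n)) hbound
    (Metric.mem_ball_self hρ0) (hsum a B hB0 ha 0 (Metric.mem_ball_self hρ0)).of_norm hzt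
  refine hder.congr_deriv ?_
  have hsummable : Summable fun n : ℕ => ((n : ℂ) * z ^ (n - 1)) • a n :=
    Summable.of_norm_bounded hu fun n => hbound n z hzt
  rw [hsummable.tsum_eq_zero_add, tsum_mul_tsum_eq_tsum_sum_range_of_summable_norm
    (hsum a B hB0 ha z hzt) (hsum c C hC.le hc z hzt)]
  simp only [Nat.cast_zero, zero_mul, zero_smul, zero_add, Nat.add_sub_cancel]
  congr 1
  ext n
  rw [mul_comm, mul_smul, ← ha_def, odeCoeff_succ, Finset.smul_sum]
  refine Finset.sum_congr rfl fun k hk => ?_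
  rw [smul_mul_smul_comm, ← pow_add]
  congr 2
  have := Finset.mem_range.1 hk
  omega

/-- Local existence for the linear differential equation `F' = F Z` with holomorphic coefficients,
by majorizing the coefficients of the formal solution. -/
theorem exists_hasDerivAt_mul_of_analyticAt [CompleteSpace 𝔸] {Z : ℂ → 𝔸} {z₀ : ℂ}
    (hZ : AnalyticAt ℂ Z z₀) :
    ∃ F : ℂ → 𝔸, F z₀ = 1 ∧ ∀ᶠ z in 𝓝 z₀, HasDerivAt F (F z * Z z) z := by
  obtain ⟨p, hp⟩ := hZ
  obtain ⟨C, r, hC, hr, hCr⟩ := p.le_mul_pow_of_radius_pos hp.radius_pos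
  have hL : 0 < max C r := lt_max_of_lt_left hC
  have hcL : ∀ n, ‖p.coeff n‖ ≤ C * (max C r) ^ n := by
    intro n
    have h0 : ‖p.coeff n‖ ≤ ‖p n‖ := by
      have h := (p n).le_opNorm (fun _ => (1 : ℂ))
      rw [Finset.prod_eq_one (fun i _ => norm_one), mul_one] at h
      exact h
    refine h0.trans ((hCr n).trans ?_)
    have : r ≤ max C r := le_max_right _ _
    gcongr
  refine ⟨fun z => ∑' n, (z - z₀) ^ n • odeCoeff p.coeff n, ?_, ?_⟩
  · dsimp only
    rw [tsum_eq_single 0]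
    · simp [odeCoeff]
    · intro n hn
      simp [hn]
  have hZsum : ∀ᶠ z in 𝓝 z₀, HasSum (fun n => (z - z₀) ^ n • p.coeff n) (Z z) :=
    hasFPowerSeriesAt_iff'.1 hp
  have hρ0 : 0 < 1 / (2 * max C r) := by positivity
  filter_upwards [hZsum, Metric.ball_mem_nhds z₀ hρ0] with z hz hzt
  rw [mem_ball_iff_norm] at hzt
  rw [← hz.tsum_eq]
  have h := hasDerivAt_tsum_odeCoeff hC (le_max_left _ _) hcL hzt
  exact h.comp_sub_const z z₀

end LinearODE

section MatrixODE

attribute [local instance] Matrix.linftyOpNormedAddCommGroup Matrix.linftyOpNormedSpace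
  Matrix.linftyOpNormedRing Matrix.linftyOpNormedAlgebra

theorem exists_matrix_hasDerivAt_mul_of_analyticAt {n : Type*} [Fintype n] [DecidableEq n]
    {Z : ℂ → Matrix n n ℂ} {z₀ : ℂ} (hZ : ∀ i j, AnalyticAt ℂ (fun z => Z z i j) z₀) :
    ∃ F : ℂ → Matrix n n ℂ, F z₀ = 1 ∧
      ∀ᶠ z in 𝓝 z₀, ∀ i j, HasDerivAt (fun z => F z i j) ((F z * Z z) i j) z := by
  have hZ' : AnalyticAt ℂ Z z₀ := by
    have : Z = fun z => ∑ i, ∑ j, Z z i j • Matrix.single i j (1 : ℂ) := by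
      ext1 z
      conv_lhs => rw [Matrix.matrix_eq_sum_single (Z z)]
      simp [Matrix.smul_single]
    rw [this]
    refine Finset.analyticAt_fun_sum _ fun i _ => Finset.analyticAt_fun_sum _ fun j _ => ?_
    exact (hZ i j).smul analyticAt_const
  obtain ⟨F, h0, hF⟩ := exists_hasDerivAt_mul_of_analyticAt hZ'
  refine ⟨F, h0, hF.mono fun z hz i j => ?_⟩
  let ev : Matrix n n ℂ →L[ℂ] ℂ :=
    LinearMap.toContinuousLinearMap
      { toFun := fun A => A i j
        map_add' := fun _ _ => rfl
        map_smul' := fun _ _ => rfl }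
  exact ev.hasFDerivAt.comp_hasDerivAt z hz

end MatrixODE

/-! ### Injective holomorphic functions -/

/-- The zeros of the derivative are isolated, so that the inverse homeomorphism is holomorphic
outside of isolated points, and by the removable singularity theorem everywhere; then the chain rule
applies. -/
theorem deriv_ne_zero_of_openPartialHomeomorph (e : OpenPartialHomeomorph ℂ ℂ) {z : ℂ}
    (hz : z ∈ e.source) (he : AnalyticAt ℂ e z) : deriv e z ≠ 0 := by
  have hleft : ∀ᶠ y in 𝓝 z, e.symm (e y) = y := e.eventually_left_inverse hz
  have hright : ∀ᶠ w in 𝓝 (e z), e (e.symm w) = w :=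
    e.eventually_right_inverse (e.map_source hz)
  have hd : ∀ᶠ y in 𝓝[≠] z, deriv e y ≠ 0 := by
    rcases he.deriv.eventually_eq_zero_or_eventually_ne_zero with h | h
    · exfalso
      have h1 : ∀ᶠ y in 𝓝 z, e y = e z := by
        obtain ⟨r, hr, hball⟩ := Metric.eventually_nhds_iff_ball.1 (h.and he.eventually_analyticAt)
        filter_upwards [Metric.ball_mem_nhds z hr] with y hy
        refine Metric.isOpen_ball.is_const_of_deriv_eq_zero (convex_ball z r).isPreconnected
          (fun w hw => (hball w hw).2.differentiableAt.differentiableWithinAt)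
          (fun w hw => (hball w hw).1) hy (Metric.mem_ball_self hr)
      have h2 : ∀ᶠ y in 𝓝 z, y = z := by
        filter_upwards [h1, hleft] with y hy hy'
        rw [← hy', hy, e.left_inv hz]
      have h3 : ∀ᶠ y in 𝓝[≠] z, y = z := h2.filter_mono nhdsWithin_le_nhds
      obtain ⟨y, hy, hy'⟩ := (h3.and self_mem_nhdsWithin).exists
      exact hy' hy
    · exact h
  have hsymm : ContinuousAt e.symm (e z) := e.continuousAt_symm (e.map_source hz)
  have hdiff : ∀ᶠ w in 𝓝[≠] (e z), DifferentiableAt ℂ e.symm w := by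
    have ht : Filter.Tendsto e.symm (𝓝[≠] (e z)) (𝓝[≠] z) := by
      refine tendsto_nhdsWithin_of_tendsto_nhds_of_eventually_within _ ?_ ?_
      · have := hsymm.tendsto
        rw [e.left_inv hz] at this
        exact this.mono_left nhdsWithin_le_nhds
      · filter_upwards [self_mem_nhdsWithin, hright.filter_mono nhdsWithin_le_nhds] with w hw hw' h
        apply hw
        rw [Set.mem_singleton_iff] at h ⊢
        rw [← hw', h]
    have ha : ∀ᶠ y in 𝓝[≠] z, AnalyticAt ℂ e y :=
      he.eventually_analyticAt.filter_mono nhdsWithin_le_nhds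
    filter_upwards [ht.eventually hd, ht.eventually ha,
      mem_nhdsWithin_of_mem_nhds (e.open_target.mem_nhds (e.map_source hz))] with w h1 h2 h3
    exact (HasDerivAt.of_local_left_inverse (e.continuousAt_symm h3)
      h2.differentiableAt.hasDerivAt h1 (e.eventually_right_inverse h3)).differentiableAt
  have hg : AnalyticAt ℂ e.symm (e z) :=
    Complex.analyticAt_of_differentiable_on_punctured_nhds_of_continuousAt hdiff hsymm
  intro h0
  have h1 : HasDerivAt (fun y => e.symm (e y)) (deriv e.symm (e z) * deriv e z) z :=
    (hg.differentiableAt.hasDerivAt).comp z he.differentiableAt.hasDerivAt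
  have h2 : HasDerivAt (fun y => e.symm (e y)) 1 z := (hasDerivAt_id z).congr_of_eventuallyEq hleft
  have := h1.unique h2
  rw [h0, mul_zero] at this
  exact zero_ne_one this

/-! ### Differential calculus of matrix valued maps on manifolds -/

section MatrixCalculus

variable {E N : Type*} [NormedAddCommGroup E] [NormedSpace ℂ E] [TopologicalSpace N]
  [ChartedSpace E N] {l m n : Type*}

variable (E) in
/-- The matrix valued map `A` is holomorphic at `q`. -/
def HolAt (A : N → Matrix m n ℂ) (q : N) : Prop :=
  ∀ i j, ContMDiffAt 𝓘(ℂ, E) 𝓘(ℂ) ω (fun q' => A q' i j) q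

/-- The differential of a matrix valued map, evaluated on a tangent vector. -/
noncomputable def matDeriv (A : N → Matrix m n ℂ) (q : N) (v : TangentSpace 𝓘(ℂ, E) q) :
    Matrix m n ℂ :=
  Matrix.of fun i j => (mfderiv 𝓘(ℂ, E) 𝓘(ℂ) (fun q' => A q' i j) q v : ℂ)

theorem maurerCartan_eq (A : N → Matrix Ix Ix ℂ) (q : N) (v : TangentSpace 𝓘(ℂ, E) q) :
    maurerCartan A q v = (A q)⁻¹ * matDeriv A q v := rfl

theorem hasDerivAt_affineLine (a w : E) : HasDerivAt (fun t : ℂ => a + t • w) w 0 := by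
  simpa using ((hasDerivAt_id (0 : ℂ)).smul_const w).const_add a

theorem affineLine_zero (a w : E) : a + (0 : ℂ) • w = a := by simp

/-- The line through `q` in the direction `v`, in the preferred coordinates at `q`. -/
noncomputable def coordLine (q : N) (v : TangentSpace 𝓘(ℂ, E) q) (t : ℂ) : N :=
  (extChartAt 𝓘(ℂ, E) q).symm ((fun w : E => extChartAt 𝓘(ℂ, E) q q + t • w) v)

theorem coordLine_zero (q : N) (v : TangentSpace 𝓘(ℂ, E) q) : coordLine q v 0 = q :=
  (congrArg (extChartAt 𝓘(ℂ, E) q).symm (affineLine_zero (extChartAt 𝓘(ℂ, E) q q) v)).trans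
    (extChartAt_to_inv q)

theorem hasDerivAt_coordLine {f : N → ℂ} {q : N} (hf : MDifferentiableAt 𝓘(ℂ, E) 𝓘(ℂ) f q)
    (v : TangentSpace 𝓘(ℂ, E) q) :
    HasDerivAt (fun t => f (coordLine q v t)) (mfderiv 𝓘(ℂ, E) 𝓘(ℂ) f q v : ℂ) 0 := by
  have h : HasFDerivAt (writtenInExtChartAt 𝓘(ℂ, E) 𝓘(ℂ) q f)
      (show E →L[ℂ] ℂ from mfderiv 𝓘(ℂ, E) 𝓘(ℂ) f q) (extChartAt 𝓘(ℂ, E) q q) := by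
    rw [← hasFDerivWithinAt_univ, ← ModelWithCorners.range_eq_univ 𝓘(ℂ, E)]
    exact hf.hasMFDerivAt.2
  have h' : HasFDerivAt (writtenInExtChartAt 𝓘(ℂ, E) 𝓘(ℂ) q f)
      (show E →L[ℂ] ℂ from mfderiv 𝓘(ℂ, E) 𝓘(ℂ) f q)
      ((fun w : E => extChartAt 𝓘(ℂ, E) q q + (0 : ℂ) • w) v) := by
    exact (congrArg (HasFDerivAt _ _) (affineLine_zero (extChartAt 𝓘(ℂ, E) q q) v)).mpr h
  exact h'.comp_hasDerivAt 0 (hasDerivAt_affineLine (extChartAt 𝓘(ℂ, E) q q) v)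

theorem HolAt.mdifferentiableAt {A : N → Matrix m n ℂ} {q : N} (hA : HolAt E A q) (i : m) (j : n) :
    MDifferentiableAt 𝓘(ℂ, E) 𝓘(ℂ) (fun q' => A q' i j) q :=
  (hA i j).mdifferentiableAt (by simp)

theorem HolAt.hasDerivAt {A : N → Matrix m n ℂ} {q : N} (hA : HolAt E A q)
    (v : TangentSpace 𝓘(ℂ, E) q) (i : m) (j : n) :
    HasDerivAt (fun t => A (coordLine q v t) i j) (matDeriv A q v i j) 0 :=
  hasDerivAt_coordLine (hA.mdifferentiableAt i j) v

theorem matDeriv_eq_of_hasDerivAt {A : N → Matrix m n ℂ} {q : N} (hA : HolAt E A q)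
    {v : TangentSpace 𝓘(ℂ, E) q} {B : Matrix m n ℂ}
    (h : ∀ i j, HasDerivAt (fun t => A (coordLine q v t) i j) (B i j) 0) : matDeriv A q v = B := by
  ext i j
  exact (hA.hasDerivAt v i j).unique (h i j)

theorem HolAt.congr {A B : N → Matrix m n ℂ} {q : N} (hA : HolAt E A q) (h : B =ᶠ[𝓝 q] A) :
    HolAt E B q := fun i j =>
  (hA i j).congr_of_eventuallyEq (h.mono fun _ hq => congrFun (congrFun hq i) j)

theorem matDeriv_congr {A B : N → Matrix m n ℂ} {q : N} (h : A =ᶠ[𝓝 q] B)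
    (v : TangentSpace 𝓘(ℂ, E) q) : matDeriv A q v = matDeriv B q v := by
  ext i j
  have : (fun q' => A q' i j) =ᶠ[𝓝 q] fun q' => B q' i j :=
    h.mono fun _ hq => congrFun (congrFun hq i) j
  exact congrArg (fun L : E →L[ℂ] ℂ => L v) this.mfderiv_eq

theorem holAt_const (A : Matrix m n ℂ) (q : N) : HolAt E (fun _ : N => A) q :=
  fun _ _ => contMDiffAt_const

theorem matDeriv_const (A : Matrix m n ℂ) (q : N) (v : TangentSpace 𝓘(ℂ, E) q) :
    matDeriv (fun _ : N => A) q v = 0 := by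
  refine matDeriv_eq_of_hasDerivAt (holAt_const (E := E) A q) fun i j => ?_
  exact hasDerivAt_const _ _

theorem HolAt.mul [Fintype m] {A : N → Matrix l m ℂ} {B : N → Matrix m n ℂ} {q : N}
    (hA : HolAt E A q) (hB : HolAt E B q) : HolAt E (fun q => A q * B q) q := by
  intro i j
  simp only [Matrix.mul_apply]
  exact contMDiffAt_finsetSum fun k _ => (hA i k).mul (hB k j)

theorem matDeriv_mul [Fintype m] {A : N → Matrix l m ℂ} {B : N → Matrix m n ℂ} {q : N}
    (hA : HolAt E A q) (hB : HolAt E B q) (v : TangentSpace 𝓘(ℂ, E) q) :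
    matDeriv (fun q => A q * B q) q v = matDeriv A q v * B q + A q * matDeriv B q v := by
  refine matDeriv_eq_of_hasDerivAt (hA.mul hB) fun i j => ?_
  simp only [Matrix.mul_apply, Matrix.add_apply, ← Finset.sum_add_distrib]
  refine HasDerivAt.fun_sum fun k _ => ?_
  have := (hA.hasDerivAt v i k).fun_mul (hB.hasDerivAt v k j)
  rwa [coordLine_zero] at this

theorem HolAt.transpose {A : N → Matrix m n ℂ} {q : N} (hA : HolAt E A q) :
    HolAt E (fun q => (A q).transpose) q := fun i j => hA j i

theorem matDeriv_transpose (A : N → Matrix m n ℂ) (q : N) (v : TangentSpace 𝓘(ℂ, E) q) :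
    matDeriv (fun q => (A q).transpose) q v = (matDeriv A q v).transpose := rfl

theorem HolAt.comp {E' N' : Type*} [NormedAddCommGroup E'] [NormedSpace ℂ E']
    [TopologicalSpace N'] [ChartedSpace E' N'] {A : N → Matrix m n ℂ} {g : N' → N} {q : N'}
    (hA : HolAt E A (g q)) (hg : ContMDiffAt 𝓘(ℂ, E') 𝓘(ℂ, E) ω g q) :
    HolAt E' (fun q => A (g q)) q :=
  fun i j => (hA i j).comp q hg

theorem matDeriv_comp {E' N' : Type*} [NormedAddCommGroup E'] [NormedSpace ℂ E']
    [TopologicalSpace N'] [ChartedSpace E' N'] {A : N → Matrix m n ℂ} {g : N' → N} {q : N'}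
    (hA : HolAt E A (g q)) (hg : MDifferentiableAt 𝓘(ℂ, E') 𝓘(ℂ, E) g q)
    (v : TangentSpace 𝓘(ℂ, E') q) :
    matDeriv (fun q => A (g q)) q v = matDeriv A (g q) (mfderiv 𝓘(ℂ, E') 𝓘(ℂ, E) g q v) := by
  ext i j
  exact mfderiv_comp_apply q (hA.mdifferentiableAt i j) hg v

theorem HolAt.symCube {X : N → Matrix (Fin 2) (Fin 2) ℂ} {q : N} (hX : HolAt E X q) :
    HolAt E (fun q => symCube (X q)) q := by
  have hpi : ContMDiffAt 𝓘(ℂ, E) 𝓘(ℂ, Fin 2 → Fin 2 → ℂ) ω (fun q' i j => X q' i j) q :=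
    contMDiffAt_pi_space.2 fun i => contMDiffAt_pi_space.2 fun j => hX i j
  intro i j
  have h : ContDiff ℂ ω (fun x : Fin 2 → Fin 2 → ℂ => IsoCurve.symCube (Matrix.of x) i j) := by
    rcases i with i | i <;> rcases j with j | j <;> fin_cases i <;> fin_cases j <;>
      simp [IsoCurve.symCube] <;> fun_prop
  exact h.contMDiff.contMDiffAt.comp q hpi

theorem matDeriv_symCube {X : N → Matrix (Fin 2) (Fin 2) ℂ} {q : N} (hX : HolAt E X q)
    (v : TangentSpace 𝓘(ℂ, E) q) :
    matDeriv (fun q => symCube (X q)) q v = symCubeDeriv (X q) (matDeriv X q v) := by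
  refine matDeriv_eq_of_hasDerivAt hX.symCube fun i j => ?_
  have h00 := hX.hasDerivAt v 0 0
  have h01 := hX.hasDerivAt v 0 1
  have h10 := hX.hasDerivAt v 1 0
  have h11 := hX.hasDerivAt v 1 1
  have e : X q = X (coordLine q v 0) := by rw [coordLine_zero]
  generalize matDeriv X q v = ξ at *
  rw [e]
  change HasDerivAt (fun t => symCube ((fun t => X (coordLine q v t)) t) i j)
    (symCubeDeriv ((fun t => X (coordLine q v t)) 0) ξ i j) 0
  generalize hY : (fun t => X (coordLine q v t)) = Y
  have hY' : ∀ t, X (coordLine q v t) = Y t := fun t => congrFun hY t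
  simp only [hY'] at h00 h01 h10 h11
  have d00 := h00.differentiableAt
  have d01 := h01.differentiableAt
  have d10 := h10.differentiableAt
  have d11 := h11.differentiableAt
  rcases i with i | i <;> rcases j with j | j <;> fin_cases i <;> fin_cases j <;>
    simp [symCube, symCubeDeriv] <;>
    refine (DifferentiableAt.hasDerivAt (by fun_prop)).congr_deriv ?_ <;>
    simp (disch := fun_prop) only [deriv_fun_add, deriv_fun_mul, deriv_fun_pow, deriv_const,
      h00.deriv, h01.deriv, h10.deriv, h11.deriv] <;>
    push_cast <;> ring

theorem HolAt.symRep {X : N → Matrix (Fin 2) (Fin 2) ℂ} {q : N} (hX : HolAt E X q) :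
    HolAt E (fun q => symRep (X q)) q :=
  ((holAt_const cubeIso q).mul hX.symCube).mul (holAt_const cubeIso⁻¹ q)

theorem matDeriv_symRep {X : N → Matrix (Fin 2) (Fin 2) ℂ} {q : N} (hX : HolAt E X q)
    (v : TangentSpace 𝓘(ℂ, E) q) :
    matDeriv (fun q => symRep (X q)) q v = symRepDeriv (X q) (matDeriv X q v) := by
  have h1 := holAt_const (E := E) cubeIso q
  have h2 := holAt_const (E := E) cubeIso⁻¹ q
  simp only [symRep, symRepDeriv]
  rw [matDeriv_mul (h1.mul hX.symCube) h2, matDeriv_mul h1 hX.symCube, matDeriv_const,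
    matDeriv_const, matDeriv_symCube hX, zero_mul, zero_add, mul_zero, add_zero]

end MatrixCalculus

section LocallyConstant

variable {E N : Type*} [NormedAddCommGroup E] [NormedSpace ℂ E] [TopologicalSpace N]
  [ChartedSpace E N] [IsManifold 𝓘(ℂ, E) ω N]

theorem eventually_eq_of_mfderiv_eq_zero {f : N → ℂ} {q : N}
    (hf : ∀ᶠ q' in 𝓝 q, MDifferentiableAt 𝓘(ℂ, E) 𝓘(ℂ) f q')
    (h0 : ∀ᶠ q' in 𝓝 q, ∀ v : TangentSpace 𝓘(ℂ, E) q', mfderiv 𝓘(ℂ, E) 𝓘(ℂ) f q' v = 0) :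
    ∀ᶠ q' in 𝓝 q, f q' = f q := by
  set χ := chartAt E q with hχ
  have hz : χ q ∈ χ.target := mem_chart_target E q
  have hs : Filter.Tendsto χ.symm (𝓝 (χ q)) (𝓝 q) := by
    have := (χ.continuousAt_symm hz).tendsto
    rwa [χ.left_inv (mem_chart_source E q)] at this
  obtain ⟨r, hr, hball⟩ := Metric.eventually_nhds_iff_ball.1
    ((hs.eventually (hf.and h0)).and (χ.open_target.mem_nhds hz))
  have hd : ∀ z ∈ Metric.ball (χ q) r, HasFDerivAt (fun z => f (χ.symm z)) (0 : E →L[ℂ] ℂ) z := by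
    intro z hz'
    obtain ⟨⟨h1, h2⟩, h3⟩ := hball z hz'
    have h4 : MDifferentiableAt 𝓘(ℂ, E) 𝓘(ℂ, E) χ.symm z :=
      mdifferentiableAt_atlas_symm (chart_mem_atlas E q) h3
    have h5 : HasMFDerivAt 𝓘(ℂ, E) 𝓘(ℂ) (fun z => f (χ.symm z)) z
        ((mfderiv 𝓘(ℂ, E) 𝓘(ℂ) f (χ.symm z)).comp (mfderiv 𝓘(ℂ, E) 𝓘(ℂ, E) χ.symm z)) :=
      h1.hasMFDerivAt.comp z h4.hasMFDerivAt
    have h6 := hasMFDerivAt_iff_hasFDerivAt.1 h5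
    have h7 : (show E →L[ℂ] ℂ from (mfderiv 𝓘(ℂ, E) 𝓘(ℂ) f (χ.symm z)).comp
        (mfderiv 𝓘(ℂ, E) 𝓘(ℂ, E) χ.symm z)) = 0 := ContinuousLinearMap.ext fun w => h2 _
    exact (congrArg (fun L : E →L[ℂ] ℂ => HasFDerivAt (fun z => f (χ.symm z)) L z) h7).mp h6
  have hconst : ∀ z ∈ Metric.ball (χ q) r, f (χ.symm z) = f (χ.symm (χ q)) := by
    intro z hz'
    exact Metric.isOpen_ball.is_const_of_fderiv_eq_zero (convex_ball _ r).isPreconnected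
      (fun w hw => (hd w hw).differentiableAt.differentiableWithinAt)
      (fun w hw => (hd w hw).fderiv) hz' (Metric.mem_ball_self hr)
  filter_upwards [(χ.continuousAt (mem_chart_source E q)).eventually
    (Metric.ball_mem_nhds _ hr), chart_source_mem_nhds E q] with q' h1 h2
  have := hconst _ h1
  rwa [χ.left_inv h2, χ.left_inv (mem_chart_source E q)] at this

theorem eventually_eq_of_matDeriv_eq_zero {m n : Type*} [Finite m] [Finite n]
    {A : N → Matrix m n ℂ} {q : N}
    (hA : ∀ᶠ q' in 𝓝 q, HolAt E A q')
    (h0 : ∀ᶠ q' in 𝓝 q, ∀ v : TangentSpace 𝓘(ℂ, E) q', matDeriv A q' v = 0) :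
    ∀ᶠ q' in 𝓝 q, A q' = A q := by
  have h : ∀ᶠ q' in 𝓝 q, ∀ i j, A q' i j = A q i j := by
    rw [Filter.eventually_all]; intro i
    rw [Filter.eventually_all]; intro j
    refine eventually_eq_of_mfderiv_eq_zero (E := E) (f := fun q => A q i j)
      (hA.mono fun q' h => h.mdifferentiableAt i j) (h0.mono fun q' h v => ?_)
    exact congrFun (congrFun (h v) i) j
  filter_upwards [h] with q' hq'
  ext i j
  exact hq' i j

end LocallyConstant

/-! ### Products in a principal bundle and the Cartan connection -/

/-- The unit with the value `a`, and `1` for `a = 0`. -/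
noncomputable def unitOf (a : ℂ) : ℂˣ := if h : a ≠ 0 then Units.mk0 a h else 1

theorem val_unitOf {a : ℂ} (h : a ≠ 0) : (unitOf a : ℂ) = a := by simp [unitOf, h]

theorem contMDiffAt_unitOf {a : ℂ} (h : a ≠ 0) : ContMDiffAt 𝓘(ℂ) 𝓘(ℂ) ω unitOf a := by
  have hr : ∀ b : ℂ, b ≠ 0 → b ∈ Set.range (Units.val : ℂˣ → ℂ) := fun b hb => ⟨Units.mk0 b hb, rfl⟩
  have hopen : IsOpen (Set.range (Units.val : ℂˣ → ℂ)) := Units.isOpenEmbedding_val.isOpen_range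
  have h1 := contMDiffOn_isOpenEmbedding_symm (I := 𝓘(ℂ)) (n := ω)
    (Units.isOpenEmbedding_val (R := ℂ))
  refine (h1.contMDiffAt (hopen.mem_nhds (hr a h))).congr_of_eventuallyEq ?_
  filter_upwards [isOpen_ne.mem_nhds h] with b hb
  apply Units.ext
  rw [val_unitOf hb]
  exact (Topology.IsOpenEmbedding.toOpenPartialHomeomorph_right_inv _
    (Units.isOpenEmbedding_val (R := ℂ)) (hr b hb)).symm

theorem eq_mk_unitOf (x : Borel) : x = Borel.mk (unitOf (bmat x 0 0)) (bmat x 0 1) := by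
  conv_lhs => rw [Borel.exists_eq_mk x]
  congr 1
  apply Units.ext
  rw [val_unitOf (bmat_zero_zero_ne_zero x)]
  rfl

theorem Borel.curve_zero (h k : ℂ) : Borel.curve h k 0 = 1 := by
  apply bmat_injective
  rw [Borel.curve, bmat_mk, bmat_one]
  ext i j
  fin_cases i <;> fin_cases j <;> simp

section Bundle

variable {S : Type*} [TopologicalSpace S] [ChartedSpace ℂ S]
  {P : Type*} [TopologicalSpace P] [ChartedSpace (Fin 3 → ℂ) P] {U : Set S}
  {E N : Type*} [NormedAddCommGroup E] [NormedSpace ℂ E] [TopologicalSpace N]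
  [ChartedSpace E N]

/-- The action of the structure group in the coordinates `a, b` of the group, as a map that is
defined for all `a`, but is of interest only for `a ≠ 0`. -/
noncomputable def PrincipalBundle.coordAct (T : PrincipalBundle S P U) (w : P × ℂ × ℂ) : P :=
  T.act w.1 (Borel.mk (unitOf w.2.1) w.2.2)

theorem PrincipalBundle.coordAct_bmat (T : PrincipalBundle S P U) (y : P) (x : Borel) :
    T.coordAct (y, bmat x 0 0, bmat x 0 1) = T.act y x := by
  rw [PrincipalBundle.coordAct, ← eq_mk_unitOf]

theorem PrincipalBundle.contMDiffAt_coordAct (T : PrincipalBundle S P U) {w : P × ℂ × ℂ}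
    (hw : w.2.1 ≠ 0) :
    ContMDiffAt (𝓘(ℂ, Fin 3 → ℂ).prod (𝓘(ℂ).prod 𝓘(ℂ))) 𝓘(ℂ, Fin 3 → ℂ) ω T.coordAct w := by
  have h1 : ContMDiffAt (𝓘(ℂ, Fin 3 → ℂ).prod (𝓘(ℂ).prod 𝓘(ℂ))) 𝓘(ℂ) ω
      (fun w : P × ℂ × ℂ => unitOf w.2.1) w :=
    (contMDiffAt_unitOf hw).comp w (contMDiffAt_fst.comp w contMDiffAt_snd)
  have h2 : ContMDiffAt (𝓘(ℂ, Fin 3 → ℂ).prod (𝓘(ℂ).prod 𝓘(ℂ))) 𝓘(ℂ) ω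
      (fun w : P × ℂ × ℂ => w.2.2) w := contMDiffAt_snd.comp w contMDiffAt_snd
  exact T.act_holo.contMDiffAt.comp w (contMDiffAt_fst.prodMk (h1.prodMk h2))

theorem PrincipalBundle.contMDiffAt_act (T : PrincipalBundle S P U) {τ : N → P} {x : N → Borel}
    {q : N} (hτ : ContMDiffAt 𝓘(ℂ, E) 𝓘(ℂ, Fin 3 → ℂ) ω τ q)
    (hx : HolAt E (fun q => bmat (x q)) q) :
    ContMDiffAt 𝓘(ℂ, E) 𝓘(ℂ, Fin 3 → ℂ) ω (fun q => T.act (τ q) (x q)) q := by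
  have h := (T.contMDiffAt_coordAct (w := (τ q, bmat (x q) 0 0, bmat (x q) 0 1))
    (bmat_zero_zero_ne_zero _)).comp q (hτ.prodMk ((hx 0 0).prodMk (hx 0 1)))
  refine h.congr_of_eventuallyEq (Filter.Eventually.of_forall fun q' => ?_)
  exact (T.coordAct_bmat _ _).symm

variable [IsManifold 𝓘(ℂ, Fin 3 → ℂ) ω P]

theorem ProjectiveStructure.conn_congr (T : ProjectiveStructure S P U) {y y' : P} (h : y = y')
    (v : Fin 3 → ℂ) : T.conn y v = T.conn y' v := by
  subst h; rfl

theorem holAt_curve (h k t : ℂ) : HolAt ℂ (fun t => bmat (Borel.curve h k t)) t := by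
  have key : ∀ i j, ContDiff ℂ ω (fun t => bmat (Borel.curve h k t) i j) := by
    intro i j
    simp only [Borel.curve, bmat_mk]
    fin_cases i <;> fin_cases j <;> simp [← Complex.exp_neg] <;> fun_prop
  exact fun i j => (key i j).contMDiff.contMDiffAt

/-- A vector whose image under the Cartan connection is upper triangular is vertical, since it is
the velocity of a one-parameter curve of the structure group. -/
theorem ProjectiveStructure.mfderiv_proj_eq_zero (T : ProjectiveStructure S P U) {y : P}
    {v : TangentSpace 𝓘(ℂ, Fin 3 → ℂ) y} (hv : T.conn y v 1 0 = 0) :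
    mfderiv 𝓘(ℂ, Fin 3 → ℂ) 𝓘(ℂ) T.proj y v = 0 := by
  have htr := (T.conn_range y (T.conn y v)).1 ⟨v, rfl⟩
  rw [Matrix.trace_fin_two] at htr
  set h := T.conn y v 0 0
  set k := T.conn y v 0 1
  have hX : T.conn y v = !![h, k; 0, -h] := by
    ext i j
    fin_cases i <;> fin_cases j <;> simp [h, k, hv]
    exact eq_neg_of_add_eq_zero_right htr
  have hc0 : T.act y (Borel.curve h k 0) = y := by rw [Borel.curve_zero, T.act_one]
  have hcurve : MDifferentiableAt 𝓘(ℂ) 𝓘(ℂ, Fin 3 → ℂ)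
      (fun t : ℂ => T.act y (Borel.curve h k t)) 0 :=
    (T.contMDiffAt_act (N := ℂ) contMDiffAt_const (holAt_curve h k 0)).mdifferentiableAt (by simp)
  have hw := T.conn_fundamental y h k
  have hproj : MDifferentiableAt 𝓘(ℂ, Fin 3 → ℂ) 𝓘(ℂ) T.proj (T.act y (Borel.curve h k 0)) :=
    T.proj_holo.mdifferentiableAt (by simp)
  have hz : mfderiv 𝓘(ℂ, Fin 3 → ℂ) 𝓘(ℂ) T.proj (T.act y (Borel.curve h k 0))
      (mfderiv 𝓘(ℂ) 𝓘(ℂ, Fin 3 → ℂ) (fun t : ℂ => T.act y (Borel.curve h k t)) 0 (1 : ℂ)) = 0 := by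
    refine (mfderiv_comp_apply (0 : ℂ) hproj hcurve _).symm.trans ?_
    have : T.proj ∘ (fun t : ℂ => T.act y (Borel.curve h k t)) = fun _ => T.proj y := by
      ext t; exact T.proj_act _ _
    rw [this, mfderiv_const]
    rfl
  generalize mfderiv 𝓘(ℂ) 𝓘(ℂ, Fin 3 → ℂ) (fun t : ℂ => T.act y (Borel.curve h k t)) 0 (1 : ℂ)
    = w at hw hz
  revert w
  generalize T.act y (Borel.curve h k 0) = y' at hc0
  subst hc0
  intro w hw hz
  have : v = w := T.conn_injective _ (hX.trans hw.symm)
  rw [this]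
  exact hz

/-- The product rule for the Cartan connection along `q ↦ τ q · x q`, usually written
`(τ x)^*η = x⁻¹ (τ^*η) x + x⁻¹ dx`. It combines the equivariance of the connection with its values
on fundamental vector fields. -/
theorem ProjectiveStructure.conn_mfderiv_act (T : ProjectiveStructure S P U) {τ : N → P}
    {x : N → Borel} {q : N} (hτ : ContMDiffAt 𝓘(ℂ, E) 𝓘(ℂ, Fin 3 → ℂ) ω τ q)
    (hx : HolAt E (fun q => bmat (x q)) q) (v : TangentSpace 𝓘(ℂ, E) q) :
    bmat (x q) * T.conn (T.act (τ q) (x q))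
        (mfderiv 𝓘(ℂ, E) 𝓘(ℂ, Fin 3 → ℂ) (fun q => T.act (τ q) (x q)) q v)
      = T.conn (τ q) (mfderiv 𝓘(ℂ, E) 𝓘(ℂ, Fin 3 → ℂ) τ q v) * bmat (x q)
        + matDeriv (fun q => bmat (x q)) q v := by
  set y := τ q
  set a := bmat (x q) 0 0 with ha
  set b := bmat (x q) 0 1 with hb
  set dX := matDeriv (fun q => bmat (x q)) q v with hdX
  have ha0 : a ≠ 0 := bmat_zero_zero_ne_zero _
  have hm : MDifferentiableAt (𝓘(ℂ, Fin 3 → ℂ).prod (𝓘(ℂ).prod 𝓘(ℂ))) 𝓘(ℂ, Fin 3 → ℂ)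
      T.coordAct (y, a, b) := (T.contMDiffAt_coordAct ha0).mdifferentiableAt (by simp)
  have hm2 : MDifferentiableAt (𝓘(ℂ).prod 𝓘(ℂ)) 𝓘(ℂ, Fin 3 → ℂ)
      (fun w : ℂ × ℂ => T.coordAct (y, w)) (a, b) :=
    hm.comp (a, b) (mdifferentiableAt_const.prodMk mdifferentiableAt_id)
  -- The derivative is the sum of the partial derivatives.
  have h1 : mfderiv 𝓘(ℂ, E) 𝓘(ℂ, Fin 3 → ℂ) (fun q => T.act (τ q) (x q)) q v
      = (mfderiv 𝓘(ℂ, Fin 3 → ℂ) 𝓘(ℂ, Fin 3 → ℂ) (fun z => T.coordAct (z, (a, b))) y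
          (mfderiv 𝓘(ℂ, E) 𝓘(ℂ, Fin 3 → ℂ) τ q v)
        + mfderiv (𝓘(ℂ).prod 𝓘(ℂ)) 𝓘(ℂ, Fin 3 → ℂ) (fun w : ℂ × ℂ => T.coordAct (y, w)) (a, b)
          ((dX 0 0, dX 0 1) : ℂ × ℂ) : Fin 3 → ℂ) := by
    have hfun : (fun q => T.act (τ q) (x q)) = T.coordAct ∘
        (fun q => (τ q, bmat (x q) 0 0, bmat (x q) 0 1)) := by
      ext1 q'
      exact (T.coordAct_bmat _ _).symm
    rw [hfun]
    have hg := (hτ.mdifferentiableAt (by simp)).hasMFDerivAt.prodMk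
      ((hx.mdifferentiableAt 0 0).hasMFDerivAt.prodMk (hx.mdifferentiableAt 0 1).hasMFDerivAt)
    have hcomp := (hm.hasMFDerivAt.comp q hg).mfderiv
    refine (congrArg (fun L : E →L[ℂ] (Fin 3 → ℂ) => L v) hcomp).trans ?_
    exact mfderiv_prod_eq_add_apply hm
  have h2 : (fun z => T.coordAct (z, (a, b))) = fun z => T.act z (x q) := by
    ext1 z
    exact T.coordAct_bmat z (x q)
  -- a one-parameter curve of the group with the velocity `dX`
  obtain ⟨h, hh⟩ : ∃ h, a * h = dX 0 0 := ⟨dX 0 0 / a, by field_simp⟩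
  obtain ⟨k, hk⟩ : ∃ k, a * k - b * h = dX 0 1 := ⟨(dX 0 1 + b * h) / a, by field_simp; ring⟩
  have h3 : mfderiv 𝓘(ℂ) 𝓘(ℂ, Fin 3 → ℂ)
        (fun t : ℂ => T.act (T.act y (x q)) (Borel.curve h k t)) 0 (1 : ℂ)
      = (mfderiv (𝓘(ℂ).prod 𝓘(ℂ)) 𝓘(ℂ, Fin 3 → ℂ) (fun w : ℂ × ℂ => T.coordAct (y, w)) (a, b)
          ((dX 0 0, dX 0 1) : ℂ × ℂ) : Fin 3 → ℂ) := by
    set c : ℂ → ℂ × ℂ := fun t =>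
      (a * Complex.exp (t * h), a * (t * k) + b * Complex.exp (-(t * h))) with hc
    have hfun : (fun t : ℂ => T.act (T.act y (x q)) (Borel.curve h k t))
        = (fun w : ℂ × ℂ => T.coordAct (y, w)) ∘ c := by
      ext1 t
      rw [← T.act_mul, ← T.coordAct_bmat, bmat_mul, Borel.curve, bmat_mk]
      simp only [Function.comp, hc, Matrix.mul_apply, Fin.sum_univ_two]
      simp [← Complex.exp_neg, ha, hb]
    have hc0 : c 0 = (a, b) := by simp [hc]
    have hlin : HasDerivAt (fun t : ℂ => t * h) h 0 := by
      simpa using (hasDerivAt_id (0 : ℂ)).mul_const h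
    have hlin' : HasDerivAt (fun t : ℂ => a * (t * k)) (a * k) 0 := by
      simpa using ((hasDerivAt_id (0 : ℂ)).mul_const k).const_mul a
    have hc1 : HasDerivAt (fun t : ℂ => a * Complex.exp (t * h)) (dX 0 0) 0 := by
      have := (hlin.cexp).const_mul a
      simpa [hh] using this
    have hc2 : HasDerivAt (fun t : ℂ => a * (t * k) + b * Complex.exp (-(t * h))) (dX 0 1) 0 := by
      have := hlin'.fun_add ((hlin.fun_neg.cexp).const_mul b)
      refine this.congr_deriv ?_
      rw [← hk]
      simp
      ring
    have hcd := hc1.hasFDerivAt.hasMFDerivAt.prodMk hc2.hasFDerivAt.hasMFDerivAt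
    rw [hfun]
    refine (mfderiv_comp_apply_of_eq (0 : ℂ) (y := ((a, b) : ℂ × ℂ)) hm2 hcd.mdifferentiableAt hc0
      (1 : ℂ)).trans ?_
    refine congrArg (mfderiv (𝓘(ℂ).prod 𝓘(ℂ)) 𝓘(ℂ, Fin 3 → ℂ)
      (fun w : ℂ × ℂ => T.coordAct (y, w)) (a, b) : ℂ × ℂ →L[ℂ] (Fin 3 → ℂ)) ?_
    refine (congrArg (fun L : ℂ →L[ℂ] ℂ × ℂ => L 1) hcd.mfderiv).trans ?_
    exact Prod.ext (one_mul _) (one_mul _)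
  have h4 := T.conn_fundamental (T.act y (x q)) h k
  have h5 := T.conn_equivariant y (x q) (mfderiv 𝓘(ℂ, E) 𝓘(ℂ, Fin 3 → ℂ) τ q v)
  have hc0 : T.act (T.act y (x q)) (Borel.curve h k 0) = T.act y (x q) := by
    rw [Borel.curve_zero, T.act_one]
  have h4' : T.conn (T.act y (x q)) (mfderiv (𝓘(ℂ).prod 𝓘(ℂ)) 𝓘(ℂ, Fin 3 → ℂ)
      (fun w : ℂ × ℂ => T.coordAct (y, w)) (a, b) ((dX 0 0, dX 0 1) : ℂ × ℂ))
      = !![h, k; 0, -h] := by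
    rw [← h4]
    exact (T.conn_congr hc0.symm _).trans (congrArg (T.conn _) h3.symm)
  rw [← h2] at h5
  have h6 := (congrArg (T.conn (T.act y (x q))) h1).trans
    ((map_add (T.conn (T.act y (x q))) _ _).trans (congrArg₂ (· + ·) h5 h4'))
  rw [h6, mul_add, ← mul_assoc, ← mul_assoc, bmat_mul_inv, one_mul]
  congr 1
  -- the remaining entries of `dX` follow from the equations of the group
  have hd10 : dX 1 0 = 0 := by
    have e : (fun q => bmat (x q) 1 0) = fun _ => (0 : ℂ) := by ext q; exact bmat_one_zero _
    have := hx.hasDerivAt v 1 0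
    simp only [bmat_one_zero] at this
    exact this.unique (hasDerivAt_const _ _)
  have hd11 : dX 0 0 * bmat (x q) 1 1 + a * dX 1 1 = 0 := by
    have := (hx.hasDerivAt v 0 0).fun_mul (hx.hasDerivAt v 1 1)
    simp only [bmat_diag_mul, coordLine_zero] at this
    exact this.unique (hasDerivAt_const _ _)
  have h11 : dX 1 1 = -(bmat (x q) 1 1 * h) := by
    apply mul_left_cancel₀ ha0
    linear_combination hd11 + bmat (x q) 1 1 * hh
  ext i j
  fin_cases i <;> fin_cases j <;>
    simp [Matrix.mul_apply, Fin.sum_univ_two, bmat_one_zero, hd10, h11, ← ha, ← hb, hh]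
  linear_combination hk

end Bundle

/-! ### The symplectic connection defined by a projective structure and a quartic differential -/

theorem adaptedForm_smul (c : ℂ) (η : Matrix (Fin 2) (Fin 2) ℂ) (d : ℂ) :
    adaptedForm (c • η) (c * d) = c • adaptedForm η d := by
  rw [adaptedForm_eq, adaptedForm_eq]
  ext i j
  rcases i with i | i <;> rcases j with j | j <;> fin_cases i <;> fin_cases j <;>
    simp <;> ring

theorem QuarticDifferential.toFun_zero {S : Type*} [TopologicalSpace S] [ChartedSpace ℂ S]
    (δ : QuarticDifferential S) (s : S) : δ.toFun s 0 = 0 := by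
  have h := δ.homogeneous s 0 0
  rwa [zero_smul, zero_pow four_ne_zero, zero_mul] at h

theorem QuarticDifferential.toFun_congr {S : Type*} [TopologicalSpace S] [ChartedSpace ℂ S]
    (δ : QuarticDifferential S) {s s' : S} (h : s = s') {w w' : ℂ} (hw : w = w') :
    δ.toFun s w = δ.toFun s' w' := by
  subst h hw; rfl

section Connection

variable {S : Type*} [TopologicalSpace S] [ChartedSpace ℂ S]
  {P : Type*} [TopologicalSpace P] [ChartedSpace (Fin 3 → ℂ) P]
  [IsManifold 𝓘(ℂ, Fin 3 → ℂ) ω P] {U : Set S}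
  {E N : Type*} [NormedAddCommGroup E] [NormedSpace ℂ E] [TopologicalSpace N]
  [ChartedSpace E N]

/-- The `𝔰𝔭(2,ℂ)`-valued form on `P` determined by the Cartan connection and by the quartic
differential `δ`: it has the shape of the Maurer-Cartan form of an adapted frame, with `η` the
Cartan connection and with `φ¹₃ = δ / (φ⁴₂)³`. On vertical vectors, both `δ` and `φ⁴₂` are zero, and
so is `φ¹₃`, by the convention `0 / 0 = 0`. -/
noncomputable def spForm (T : ProjectiveStructure S P U) (δ : QuarticDifferential S) (y : P)
    (v : TangentSpace 𝓘(ℂ, Fin 3 → ℂ) y) : Matrix Ix Ix ℂ :=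
  adaptedForm (T.conn y v)
    (δ.toFun (T.proj y) (mfderiv 𝓘(ℂ, Fin 3 → ℂ) 𝓘(ℂ) T.proj y v) /
      (-(6 * cbrt (1 / 6) ^ 2 * T.conn y v 1 0)) ^ 3)

theorem spForm_mul_J (T : ProjectiveStructure S P U) (δ : QuarticDifferential S) (y : P)
    (v : TangentSpace 𝓘(ℂ, Fin 3 → ℂ) y) :
    spForm T δ y v * Matrix.J (Fin 2) ℂ + Matrix.J (Fin 2) ℂ * (spForm T δ y v).transpose = 0 :=
  adaptedForm_mul_J ((T.conn_range y _).1 ⟨v, rfl⟩) _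

theorem spForm_smul (T : ProjectiveStructure S P U) (δ : QuarticDifferential S) (y : P) (c : ℂ)
    (v : TangentSpace 𝓘(ℂ, Fin 3 → ℂ) y) : spForm T δ y (c • v) = c • spForm T δ y v := by
  rw [spForm, spForm, ← adaptedForm_smul, map_smul, map_smul, δ.homogeneous]
  congr 1
  rcases eq_or_ne c 0 with rfl | hc
  · simp
  · rw [Matrix.smul_apply, smul_eq_mul,
      show (-(6 * cbrt (1 / 6) ^ 2 * (c * T.conn y v 1 0))) ^ 3
        = c ^ 3 * (-(6 * cbrt (1 / 6) ^ 2 * T.conn y v 1 0)) ^ 3 by ring, pow_succ, mul_assoc,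
      mul_div_mul_left _ _ (pow_ne_zero 3 hc), mul_div_assoc]

/-- The map `F` to the matrices is a parallel frame over the map `τ` to `P`, at the point `q`:
`dF = F · τ^*ζ` there, where `ζ` is the form `spForm`. -/
def ParallelAt (T : ProjectiveStructure S P U) (δ : QuarticDifferential S)
    (F : N → Matrix Ix Ix ℂ) (τ : N → P) (q : N) : Prop :=
  ∀ v : TangentSpace 𝓘(ℂ, E) q,
    matDeriv F q v = F q * spForm T δ (τ q) (mfderiv 𝓘(ℂ, E) 𝓘(ℂ, Fin 3 → ℂ) τ q v)

variable {T : ProjectiveStructure S P U} {δ : QuarticDifferential S} {F F₁ F₂ : N → Matrix Ix Ix ℂ}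
  {τ : N → P} {q : N}

theorem spForm_congr {y y' : P} (h : y = y') (v : Fin 3 → ℂ) :
    spForm T δ y v = spForm T δ y' v := by
  subst h; rfl

theorem ParallelAt.congr (h : ParallelAt (E := E) T δ F τ q) {F' : N → Matrix Ix Ix ℂ} {τ' : N → P}
    (hF : F' =ᶠ[𝓝 q] F) (hτ : τ' =ᶠ[𝓝 q] τ) : ParallelAt (E := E) T δ F' τ' q := by
  intro v
  rw [matDeriv_congr hF, h v, hF.eq_of_nhds]
  congr 1
  have h1 : (show E →L[ℂ] (Fin 3 → ℂ) from mfderiv 𝓘(ℂ, E) 𝓘(ℂ, Fin 3 → ℂ) τ' q)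
      = mfderiv 𝓘(ℂ, E) 𝓘(ℂ, Fin 3 → ℂ) τ q := hτ.mfderiv_eq
  exact (spForm_congr hτ.eq_of_nhds.symm _).trans
    (congrArg (fun L : E →L[ℂ] (Fin 3 → ℂ) => spForm T δ (τ' q) (L v)) h1.symm)

theorem ParallelAt.const_mul (h : ParallelAt (E := E) T δ F τ q) (hF : HolAt E F q)
    (C : Matrix Ix Ix ℂ) : ParallelAt (E := E) T δ (fun q => C * F q) τ q := by
  intro v
  rw [matDeriv_mul (holAt_const C q) hF, matDeriv_const, zero_mul, zero_add, h v, mul_assoc]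

theorem ParallelAt.comp {E' N' : Type*} [NormedAddCommGroup E'] [NormedSpace ℂ E']
    [TopologicalSpace N'] [ChartedSpace E' N'] {g : N' → N} {q : N'}
    (h : ParallelAt (E := E) T δ F τ (g q)) (hF : HolAt E F (g q))
    (hτ : MDifferentiableAt 𝓘(ℂ, E) 𝓘(ℂ, Fin 3 → ℂ) τ (g q))
    (hg : MDifferentiableAt 𝓘(ℂ, E') 𝓘(ℂ, E) g q) :
    ParallelAt (E := E') T δ (fun q => F (g q)) (fun q => τ (g q)) q := by
  intro v
  rw [matDeriv_comp hF hg, h]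
  congr 1
  exact congrArg (spForm T δ (τ (g q))) (mfderiv_comp_apply q hτ hg v).symm

/-- The form `spForm` transforms like a connection form when the section is changed, and so parallel
frames correspond to each other under the right action of `H₁`. -/
theorem ParallelAt.act {x : N → Borel} (h : ParallelAt (E := E) T δ F τ q) (hF : HolAt E F q)
    (hτ : ContMDiffAt 𝓘(ℂ, E) 𝓘(ℂ, Fin 3 → ℂ) ω τ q)
    (hx : HolAt E (fun q => bmat (x q)) q) :
    ParallelAt (E := E) T δ (fun q => F q * symRep (bmat (x q)))
      (fun q => T.act (τ q) (x q)) q := by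
  intro v
  rw [matDeriv_mul hF hx.symRep, matDeriv_symRep hx, h v, mul_assoc, ← mul_add, mul_assoc]
  congr 1
  have hη := T.conn_mfderiv_act hτ hx v
  refine adaptedForm_gauge (x q) hη ?_
  have hproj : ∀ y, MDifferentiableAt 𝓘(ℂ, Fin 3 → ℂ) 𝓘(ℂ) T.proj y := fun y =>
    T.proj_holo.mdifferentiableAt (by simp)
  have h1 := mfderiv_comp_apply q (hproj _) (hτ.mdifferentiableAt (by simp)) v
  have h2 := mfderiv_comp_apply q (hproj _)
    ((T.contMDiffAt_act hτ hx).mdifferentiableAt (by simp)) v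
  have hfun : T.proj ∘ (fun q => T.act (τ q) (x q)) = T.proj ∘ τ := by
    ext q'; exact T.proj_act _ _
  have h12 : (show ℂ from mfderiv 𝓘(ℂ, E) 𝓘(ℂ) (T.proj ∘ (fun q => T.act (τ q) (x q))) q v)
      = mfderiv 𝓘(ℂ, E) 𝓘(ℂ) (T.proj ∘ τ) q v := by rw [hfun]
  have e := δ.toFun_congr (T.proj_act (τ q) (x q)) (h2.symm.trans (h12.trans h1))
  have h10 := congrFun (congrFun hη 1) 0
  have hdiag := bmat_diag_mul (x q)
  have hd10 : matDeriv (fun q => bmat (x q)) q v 1 0 = 0 := by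
    have := hx.hasDerivAt v 1 0
    simp only [bmat_one_zero] at this
    exact this.unique (hasDerivAt_const _ _)
  simp only [Matrix.add_apply, Matrix.mul_apply, Fin.sum_univ_two, bmat_one_zero, hd10,
    zero_mul, mul_zero, zero_add, add_zero] at h10
  have ha := bmat_zero_zero_ne_zero (x q)
  refine Eq.trans ?_ (congrArg (fun w => bmat (x q) 0 0 ^ 6 * (w /
    (-(6 * cbrt (1 / 6) ^ 2 * T.conn (T.act (τ q) (x q)) (mfderiv 𝓘(ℂ, E) 𝓘(ℂ, Fin 3 → ℂ)
      (fun q => T.act (τ q) (x q)) q v) 1 0)) ^ 3)) e.symm)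
  generalize T.conn (T.act (τ q) (x q)) (mfderiv 𝓘(ℂ, E) 𝓘(ℂ, Fin 3 → ℂ)
      (fun q => T.act (τ q) (x q)) q v) 1 0 = c' at h10
  have hc' : c' = bmat (x q) 0 0 ^ 2 *
      T.conn (τ q) (mfderiv 𝓘(ℂ, E) 𝓘(ℂ, Fin 3 → ℂ) τ q v) 1 0 := by
    linear_combination (-c') * hdiag + bmat (x q) 0 0 * h10
  rw [hc', show ∀ a k c : ℂ, (-(6 * k ^ 2 * (a ^ 2 * c))) ^ 3 = a ^ 6 * (-(6 * k ^ 2 * c)) ^ 3 by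
    intros; ring, ← mul_div_assoc, mul_div_mul_left _ _ (pow_ne_zero 6 ha)]

/-- Two parallel frames over the same map differ by a constant: if `F₂` is symplectic, the matrix
`F₁ J F₂ᵀ` is `F₁ F₂⁻¹ J`. In this form no such hypothesis is needed, and the case `F₁ = F₂` shows
that parallel frames stay symplectic. -/
theorem eventually_mul_J_mul_transpose_eq [IsManifold 𝓘(ℂ, E) ω N]
    (h₁ : ∀ᶠ q' in 𝓝 q, HolAt E F₁ q' ∧ ParallelAt (E := E) T δ F₁ τ q')
    (h₂ : ∀ᶠ q' in 𝓝 q, HolAt E F₂ q' ∧ ParallelAt (E := E) T δ F₂ τ q') :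
    ∀ᶠ q' in 𝓝 q, F₁ q' * Matrix.J (Fin 2) ℂ * (F₂ q').transpose
      = F₁ q * Matrix.J (Fin 2) ℂ * (F₂ q).transpose := by
  refine eventually_eq_of_matDeriv_eq_zero (E := E)
    (A := fun q => F₁ q * Matrix.J (Fin 2) ℂ * (F₂ q).transpose) ?_ ?_
  · filter_upwards [h₁, h₂] with q' h1 h2
    exact (h1.1.mul (holAt_const _ _)).mul h2.1.transpose
  · filter_upwards [h₁, h₂] with q' h1 h2 v
    have hJ := holAt_const (E := E) (Matrix.J (Fin 2) ℂ) q'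
    rw [matDeriv_mul (h1.1.mul hJ) h2.1.transpose, matDeriv_mul h1.1 hJ, matDeriv_const,
      matDeriv_transpose, h1.2 v, h2.2 v, Matrix.transpose_mul]
    generalize hZ : spForm T δ (τ q') (mfderiv 𝓘(ℂ, E) 𝓘(ℂ, Fin 3 → ℂ) τ q' v) = Z
    have hsp : Z * Matrix.J (Fin 2) ℂ + Matrix.J (Fin 2) ℂ * Z.transpose = 0 := by
      rw [← hZ]; exact spForm_mul_J T δ _ _
    calc _ = F₁ q' * (Z * Matrix.J (Fin 2) ℂ + Matrix.J (Fin 2) ℂ * Z.transpose)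
          * (F₂ q').transpose := by noncomm_ring
      _ = 0 := by rw [hsp, mul_zero, zero_mul]

end Connection

/-! ### Local existence of parallel frames -/

section Existence

variable {S : Type*} [TopologicalSpace S] [ChartedSpace ℂ S]
  {P : Type*} [TopologicalSpace P] [ChartedSpace (Fin 3 → ℂ) P]
  [IsManifold 𝓘(ℂ, Fin 3 → ℂ) ω P] {U : Set S}

theorem ProjectiveStructure.analyticAt_conn_mfderiv (T : ProjectiveStructure S P U) {σ : ℂ → P}
    {z₀ : ℂ} (hσ : ∀ᶠ z in 𝓝 z₀, ContMDiffAt 𝓘(ℂ) 𝓘(ℂ, Fin 3 → ℂ) ω σ z) (i j : Fin 2) :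
    AnalyticAt ℂ (fun z => T.conn (σ z) (mfderiv 𝓘(ℂ) 𝓘(ℂ, Fin 3 → ℂ) σ z (1 : ℂ)) i j) z₀ := by
  obtain ⟨W, hW, hWo, hz₀⟩ := eventually_nhds_iff.1 hσ
  have hon : ContMDiffOn 𝓘(ℂ) 𝓘(ℂ, Fin 3 → ℂ) ω σ W := fun z hz => (hW z hz).contMDiffWithinAt
  have ht := hon.contMDiffOn_tangentMapWithin (m := ω) (by simp) hWo.uniqueMDiffOn
  have hs : ContMDiff 𝓘(ℂ) 𝓘(ℂ).tangent ω
      (fun z : ℂ => (⟨z, (1 : ℂ)⟩ : TangentBundle 𝓘(ℂ) ℂ)) := fun z =>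
    contMDiffAt_vectorSpace_iff_contDiffAt.2 contDiffAt_const
  have hcomp : ContMDiffOn 𝓘(ℂ) 𝓘(ℂ) ω
      ((fun w : TangentBundle 𝓘(ℂ, Fin 3 → ℂ) P => T.conn w.proj w.snd i j) ∘
        (tangentMapWithin 𝓘(ℂ) 𝓘(ℂ, Fin 3 → ℂ) σ W) ∘
        (fun z : ℂ => (⟨z, (1 : ℂ)⟩ : TangentBundle 𝓘(ℂ) ℂ))) W :=
    (T.conn_holo i j).comp_contMDiffOn (ht.comp hs.contMDiffOn fun z hz => hz)
  have h1 : ContMDiffAt 𝓘(ℂ) 𝓘(ℂ) ω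
      (fun z => T.conn (σ z) (mfderiv 𝓘(ℂ) 𝓘(ℂ, Fin 3 → ℂ) σ z (1 : ℂ)) i j) z₀ := by
    refine (hcomp.contMDiffAt (hWo.mem_nhds hz₀)).congr_of_eventuallyEq ?_
    filter_upwards [hWo.mem_nhds hz₀] with z hz
    simp only [Function.comp, tangentMapWithin]
    have : (show ℂ →L[ℂ] (Fin 3 → ℂ) from mfderivWithin 𝓘(ℂ) 𝓘(ℂ, Fin 3 → ℂ) σ W z)
      = mfderiv 𝓘(ℂ) 𝓘(ℂ, Fin 3 → ℂ) σ z := mfderivWithin_of_isOpen hWo hz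
    exact congrFun (congrFun (congrArg (T.conn (σ z))
      (congrArg (fun L : ℂ →L[ℂ] (Fin 3 → ℂ) => L (1 : ℂ)) this.symm)) i) j
  exact (contMDiffAt_iff_contDiffAt.1 h1).analyticAt

variable {δ : QuarticDifferential S}

theorem QuarticDifferential.analyticAt_quarticCoeff {s : S} (hs : s ∉ δ.divisorSupport) :
    AnalyticAt ℂ (quarticCoeff δ.toFun s) (chartAt ℂ s s) := by
  have h0 : meromorphicOrderAt (quarticCoeff δ.toFun s) (chartAt ℂ s s) = 0 := by
    by_contra h
    exact hs h
  exact (δ.meromorphic s).meromorphicOrderAt_nonneg_iff_analyticAt.1 h0.ge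

theorem QuarticDifferential.quarticCoeff_ne_zero {s : S} (hs : s ∉ δ.divisorSupport) :
    quarticCoeff δ.toFun s (chartAt ℂ s s) ≠ 0 := by
  have h0 : meromorphicOrderAt (quarticCoeff δ.toFun s) (chartAt ℂ s s) = 0 := by
    by_contra h
    exact hs h
  exact (δ.meromorphic s).meromorphicOrderAt_eq_zero_iff.1 h0

/-- The pull-back of `spForm` by a holomorphic section is holomorphic: a section is transversal to
the fibres, so that the denominator in the definition of `spForm` does not vanish on it. -/
theorem analyticAt_spForm_mfderiv [IsManifold 𝓘(ℂ) ω S] (T : ProjectiveStructure S P U) {σ : S → P}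
    {s₀ : S} (hs₀ : s₀ ∉ δ.divisorSupport)
    (hσ : ∀ᶠ s in 𝓝 s₀, ContMDiffAt 𝓘(ℂ) 𝓘(ℂ, Fin 3 → ℂ) ω σ s)
    (hproj : ∀ᶠ s in 𝓝 s₀, T.proj (σ s) = s) (i j : Ix) :
    AnalyticAt ℂ (fun z => spForm T δ (σ ((chartAt ℂ s₀).symm z)) (mfderiv 𝓘(ℂ) 𝓘(ℂ, Fin 3 → ℂ)
      (fun z => σ ((chartAt ℂ s₀).symm z)) z (1 : ℂ)) i j) (chartAt ℂ s₀ s₀) := by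
  set χ := chartAt ℂ s₀ with hχ
  have hz : χ s₀ ∈ χ.target := mem_chart_target ℂ s₀
  have hinv : χ.symm (χ s₀) = s₀ := χ.left_inv (mem_chart_source ℂ s₀)
  have hs : Filter.Tendsto χ.symm (𝓝 (χ s₀)) (𝓝 s₀) := by
    have := (χ.continuousAt_symm hz).tendsto
    rwa [hinv] at this
  have hσ' : ∀ᶠ z in 𝓝 (χ s₀), ContMDiffAt 𝓘(ℂ) 𝓘(ℂ, Fin 3 → ℂ) ω (fun z => σ (χ.symm z)) z := by
    filter_upwards [hs.eventually hσ, χ.open_target.mem_nhds hz] with z h1 h2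
    exact h1.comp z (contMDiffOn_chart_symm.contMDiffAt (χ.open_target.mem_nhds h2))
  have hconn := T.analyticAt_conn_mfderiv hσ'
  -- The quartic differential in this formula is the local coefficient of `δ`
  have hδ : ∀ᶠ z in 𝓝 (χ s₀), quarticCoeff δ.toFun s₀ z
      = δ.toFun (T.proj (σ (χ.symm z))) (mfderiv 𝓘(ℂ, Fin 3 → ℂ) 𝓘(ℂ) T.proj (σ (χ.symm z))
        (mfderiv 𝓘(ℂ) 𝓘(ℂ, Fin 3 → ℂ) (fun z => σ (χ.symm z)) z (1 : ℂ))) := by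
    filter_upwards [hσ', (hs.eventually hproj.eventually_nhds), χ.open_target.mem_nhds hz]
      with z h1 h2 h3
    have h4 := mfderiv_comp_apply z (T.proj_holo.mdifferentiableAt (by simp) (x := σ (χ.symm z)))
      (h1.mdifferentiableAt (by simp)) (1 : ℂ)
    have h5 : T.proj ∘ (fun z => σ (χ.symm z)) =ᶠ[𝓝 z] χ.symm :=
      (χ.continuousAt_symm h3).eventually h2
    have h6 : (show ℂ →L[ℂ] ℂ from mfderiv 𝓘(ℂ) 𝓘(ℂ) (T.proj ∘ (fun z => σ (χ.symm z))) z)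
      = mfderiv 𝓘(ℂ) 𝓘(ℂ) χ.symm z := h5.mfderiv_eq
    exact δ.toFun_congr h5.eq_of_nhds.symm
      ((congrArg (fun L : ℂ →L[ℂ] ℂ => L (1 : ℂ)) h6.symm).trans h4)
  have hne : T.conn (σ (χ.symm (χ s₀))) (mfderiv 𝓘(ℂ) 𝓘(ℂ, Fin 3 → ℂ) (fun z => σ (χ.symm z)) (χ s₀)
      (1 : ℂ)) 1 0 ≠ 0 := by
    intro h
    have h1 := T.mfderiv_proj_eq_zero h
    have h2 := hδ.self_of_nhds
    refine QuarticDifferential.quarticCoeff_ne_zero hs₀ (h2.trans ?_)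
    exact (δ.toFun_congr rfl h1).trans (δ.toFun_zero _)
  have hquot : AnalyticAt ℂ (fun z => δ.toFun (T.proj (σ (χ.symm z)))
      (mfderiv 𝓘(ℂ, Fin 3 → ℂ) 𝓘(ℂ) T.proj (σ (χ.symm z))
        (mfderiv 𝓘(ℂ) 𝓘(ℂ, Fin 3 → ℂ) (fun z => σ (χ.symm z)) z (1 : ℂ))) /
      (-(6 * cbrt (1 / 6) ^ 2 * T.conn (σ (χ.symm z)) (mfderiv 𝓘(ℂ) 𝓘(ℂ, Fin 3 → ℂ)
        (fun z => σ (χ.symm z)) z (1 : ℂ)) 1 0)) ^ 3) (χ s₀) := by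
    refine ((QuarticDifferential.analyticAt_quarticCoeff hs₀).congr hδ).fun_div
      ((analyticAt_const.mul (hconn 1 0)).neg.pow 3) ?_
    exact pow_ne_zero 3 (neg_ne_zero.2 (mul_ne_zero (mul_ne_zero (by norm_num)
      (pow_ne_zero 2 cbrt_sixth_ne_zero)) hne))
  simp only [spForm, adaptedForm_eq]
  generalize cbrt (1 / 6) = k at *
  have h00 := hconn 0 0
  have h01 := hconn 0 1
  have h10 := hconn 1 0
  have h11 := hconn 1 1
  rcases i with i | i <;> rcases j with j | j <;> fin_cases i <;> fin_cases j <;>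
    simp <;> fun_prop

/-- Over a holomorphic section near a point that is neither a zero nor a pole of `δ`, there is a
holomorphic parallel frame with values in the symplectic group. -/
theorem exists_parallelAt [IsManifold 𝓘(ℂ) ω S] (T : ProjectiveStructure S P U) {σ : S → P} {s₀ : S}
    (hs₀ : s₀ ∉ δ.divisorSupport)
    (hσ : ∀ᶠ s in 𝓝 s₀, ContMDiffAt 𝓘(ℂ) 𝓘(ℂ, Fin 3 → ℂ) ω σ s)
    (hproj : ∀ᶠ s in 𝓝 s₀, T.proj (σ s) = s) :
    ∃ F : S → Matrix Ix Ix ℂ, ∀ᶠ s in 𝓝 s₀,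
      HolAt ℂ F s ∧ F s ∈ Sp ∧ ParallelAt (E := ℂ) T δ F σ s := by
  set χ := chartAt ℂ s₀ with hχ
  have hz : χ s₀ ∈ χ.target := mem_chart_target ℂ s₀
  have hinv : χ.symm (χ s₀) = s₀ := χ.left_inv (mem_chart_source ℂ s₀)
  have hs : Filter.Tendsto χ.symm (𝓝 (χ s₀)) (𝓝 s₀) := by
    have := (χ.continuousAt_symm hz).tendsto
    rwa [hinv] at this
  obtain ⟨F, hF1, hF⟩ := exists_matrix_hasDerivAt_mul_of_analyticAt
    (Z := fun z => spForm T δ (σ (χ.symm z)) (mfderiv 𝓘(ℂ) 𝓘(ℂ, Fin 3 → ℂ)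
      (fun z => σ (χ.symm z)) z (1 : ℂ))) (fun i j => analyticAt_spForm_mfderiv T hs₀ hσ hproj i j)
  -- The solution of the differential equation is parallel over `σ` in the coordinate
  have hhol : ∀ᶠ z in 𝓝 (χ s₀), HolAt ℂ F z := by
    filter_upwards [hF.eventually_nhds] with z hz' i j
    have : AnalyticAt ℂ (fun z => F z i j) z :=
      Complex.analyticAt_iff_eventually_differentiableAt.2
        (hz'.mono fun w hw => (hw i j).differentiableAt)
    exact this.contDiffAt.contMDiffAt
  have hpar : ∀ᶠ z in 𝓝 (χ s₀), ParallelAt (E := ℂ) T δ F (fun z => σ (χ.symm z)) z := by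
    filter_upwards [hF, hhol] with z hz' hz'' v
    have hv : ∀ w : ℂ, w = w • (1 : ℂ) := fun w => by simp
    have h1 : ∀ w : ℂ, spForm T δ (σ (χ.symm z)) (mfderiv 𝓘(ℂ) 𝓘(ℂ, Fin 3 → ℂ)
        (fun z => σ (χ.symm z)) z w) = w • spForm T δ (σ (χ.symm z)) (mfderiv 𝓘(ℂ) 𝓘(ℂ, Fin 3 → ℂ)
        (fun z => σ (χ.symm z)) z (1 : ℂ)) := by
      intro w
      rw [← spForm_smul]
      refine congrArg (spForm T δ (σ (χ.symm z))) ?_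
      exact (congrArg (mfderiv 𝓘(ℂ) 𝓘(ℂ, Fin 3 → ℂ) (fun z => σ (χ.symm z)) z : ℂ →L[ℂ] _)
        (hv w)).trans (map_smul (mfderiv 𝓘(ℂ) 𝓘(ℂ, Fin 3 → ℂ) (fun z => σ (χ.symm z)) z :
          ℂ →L[ℂ] (Fin 3 → ℂ)) w (1 : ℂ))
    refine Eq.trans ?_ (congrArg (fun B => F z * B) (h1 v)).symm
    ext i j
    have h2 := (hz' i j).hasFDerivAt.hasMFDerivAt.mfderiv
    refine (congrArg (fun L : ℂ →L[ℂ] ℂ => L v) h2).trans ?_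
    exact congrFun (congrFun (Matrix.mul_smul (F z) (show ℂ from v) _).symm i) j
  refine ⟨fun s => F (χ s), ?_⟩
  have hχs : ContinuousAt χ s₀ := χ.continuousAt (mem_chart_source ℂ s₀)
  have hmain : ∀ᶠ s in 𝓝 s₀, HolAt ℂ (fun s => F (χ s)) s ∧
      ParallelAt (E := ℂ) T δ (fun s => F (χ s)) σ s := by
    filter_upwards [hχs.eventually hhol, hχs.eventually hpar, chart_source_mem_nhds ℂ s₀,
      hσ] with s h1 h2 h3 h4
    have hχ1 : ContMDiffAt 𝓘(ℂ) 𝓘(ℂ) ω χ s :=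
      contMDiffOn_chart.contMDiffAt (χ.open_source.mem_nhds h3)
    refine ⟨h1.comp hχ1, ?_⟩
    have hσs : MDifferentiableAt 𝓘(ℂ) 𝓘(ℂ, Fin 3 → ℂ) (fun z => σ (χ.symm z)) (χ s) := by
      have h5 : ContMDiffAt 𝓘(ℂ) 𝓘(ℂ, Fin 3 → ℂ) ω σ (χ.symm (χ s)) := by rwa [χ.left_inv h3]
      exact (h5.comp (χ s) (contMDiffOn_chart_symm.contMDiffAt
        (χ.open_target.mem_nhds (χ.map_source h3)))).mdifferentiableAt (by simp)
    refine (h2.comp h1 hσs (hχ1.mdifferentiableAt (by simp))).congr Filter.EventuallyEq.rfl ?_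
    filter_upwards [χ.open_source.mem_nhds h3] with s' hs'
    rw [χ.left_inv hs']
  filter_upwards [hmain, eventually_mul_J_mul_transpose_eq hmain hmain] with s h1 h2
  refine ⟨h1.1, ?_, h1.2⟩
  change F (χ s) ∈ Matrix.symplecticGroup (Fin 2) ℂ
  rw [SymplecticGroup.mem_iff, h2, hF1]
  simp

end Existence

/-! ### The global equivariant frame -/

theorem mul_mem_Sp {A B : Matrix Ix Ix ℂ} (hA : A ∈ Sp) (hB : B ∈ Sp) : A * B ∈ Sp :=
  (Matrix.symplecticGroup (Fin 2) ℂ).mul_mem hA hB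

section Global

variable {S : Type*} [TopologicalSpace S] [ChartedSpace ℂ S]
  {P : Type*} [TopologicalSpace P] [ChartedSpace (Fin 3 → ℂ) P] {U : Set S}

/-- A local trivialization of a principal bundle over the open set `V`: a holomorphic section `σ`
and the holomorphic map `g` with `y = σ (proj y) · g y`. -/
structure PrincipalBundle.IsTrivialization (T : PrincipalBundle S P U) (V : Set S) (σ : S → P)
    (g : P → Borel) : Prop where
  isOpen : IsOpen V
  holo : ∀ s ∈ V, ContMDiffAt 𝓘(ℂ) 𝓘(ℂ, Fin 3 → ℂ) ω σ s
  proj_section : ∀ s ∈ V, T.proj (σ s) = s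
  act_coord : ∀ y, T.proj y ∈ V → T.act (σ (T.proj y)) (g y) = y
  coord_holo : ∀ y, T.proj y ∈ V → HolAt (Fin 3 → ℂ) (fun y => bmat (g y)) y

theorem PrincipalBundle.act_injective (T : PrincipalBundle S P U) (y : P) :
    Function.Injective (T.act y) := by
  intro a b h
  have : T.act y (a * b⁻¹) = y := by
    rw [T.act_mul, h, ← T.act_mul, mul_inv_cancel, T.act_one]
  exact mul_inv_eq_one.1 (T.act_free y _ this)

theorem PrincipalBundle.IsTrivialization.coord_act {T : PrincipalBundle S P U} {V : Set S}
    {σ : S → P} {g : P → Borel} (h : T.IsTrivialization V σ g) {y : P}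
    (hy : T.proj y ∈ V) (x : Borel) :
    g (T.act y x) = g y * x := by
  apply T.act_injective (σ (T.proj y))
  rw [T.act_mul, h.act_coord y hy]
  have := h.act_coord (T.act y x) (by rwa [T.proj_act])
  rwa [T.proj_act] at this

theorem PrincipalBundle.IsTrivialization.mono {T : PrincipalBundle S P U} {V W : Set S} {σ : S → P}
    {g : P → Borel} (h : T.IsTrivialization V σ g) (hW : IsOpen W) (hWV : W ⊆ V) :
    T.IsTrivialization W σ g :=
  ⟨hW, fun s hs => h.holo s (hWV hs), fun s hs => h.proj_section s (hWV hs),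
    fun y hy => h.act_coord y (hWV hy), fun y hy => h.coord_holo y (hWV hy)⟩

theorem PrincipalBundle.exists_isTrivialization (T : PrincipalBundle S P U) {s₀ : S}
    (hs₀ : s₀ ∈ U) : ∃ V σ g, s₀ ∈ V ∧ T.IsTrivialization V σ g := by
  obtain ⟨V, σ, g, hV, hs, -, h1, h2, h3, h4⟩ := T.locally_trivial s₀ hs₀
  refine ⟨V, σ, g, hs, hV, fun s hs => h1.contMDiffAt (hV.mem_nhds hs), h2, h3, fun y hy i j => ?_⟩
  exact (h4 i j).contMDiffAt ((hV.preimage T.proj_holo.continuous).mem_nhds hy)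

variable [IsManifold 𝓘(ℂ, Fin 3 → ℂ) ω P]

/-- A local trivialization together with a holomorphic parallel frame `F` over its section, with
values in the symplectic group. -/
structure IsParallelFrame (T : ProjectiveStructure S P U) (δ : QuarticDifferential S) (V : Set S)
    (σ : S → P) (g : P → Borel) (F : S → Matrix Ix Ix ℂ) : Prop
    extends T.toPrincipalBundle.IsTrivialization V σ g where
  frame_holo : ∀ s ∈ V, HolAt ℂ F s
  frame_mem : ∀ s ∈ V, F s ∈ Sp
  parallel : ∀ s ∈ V, ParallelAt (E := ℂ) T δ F σ s

variable {T : ProjectiveStructure S P U} {δ : QuarticDifferential S}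

theorem IsParallelFrame.const_mul {V : Set S} {σ : S → P} {g : P → Borel} {F : S → Matrix Ix Ix ℂ}
    (h : IsParallelFrame T δ V σ g F) {C : Matrix Ix Ix ℂ} (hC : C ∈ Sp) :
    IsParallelFrame T δ V σ g (fun s => C * F s) :=
  { h with
    frame_holo := fun s hs => (holAt_const C s).mul (h.frame_holo s hs)
    frame_mem := fun s hs => mul_mem_Sp hC (h.frame_mem s hs)
    parallel := fun s hs => (h.parallel s hs).const_mul (h.frame_holo s hs) C }

variable [IsManifold 𝓘(ℂ) ω S]

theorem exists_isParallelFrame (T : ProjectiveStructure S P U) (δ : QuarticDifferential S) {s₀ : S}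
    (hs₀ : s₀ ∈ U) (hδ : s₀ ∉ δ.divisorSupport) :
    ∃ V σ g F, s₀ ∈ V ∧ IsParallelFrame T δ V σ g F := by
  obtain ⟨V, σ, g, hs, h⟩ := T.exists_isTrivialization hs₀
  have hV := h.isOpen.mem_nhds hs
  obtain ⟨F, hF⟩ := exists_parallelAt T hδ (Filter.mem_of_superset hV h.holo)
    (Filter.mem_of_superset hV h.proj_section)
  obtain ⟨W, hW, hWo, hsW⟩ := eventually_nhds_iff.1 (hF.and hV)
  exact ⟨W, σ, g, F, hsW,
    { h.mono hWo (fun s hs => (hW s hs).2) with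
      frame_holo := fun s hs => (hW s hs).1.1
      frame_mem := fun s hs => (hW s hs).1.2.1
      parallel := fun s hs => (hW s hs).1.2.2 }⟩

/-- The transition functions between parallel frames are locally constant, after the frame over `σ₁`
has been moved to the section `σ₂ = σ₁ · g₁(σ₂)`. -/
theorem IsParallelFrame.eventually_transition_eq {V₁ V₂ : Set S} {σ₁ σ₂ : S → P} {g₁ g₂ : P → Borel}
    {F₁ F₂ : S → Matrix Ix Ix ℂ} (h₁ : IsParallelFrame T δ V₁ σ₁ g₁ F₁)
    (h₂ : IsParallelFrame T δ V₂ σ₂ g₂ F₂) {s : S} (hs : s ∈ V₁ ∩ V₂) :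
    ∀ᶠ s' in 𝓝 s, F₁ s' * symRep (bmat (g₁ (σ₂ s'))) * Matrix.J (Fin 2) ℂ * (F₂ s').transpose
      = F₁ s * symRep (bmat (g₁ (σ₂ s))) * Matrix.J (Fin 2) ℂ * (F₂ s).transpose := by
  have hV : IsOpen (V₁ ∩ V₂) := h₁.isOpen.inter h₂.isOpen
  have hx : ∀ s' ∈ V₁ ∩ V₂, HolAt ℂ (fun s => bmat (g₁ (σ₂ s))) s' := by
    intro s' hs'
    exact (h₁.coord_holo (σ₂ s') (by rw [h₂.proj_section s' hs'.2]; exact hs'.1)).comp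
      (h₂.holo s' hs'.2)
  refine eventually_mul_J_mul_transpose_eq (E := ℂ) (T := T) (δ := δ) (τ := σ₂)
    (F₁ := fun s' => F₁ s' * symRep (bmat (g₁ (σ₂ s')))) (F₂ := F₂) ?_ ?_
  · filter_upwards [hV.mem_nhds hs] with s' hs'
    refine ⟨(h₁.frame_holo s' hs'.1).mul (hx s' hs').symRep, ?_⟩
    refine ((h₁.parallel s' hs'.1).act (h₁.frame_holo s' hs'.1) (h₁.holo s' hs'.1)
      (hx s' hs')).congr Filter.EventuallyEq.rfl ?_
    filter_upwards [hV.mem_nhds hs'] with t ht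
    have := h₁.act_coord (σ₂ t) (by rw [h₂.proj_section t ht.2]; exact ht.1)
    rw [h₂.proj_section t ht.2] at this
    exact this.symm
  · filter_upwards [hV.mem_nhds hs] with s' hs'
    exact ⟨h₂.frame_holo s' hs'.2, h₂.parallel s' hs'.2⟩

/-- On a simply connected space over the base, away from the divisor of `δ`, the parallel frames can
be chosen so that they fit together to one equivariant map `Ψ`. -/
theorem exists_global_frame {M : Type*} [TopologicalSpace M] [SimplyConnectedSpace M]
    [LocallyPathConnectedSpace M] (T : ProjectiveStructure S P U) (δ : QuarticDifferential S)
    {p : M → S} (hp : Continuous p) (hU : ∀ q, p q ∈ U) (hδ : ∀ q, p q ∉ δ.divisorSupport) :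
    ∃ Ψ : M → P → Matrix Ix Ix ℂ, ∀ q₀, ∃ V σ g F, p q₀ ∈ V ∧ IsParallelFrame T δ V σ g F ∧
      ∀ᶠ q in 𝓝 q₀, ∀ y, T.proj y = p q → Ψ q y = F (p q) * symRep (bmat (g y)) := by
  choose V σ g F hV hF using fun q => exists_isParallelFrame T δ (hU q) (hδ q)
  -- The frames are compared at an arbitrary point `r q` of the fibre over `p q`.
  let r : M → P := fun q => σ q (p q)
  have hr : ∀ q, T.proj (r q) = p q := fun q => (hF q).proj_section _ (hV q)
  have hmem : ∀ i q, p q ∈ V i → F i (p q) * symRep (bmat (g i (r q))) ∈ Sp := fun i q h =>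
    mul_mem_Sp ((hF i).frame_mem _ h) (symRep_bmat_mem _)
  classical
  let K : M → M → Matrix.symplecticGroup (Fin 2) ℂ := fun i q =>
    if h : p q ∈ V i then ⟨F i (p q) * symRep (bmat (g i (r q))), hmem i q h⟩ else 1
  have hK : ∀ i q, p q ∈ V i →
      (K i q : Matrix Ix Ix ℂ) = F i (p q) * symRep (bmat (g i (r q))) := by
    intro i q h
    simp only [K, dif_pos h]
  have hKK : ∀ i j q, p q ∈ V i → p q ∈ V j →
      ((K i q * (K j q)⁻¹ : Matrix.symplecticGroup (Fin 2) ℂ) : Matrix Ix Ix ℂ)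
        = -(F i (p q) * symRep (bmat (g i (σ j (p q)))) * Matrix.J (Fin 2) ℂ *
          (F j (p q)).transpose) * Matrix.J (Fin 2) ℂ := by
    intro i j q hi hj
    have h1 : g i (r q) = g i (σ j (p q)) * g j (r q) := by
      have h2 := (hF j).act_coord (r q) (by rw [hr]; exact hj)
      rw [hr] at h2
      conv_lhs => rw [← h2]
      exact (hF i).coord_act (by rw [(hF j).proj_section _ hj]; exact hi) _
    let A : Matrix.symplecticGroup (Fin 2) ℂ := ⟨F i (p q), (hF i).frame_mem _ hi⟩
    let B : Matrix.symplecticGroup (Fin 2) ℂ := ⟨F j (p q), (hF j).frame_mem _ hj⟩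
    let X : Matrix.symplecticGroup (Fin 2) ℂ := ⟨_, symRep_bmat_mem (g i (σ j (p q)))⟩
    let G : Matrix.symplecticGroup (Fin 2) ℂ := ⟨_, symRep_bmat_mem (g j (r q))⟩
    have hKi : K i q = A * X * G := by
      apply Subtype.ext
      rw [hK i q hi, h1, bmat_mul, symRep_mul]
      exact (mul_assoc _ _ _).symm
    have hKj : K j q = B * G := by
      apply Subtype.ext
      rw [hK j q hj]
      rfl
    rw [hKi, hKj, mul_inv_rev, mul_assoc (A * X), mul_inv_cancel_left]
    change F i (p q) * symRep (bmat (g i (σ j (p q)))) *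
      ((-Matrix.J (Fin 2) ℂ) * (F j (p q)).transpose * Matrix.J (Fin 2) ℂ) = _
    noncomm_ring
  obtain ⟨L, hL⟩ := exists_mul_inv_locally_constant (fun i => p ⁻¹' V i)
    (fun i => (hF i).isOpen.preimage hp) hV K (by
      rintro i j q ⟨hi, hj⟩
      have h1 := (hp.tendsto q).eventually ((hF i).eventually_transition_eq (hF j) ⟨hi, hj⟩)
      filter_upwards [h1, ((hF i).isOpen.preimage hp).mem_nhds hi,
        ((hF j).isOpen.preimage hp).mem_nhds hj] with q' h2 hi' hj'
      apply Subtype.ext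
      rw [hKK i j q' hi' hj', hKK i j q hi hj, h2])
  refine ⟨fun q y => (L q : Matrix Ix Ix ℂ) * symRep (bmat ((g q (r q))⁻¹ * g q y)), fun q₀ => ?_⟩
  refine ⟨V q₀, σ q₀, g q₀, fun s => ((L q₀ * (K q₀ q₀)⁻¹ : Matrix.symplecticGroup (Fin 2) ℂ) :
    Matrix Ix Ix ℂ) * F q₀ s, hV q₀, (hF q₀).const_mul (L q₀ * (K q₀ q₀)⁻¹).2, ?_⟩
  filter_upwards [hL q₀ q₀ (hV q₀), ((hF q₀).isOpen.preimage hp).mem_nhds (hV q₀)] with q h1 h2 y hy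
  have hx : g q₀ y = g q₀ (r q) * ((g q (r q))⁻¹ * g q y) := by
    rw [← (hF q₀).coord_act (by rw [hr]; exact h2)]
    congr 1
    have h3 := (hF q).act_coord y (by rw [hy]; exact hV q)
    have h4 := (hF q).act_coord (r q) (by rw [hr]; exact hV q)
    rw [hy] at h3
    rw [hr] at h4
    rw [← h4, ← T.act_mul, h4, mul_inv_cancel_left, h3]
  have hLq : L q = L q₀ * (K q₀ q₀)⁻¹ * K q₀ q := by rw [← h1, inv_mul_cancel_right]
  rw [hx, bmat_mul (g q₀ (r q)), symRep_mul (bmat (g q₀ (r q))), hLq, Submonoid.coe_mul, hK q₀ q h2]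
  simp only [mul_assoc]

end Global

/-! ### Uniqueness of adapted frames -/

/-- The shape of the Maurer-Cartan form of an adapted frame, with `u = φ²₂`, `v = φ²₄`, `w = φ⁴₂`
and `d = φ¹₃`. -/
noncomputable def adaptedShape (u v w d : ℂ) : Matrix Ix Ix ℂ :=
  Matrix.fromBlocks !![3 * u, 3 / 4 * v; w, u] !![d, 0; 0, v] !![0, 0; 0, w]
    !![-(3 * u), -w; -(3 / 4 * v), -u]

theorem sympl_columns {A : Matrix Ix Ix ℂ} (hA : A ∈ Sp) (i j : Ix) :
    sympl (fun k => A k i) (fun k => A k j) = -Matrix.J (Fin 2) ℂ i j := by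
  have h := congrFun (congrFun (SymplecticGroup.mem_iff'.1 hA) i) j
  rw [← h]
  simp [sympl, Matrix.mul_apply, Fintype.sum_sum_type, Fin.sum_univ_two, Matrix.J]
  ring

theorem isUnit_det_of_mem_Sp {A : Matrix Ix Ix ℂ} (hA : A ∈ Sp) : IsUnit A.det :=
  SymplecticGroup.symplectic_det hA

theorem inv_eq_of_mem_Sp {A : Matrix Ix Ix ℂ} (hA : A ∈ Sp) :
    A⁻¹ = -Matrix.J (Fin 2) ℂ * A.transpose * Matrix.J (Fin 2) ℂ :=
  SymplecticGroup.inv_eq_symplectic_inv A hA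

theorem inv_mem_Sp {A : Matrix Ix Ix ℂ} (hA : A ∈ Sp) : A⁻¹ ∈ Sp := by
  have h := (((⟨A, hA⟩ : Matrix.symplecticGroup (Fin 2) ℂ))⁻¹).2
  rwa [SymplecticGroup.coe_inv'] at h

section Frames

variable {E N : Type*} [NormedAddCommGroup E] [NormedSpace ℂ E] [TopologicalSpace N]
  [ChartedSpace E N]

/-- The Maurer-Cartan form of a symplectic frame takes its values in the symplectic Lie algebra, by
differentiation of `Aᵀ J A = J`. -/
theorem maurerCartan_mem_lieAlgebra {A : N → Matrix Ix Ix ℂ} {q : N} (hA : HolAt E A q)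
    (hSp : ∀ᶠ q' in 𝓝 q, A q' ∈ Sp) (v : TangentSpace 𝓘(ℂ, E) q) :
    (maurerCartan A q v).transpose * Matrix.J (Fin 2) ℂ
      + Matrix.J (Fin 2) ℂ * maurerCartan A q v = 0 := by
  have hq := hSp.self_of_nhds
  have hJ := holAt_const (E := E) (Matrix.J (Fin 2) ℂ) q
  have h0 : matDeriv (fun q => (A q).transpose * Matrix.J (Fin 2) ℂ * A q) q v = 0 := by
    rw [← matDeriv_const (N := N) (Matrix.J (Fin 2) ℂ) q v]
    exact matDeriv_congr (hSp.mono fun q' h => SymplecticGroup.mem_iff'.1 h) v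
  rw [matDeriv_mul (hA.transpose.mul hJ) hA, matDeriv_mul hA.transpose hJ, matDeriv_const, mul_zero,
    add_zero, matDeriv_transpose] at h0
  have hd : matDeriv A q v = A q * maurerCartan A q v := by
    rw [maurerCartan_eq, Matrix.mul_nonsing_inv_cancel_left _ _ (isUnit_det_of_mem_Sp hq)]
  have hq' : (A q).transpose * Matrix.J (Fin 2) ℂ * A q = Matrix.J (Fin 2) ℂ :=
    SymplecticGroup.mem_iff'.1 hq
  rw [hd, Matrix.transpose_mul] at h0
  calc _ = (maurerCartan A q v).transpose * ((A q).transpose * Matrix.J (Fin 2) ℂ * A q)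
        + ((A q).transpose * Matrix.J (Fin 2) ℂ * A q) * maurerCartan A q v := by rw [hq']
    _ = _ := by rw [← h0]; simp only [mul_assoc]

end Frames

/-- The matrix of change between symplectic matrices whose first two columns span the same plane is
block upper triangular. -/
theorem transition_lowerLeft_eq_zero {A B : Matrix Ix Ix ℂ} (hA : A ∈ Sp)
    (h : Submodule.span ℂ {(fun i => A i i1), (fun i => A i i2)}
      = Submodule.span ℂ {(fun i => B i i1), (fun i => B i i2)}) (i j : Fin 2) :
    (A⁻¹ * B) (Sum.inr i) (Sum.inl j) = 0 := by
  have hmem : (fun k => B k (Sum.inl j))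
      ∈ Submodule.span ℂ {(fun i => A i i1), (fun i => A i i2)} := by
    rw [h]
    apply Submodule.subset_span
    fin_cases j <;> simp
  obtain ⟨a, b, hab⟩ := Submodule.mem_span_pair.1 hmem
  have h1 := Matrix.nonsing_inv_mul A (isUnit_det_of_mem_Sp hA)
  have e1 := congrFun (congrFun h1 (Sum.inr i)) i1
  have e2 := congrFun (congrFun h1 (Sum.inr i)) i2
  rw [Matrix.mul_apply] at e1 e2 ⊢
  have : ∀ k, B k (Sum.inl j) = a * A k i1 + b * A k i2 := fun k => (congrFun hab k).symm
  simp only [this, mul_add, Finset.sum_add_distrib, mul_left_comm _ a, mul_left_comm _ b,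
    ← Finset.mul_sum, e1, e2]
  simp

section Adapted

variable {M : Type*} [TopologicalSpace M] [ChartedSpace ℂ M]

theorem IsSymplecticFrame.holAt {f : M → Quadric} {U : Set M} {A : M → Matrix Ix Ix ℂ}
    (h : IsSymplecticFrame f U A) {q : M} (hq : q ∈ U) : HolAt ℂ A q := fun i j =>
  (h.2.1 i j).contMDiffAt (h.1.mem_nhds hq)

theorem IsSymplecticFrame.mono {f : M → Quadric} {U W : Set M} {A : M → Matrix Ix Ix ℂ}
    (h : IsSymplecticFrame f U A) (hW : IsOpen W) (hWU : W ⊆ U) : IsSymplecticFrame f W A :=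
  ⟨hW, fun i j => (h.2.1 i j).mono hWU, fun q hq => h.2.2 q (hWU hq)⟩

theorem IsAdaptedFrame.mono {f : M → Quadric} {U W : Set M} {A : M → Matrix Ix Ix ℂ}
    (h : IsAdaptedFrame f U A) (hW : IsOpen W) (hWU : W ⊆ U) : IsAdaptedFrame f W A :=
  ⟨h.1.mono hW hWU, fun q hq => h.2 q (hWU hq)⟩

theorem IsAdaptedFrame.maurerCartan_eq_adaptedShape {f : M → Quadric} {U : Set M}
    {A : M → Matrix Ix Ix ℂ} (h : IsAdaptedFrame f U A) {q : M} (hq : q ∈ U)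
    (v : TangentSpace 𝓘(ℂ) q) :
    maurerCartan A q v = adaptedShape (maurerCartan A q v i2 i2) (maurerCartan A q v i2 i4)
      (maurerCartan A q v i4 i2) (maurerCartan A q v i1 i3) := by
  have h1 := h.2 q hq v
  have h2 := maurerCartan_mem_lieAlgebra (h.1.holAt hq)
    (Filter.mem_of_superset (h.1.1.mem_nhds hq) fun q' hq' => (h.1.2.2 q' hq').1) v
  obtain ⟨e1, e2, e3, e4, e5, e6, -⟩ := h1
  generalize maurerCartan A q v = φ at *
  have h3 := fun i j => congrFun (congrFun h2 i) j
  have f1 := h3 i1 i3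
  have f2 := h3 i1 i4
  have f3 := h3 i2 i3
  have f4 := h3 i2 i4
  have f5 := h3 i3 i4
  have f6 := h3 i1 i2
  simp [Matrix.J, Matrix.mul_apply, Fintype.sum_sum_type, Fin.sum_univ_two] at f1 f2 f3 f4 f5 f6
  ext i j
  rcases i with i | i <;> rcases j with j | j <;> fin_cases i <;> fin_cases j <;>
    simp [adaptedShape] <;> grind

end Adapted

section Transition

variable {M : Type*} [TopologicalSpace M] [ChartedSpace ℂ M]

theorem tendsto_coordLine (q : M) (v : TangentSpace 𝓘(ℂ) q) :
    Filter.Tendsto (coordLine q v) (𝓝 0) (𝓝 q) := by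
  have h1 : Filter.Tendsto (fun t : ℂ => (fun w : ℂ => extChartAt 𝓘(ℂ) q q + t • w) v) (𝓝 0)
      (𝓝 (extChartAt 𝓘(ℂ) q q)) := by
    have := (hasDerivAt_affineLine (extChartAt 𝓘(ℂ) q q) (show ℂ from v)).continuousAt.tendsto
    rwa [affineLine_zero] at this
  have h2 := (continuousAt_extChartAt_symm (I := 𝓘(ℂ)) q).tendsto
  rw [extChartAt_to_inv] at h2
  exact h2.comp h1

theorem exists_tangent_ne_zero (q : M) : ∃ v : TangentSpace 𝓘(ℂ) q, v ≠ 0 :=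
  ⟨(1 : ℂ), (one_ne_zero : (1 : ℂ) ≠ 0)⟩

theorem symplectic_relations_of_lowerLeft {h : Matrix Ix Ix ℂ} (hh : h ∈ Sp)
    (l : ∀ i j, h (Sum.inr i) (Sum.inl j) = 0) :
    h i1 i1 * h i3 i3 + h i2 i1 * h i4 i3 = 1 ∧
    h i1 i1 * h i3 i4 + h i2 i1 * h i4 i4 = 0 ∧
    h i1 i2 * h i3 i3 + h i2 i2 * h i4 i3 = 0 ∧
    h i1 i2 * h i3 i4 + h i2 i2 * h i4 i4 = 1 ∧
    h i1 i3 * h i3 i4 - h i3 i3 * h i1 i4 + h i2 i3 * h i4 i4 - h i4 i3 * h i2 i4 = 0 := by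
  have s := sympl_columns hh
  have s1 := s i1 i3
  have s2 := s i1 i4
  have s3 := s i2 i3
  have s4 := s i2 i4
  have s5 := s i3 i4
  simp [sympl, Matrix.J, l] at s1 s2 s3 s4 s5
  refine ⟨s1, s2, s3, s4, ?_⟩
  linear_combination s5

/-- The matrix `h` of change between two adapted frames over `W`, with the Maurer-Cartan forms `φ`
and `φ'`. Only what the comparison of the frames needs is recorded: `h` is symplectic and block
upper triangular, both forms have the shape of adapted frames, and `h φ' = φ h + dh`. The conclusions
below determine `h` by the entries `s = h¹₂`, `t = h²₂`, with `h⁴₄ = t⁻¹`. -/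
structure IsAdaptedTransition (W : Set M) (h : M → Matrix Ix Ix ℂ)
    (φ φ' : ∀ q : M, TangentSpace 𝓘(ℂ) q → Matrix Ix Ix ℂ) : Prop where
  isOpen : IsOpen W
  holo : ∀ q ∈ W, HolAt ℂ h q
  mem_Sp : ∀ q ∈ W, h q ∈ Sp
  lowerLeft : ∀ q ∈ W, ∀ i j, h q (Sum.inr i) (Sum.inl j) = 0
  shape : ∀ q ∈ W, ∀ v : TangentSpace 𝓘(ℂ) q, v ≠ 0 → ∃ a b c d a' b' c' d', c ≠ 0 ∧
    φ q v = adaptedShape a b c d ∧ φ' q v = adaptedShape a' b' c' d'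
  gauge : ∀ q ∈ W, ∀ v : TangentSpace 𝓘(ℂ) q, h q * φ' q v = φ q v * h q + matDeriv h q v

namespace IsAdaptedTransition

variable {W : Set M} {h : M → Matrix Ix Ix ℂ}
  {φ φ' : ∀ q : M, TangentSpace 𝓘(ℂ) q → Matrix Ix Ix ℂ}

/-- An identity between functions of `h` that holds on all of `W` may be differentiated. -/
theorem deriv_eq (H : IsAdaptedTransition W h φ φ') {f g : Matrix Ix Ix ℂ → ℂ}
    (hfg : ∀ q ∈ W, f (h q) = g (h q)) {q : M} (hq : q ∈ W)
    (v : TangentSpace 𝓘(ℂ) q) {f' g' : ℂ} (hf : HasDerivAt (fun t => f (h (coordLine q v t))) f' 0)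
    (hg : HasDerivAt (fun t => g (h (coordLine q v t))) g' 0) : f' = g' := by
  have : (fun t => f (h (coordLine q v t))) =ᶠ[𝓝 0] fun t => g (h (coordLine q v t)) :=
    (tendsto_coordLine q v).eventually (Filter.mem_of_superset (H.isOpen.mem_nhds hq) hfg)
  exact (hf.congr_of_eventuallyEq this.symm).unique hg

theorem hasDerivAt (H : IsAdaptedTransition W h φ φ') {q : M} (hq : q ∈ W)
    (v : TangentSpace 𝓘(ℂ) q) (i j : Ix) :
    HasDerivAt (fun t => h (coordLine q v t) i j) (matDeriv h q v i j) 0 :=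
  (H.holo q hq).hasDerivAt v i j

theorem symplectic_relations (H : IsAdaptedTransition W h φ φ') {q : M} (hq : q ∈ W) :
    h q i1 i1 * h q i3 i3 + h q i2 i1 * h q i4 i3 = 1 ∧
    h q i1 i1 * h q i3 i4 + h q i2 i1 * h q i4 i4 = 0 ∧
    h q i1 i2 * h q i3 i3 + h q i2 i2 * h q i4 i3 = 0 ∧
    h q i1 i2 * h q i3 i4 + h q i2 i2 * h q i4 i4 = 1 ∧
    h q i1 i3 * h q i3 i4 - h q i3 i3 * h q i1 i4 + h q i2 i3 * h q i4 i4
      - h q i4 i3 * h q i2 i4 = 0 :=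
  symplectic_relations_of_lowerLeft (H.mem_Sp q hq) (H.lowerLeft q hq)

theorem matDeriv_lowerLeft (H : IsAdaptedTransition W h φ φ') {q : M} (hq : q ∈ W)
    (v : TangentSpace 𝓘(ℂ) q) (i j : Fin 2) : matDeriv h q v (Sum.inr i) (Sum.inl j) = 0 :=
  H.deriv_eq (f := fun B => B (Sum.inr i) (Sum.inl j)) (g := fun _ => 0)
    (fun q hq => H.lowerLeft q hq i j) hq v (H.hasDerivAt hq v _ _) (hasDerivAt_const _ _)

/-- The equation `φ⁴₁ = 0` of both frames makes the diagonal blocks triangular. -/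
theorem triangular (H : IsAdaptedTransition W h φ φ') {q : M} (hq : q ∈ W) :
    h q i2 i1 = 0 ∧ h q i3 i4 = 0 ∧ h q i2 i2 * h q i4 i4 = 1 := by
  obtain ⟨s1, s2, s3, s4, -⟩ := H.symplectic_relations hq
  obtain ⟨v, hv⟩ := exists_tangent_ne_zero q
  obtain ⟨a, b, c, d, a', b', c', d', hc, hφ, hφ'⟩ := H.shape q hq v hv
  have e := congrFun (congrFun (H.gauge q hq v) i4) i1
  rw [hφ, hφ'] at e
  simp [Matrix.mul_apply, Fintype.sum_sum_type, Fin.sum_univ_two, adaptedShape,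
    H.lowerLeft q hq, H.matDeriv_lowerLeft hq] at e
  have h21 : h q i2 i1 = 0 := by
    rcases e with e | e
    · exact absurd e hc
    · exact e
  rw [h21] at s1 s2
  have h34 : h q i3 i4 = 0 := by
    have : h q i1 i1 ≠ 0 := by
      intro h0
      rw [h0] at s1
      simp at s1
    simpa [this] using s2
  rw [h34] at s4
  exact ⟨h21, h34, by simpa using s4⟩

/-- The equation `φ²₁ = φ⁴₂` of both frames determines the diagonal of `h`. -/
theorem diagonal (H : IsAdaptedTransition W h φ φ') {q : M} (hq : q ∈ W) :
    h q i1 i1 = h q i2 i2 ^ 3 ∧ h q i3 i3 = h q i4 i4 ^ 3 ∧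
      h q i4 i3 = -(h q i1 i2 * h q i4 i4 ^ 4) ∧
      ∀ v : TangentSpace 𝓘(ℂ) q, v ≠ 0 →
        φ' q v i4 i2 = h q i2 i2 ^ 2 * φ q v i4 i2 := by
  obtain ⟨s1, -, s3, -⟩ := H.symplectic_relations hq
  obtain ⟨h21, h34, hti⟩ := H.triangular hq
  have key : ∀ v : TangentSpace 𝓘(ℂ) q, v ≠ 0 → h q i1 i1 = h q i2 i2 ^ 3 ∧
      φ' q v i4 i2 = h q i2 i2 ^ 2 * φ q v i4 i2 := by
    intro v hv
    obtain ⟨a, b, c, d, a', b', c', d', hc, hφ, hφ'⟩ := H.shape q hq v hv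
    have e1 := congrFun (congrFun (H.gauge q hq v) i4) i2
    have e2 := congrFun (congrFun (H.gauge q hq v) i2) i1
    have hd21 : matDeriv h q v i2 i1 = 0 :=
      H.deriv_eq (f := fun B => B i2 i1) (g := fun _ => 0) (fun q hq => (H.triangular hq).1) hq v
        (H.hasDerivAt hq v _ _) (hasDerivAt_const _ _)
    rw [hφ, hφ'] at e1 e2
    simp [Matrix.mul_apply, Fintype.sum_sum_type, Fin.sum_univ_two, adaptedShape,
      H.lowerLeft q hq, H.matDeriv_lowerLeft hq, h21, hd21] at e1 e2
    rw [hφ, hφ']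
    simp only [adaptedShape, Matrix.fromBlocks_apply₂₁]
    have hc' : c' = h q i2 i2 ^ 2 * c := by
      linear_combination h q i2 i2 * e1 - c' * hti
    refine ⟨?_, by simpa using hc'⟩
    apply mul_left_cancel₀ hc
    linear_combination -e2 + h q i2 i2 * hc'
  obtain ⟨v, hv⟩ := exists_tangent_ne_zero q
  obtain ⟨h11, -⟩ := key v hv
  have h33 : h q i3 i3 = h q i4 i4 ^ 3 := by
    rw [h11, h21] at s1
    linear_combination h q i4 i4 ^ 3 * s1 - h q i3 i3 *
      ((h q i2 i2 * h q i4 i4) ^ 2 + h q i2 i2 * h q i4 i4 + 1) * hti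
  refine ⟨h11, h33, ?_, fun v hv => (key v hv).2⟩
  rw [h33] at s3
  linear_combination h q i4 i4 * s3 - h q i4 i3 * hti

theorem matDeriv_diagonal (H : IsAdaptedTransition W h φ φ') {q : M} (hq : q ∈ W)
    (v : TangentSpace 𝓘(ℂ) q) :
    matDeriv h q v i2 i1 = 0 ∧ matDeriv h q v i3 i4 = 0 ∧
      matDeriv h q v i4 i4 = -(h q i4 i4 ^ 2 * matDeriv h q v i2 i2) ∧
      matDeriv h q v i1 i1 = 3 * h q i2 i2 ^ 2 * matDeriv h q v i2 i2 ∧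
      matDeriv h q v i3 i3 = 3 * h q i4 i4 ^ 2 * matDeriv h q v i4 i4 ∧
      matDeriv h q v i4 i3 = -(matDeriv h q v i1 i2 * h q i4 i4 ^ 4
        + 4 * h q i1 i2 * h q i4 i4 ^ 3 * matDeriv h q v i4 i4) := by
  have D := H.hasDerivAt hq v
  obtain ⟨-, -, hti⟩ := H.triangular hq
  refine ⟨?_, ?_, ?_, ?_, ?_, ?_⟩
  · exact H.deriv_eq (f := fun B => B i2 i1) (g := fun _ => 0)
      (fun q hq => (H.triangular hq).1) hq v (D _ _) (hasDerivAt_const _ _)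
  · exact H.deriv_eq (f := fun B => B i3 i4) (g := fun _ => 0) (fun q hq => (H.triangular hq).2.1)
      hq v (D _ _) (hasDerivAt_const _ _)
  · have := H.deriv_eq (f := fun B => B i2 i2 * B i4 i4) (g := fun _ => 1)
      (fun q hq => (H.triangular hq).2.2) hq v ((D _ _).fun_mul (D _ _)) (hasDerivAt_const _ _)
    rw [coordLine_zero] at this
    linear_combination h q i4 i4 * this - matDeriv h q v i4 i4 * hti
  · have := H.deriv_eq (f := fun B => B i1 i1) (g := fun B => B i2 i2 ^ 3)
      (fun q hq => (H.diagonal hq).1) hq v (D _ _) ((D _ _).fun_pow 3)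
    rw [coordLine_zero] at this
    linear_combination this
  · have := H.deriv_eq (f := fun B => B i3 i3) (g := fun B => B i4 i4 ^ 3)
      (fun q hq => (H.diagonal hq).2.1) hq v (D _ _) ((D _ _).fun_pow 3)
    rw [coordLine_zero] at this
    linear_combination this
  · have := H.deriv_eq (f := fun B => B i4 i3) (g := fun B => -(B i1 i2 * B i4 i4 ^ 4))
      (fun q hq => (H.diagonal hq).2.2.1) hq v (D _ _)
      (((D _ _).fun_mul ((D _ _).fun_pow 4)).fun_neg)
    rw [coordLine_zero] at this
    linear_combination this

/-- The equation `φ¹₁ = 3 φ²₂` of both frames determines `h²₄`. -/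
theorem entry_two_four (H : IsAdaptedTransition W h φ φ') {q : M} (hq : q ∈ W) :
    3 * h q i2 i4 = 4 * (h q i1 i2 * h q i4 i4 ^ 2) := by
  obtain ⟨h21, h34, hti⟩ := H.triangular hq
  obtain ⟨h11, h33, h43, hw⟩ := H.diagonal hq
  obtain ⟨v, hv⟩ := exists_tangent_ne_zero q
  obtain ⟨d21, d34, d44, d11, d33, d43⟩ := H.matDeriv_diagonal hq v
  obtain ⟨a, b, c, d, a', b', c', d', hc, hφ, hφ'⟩ := H.shape q hq v hv
  replace hw := hw v hv
  have e1 := congrFun (congrFun (H.gauge q hq v) i1) i1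
  have e2 := congrFun (congrFun (H.gauge q hq v) i2) i2
  rw [hφ, hφ'] at e1 e2 hw
  simp [Matrix.mul_apply, Fintype.sum_sum_type, Fin.sum_univ_two, adaptedShape,
    H.lowerLeft q hq, h21, h11, d11] at e1 e2 hw
  generalize matDeriv h q v i2 i2 = dt at *
  generalize h q i2 i2 = t at *
  generalize h q i4 i4 = i at *
  generalize h q i1 i2 = s at *
  apply mul_left_cancel₀ hc
  grind

theorem matDeriv_two_four (H : IsAdaptedTransition W h φ φ') {q : M} (hq : q ∈ W)
    (v : TangentSpace 𝓘(ℂ) q) :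
    3 * matDeriv h q v i2 i4 = 4 * (matDeriv h q v i1 i2 * h q i4 i4 ^ 2
      + 2 * h q i1 i2 * h q i4 i4 * matDeriv h q v i4 i4) := by
  have D := H.hasDerivAt hq v
  have := H.deriv_eq (f := fun B => 3 * B i2 i4) (g := fun B => 4 * (B i1 i2 * B i4 i4 ^ 2))
    (fun q hq => H.entry_two_four hq) hq v ((D _ _).const_mul 3)
    (((D _ _).fun_mul ((D _ _).fun_pow 2)).const_mul 4)
  rw [coordLine_zero] at this
  linear_combination this

/-- The equation `4 φ¹₂ = 3 φ²₄` of both frames determines `h¹₄` and `h²₃`. -/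
theorem entry_one_four (H : IsAdaptedTransition W h φ φ') {q : M} (hq : q ∈ W) :
    3 * h q i1 i4 = 2 * (h q i1 i2 ^ 2 * h q i4 i4 ^ 3) ∧
      3 * h q i2 i3 = -2 * (h q i1 i2 ^ 2 * h q i4 i4 ^ 5) := by
  obtain ⟨-, -, -, -, s5⟩ := H.symplectic_relations hq
  obtain ⟨h21, h34, hti⟩ := H.triangular hq
  obtain ⟨h11, h33, h43, hw⟩ := H.diagonal hq
  have h24 := H.entry_two_four hq
  obtain ⟨v, hv⟩ := exists_tangent_ne_zero q
  obtain ⟨d21, d34, d44, d11, d33, d43⟩ := H.matDeriv_diagonal hq v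
  have d24 := H.matDeriv_two_four hq v
  obtain ⟨a, b, c, d, a', b', c', d', hc, hφ, hφ'⟩ := H.shape q hq v hv
  replace hw := hw v hv
  have e1 := congrFun (congrFun (H.gauge q hq v) i1) i2
  have e2 := congrFun (congrFun (H.gauge q hq v) i2) i2
  have e3 := congrFun (congrFun (H.gauge q hq v) i2) i4
  rw [hφ, hφ'] at e1 e2 e3 hw
  simp [Matrix.mul_apply, Fintype.sum_sum_type, Fin.sum_univ_two, adaptedShape,
    H.lowerLeft q hq, h21, h34, h11] at e1 e2 e3 hw
  rw [d44] at d24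
  rw [h33, h43, h34] at s5
  generalize matDeriv h q v i2 i2 = dt at *
  generalize matDeriv h q v i1 i2 = ds at *
  generalize matDeriv h q v i2 i4 = d24' at *
  generalize h q i2 i2 = t at *
  generalize h q i4 i4 = i at *
  generalize h q i1 i2 = s at *
  generalize h q i1 i4 = x at *
  generalize h q i2 i3 = y at *
  generalize h q i2 i4 = z at *
  -- the relation of the last two columns of a symplectic matrix
  have hx : x = t ^ 2 * y + s * i * z := by
    linear_combination -(t ^ 3) * s5 - x * (i ^ 2 * t ^ 2 + i * t + 1) * hti
      + (y * t ^ 2 + s * z * i * (t ^ 2 * i ^ 2 + t * i + 1)) * hti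
  have hz : z = 4 / 3 * (s * i ^ 2) := by linear_combination h24 / 3
  have ht : t ≠ 0 := left_ne_zero_of_mul_eq_one hti
  have hi : i = t⁻¹ := eq_inv_of_mul_eq_one_right hti
  subst hi hx hz hw
  have ha : a' = c * s / t + a + dt / t - 4 / 3 * s * c / t := by
    field_simp
    field_simp at e2
    linear_combination e2
  have hd : d24' = 4 / 3 * (ds / t ^ 2 - 2 * s * dt / t ^ 3) := by
    field_simp
    field_simp at d24
    linear_combination d24
  subst ha hd
  have hy : y = -(2 / 3) * s ^ 2 / t ^ 5 := by
    field_simp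
    apply mul_left_cancel₀ hc
    -- Both equations contain `b'`, `b` and `ds` in the same combination.
    field_simp at e1 e3
    linear_combination (e1 - e3) / 10
  subst hy
  constructor
  · field_simp
    ring
  · field_simp

theorem matDeriv_one_four (H : IsAdaptedTransition W h φ φ') {q : M} (hq : q ∈ W)
    (v : TangentSpace 𝓘(ℂ) q) :
    3 * matDeriv h q v i1 i4 = 2 * (2 * h q i1 i2 * matDeriv h q v i1 i2 * h q i4 i4 ^ 3
      + 3 * h q i1 i2 ^ 2 * h q i4 i4 ^ 2 * matDeriv h q v i4 i4) := by
  have D := H.hasDerivAt hq v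
  have := H.deriv_eq (f := fun B => 3 * B i1 i4) (g := fun B => 2 * (B i1 i2 ^ 2 * B i4 i4 ^ 3))
    (fun q hq => (H.entry_one_four hq).1) hq v ((D _ _).const_mul 3)
    ((((D _ _).fun_pow 2).fun_mul ((D _ _).fun_pow 3)).const_mul 2)
  rw [coordLine_zero] at this
  linear_combination this

/-- The transformation rules of the coefficients `φ⁴₂`, `φ²₂` and `φ²₄`, from the entries `(4,2)`,
`(2,2)` and `(1,2)` of `h φ' = φ h + dh`. -/
theorem coefficients (H : IsAdaptedTransition W h φ φ') {q : M} (hq : q ∈ W)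
    {v : TangentSpace 𝓘(ℂ) q} {a b c d a' b' c' d' : ℂ}
    (hφ : φ q v = adaptedShape a b c d) (hφ' : φ' q v = adaptedShape a' b' c' d') (hv : v ≠ 0) :
    c' = h q i2 i2 ^ 2 * c ∧
    h q i2 i2 * a' = a * h q i2 i2 + matDeriv h q v i2 i2 - h q i1 i2 * c / 3 ∧
    3 * h q i2 i2 ^ 3 * b' = 12 * a * h q i1 i2 + 3 * b * h q i2 i2 + 4 * matDeriv h q v i1 i2
      - 4 * h q i1 i2 * a' - 8 / 3 * h q i1 i2 ^ 2 * h q i4 i4 * c := by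
  obtain ⟨h21, h34, hti⟩ := H.triangular hq
  obtain ⟨h11, h33, h43, hw⟩ := H.diagonal hq
  have h24 := H.entry_two_four hq
  obtain ⟨h14, -⟩ := H.entry_one_four hq
  replace hw := hw v hv
  have e1 := congrFun (congrFun (H.gauge q hq v) i1) i2
  have e2 := congrFun (congrFun (H.gauge q hq v) i2) i2
  rw [hφ, hφ'] at e1 e2 hw
  simp [Matrix.mul_apply, Fintype.sum_sum_type, Fin.sum_univ_two, adaptedShape,
    H.lowerLeft q hq, h21, h11] at e1 e2 hw
  generalize h q i2 i2 = t at *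
  generalize h q i4 i4 = i at *
  have ht : t ≠ 0 := left_ne_zero_of_mul_eq_one hti
  have hi : i = t⁻¹ := eq_inv_of_mul_eq_one_right hti
  subst hi hw
  refine ⟨rfl, ?_, ?_⟩
  · field_simp at h24
    field_simp
    linear_combination 3 * e2 - h24 * c
  · field_simp at h14
    field_simp
    linear_combination 12 * t * e1 - 4 * c * h14

/-- The equation `φ¹₄ = 0` of both frames determines `h¹₃`. -/
theorem entry_one_three (H : IsAdaptedTransition W h φ φ') {q : M} (hq : q ∈ W) :
    9 * h q i1 i3 = -2 * (h q i1 i2 ^ 3 * h q i4 i4 ^ 6) := by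
  obtain ⟨h21, h34, hti⟩ := H.triangular hq
  obtain ⟨h11, h33, h43, -⟩ := H.diagonal hq
  have h24 := H.entry_two_four hq
  obtain ⟨h14, -⟩ := H.entry_one_four hq
  obtain ⟨v, hv⟩ := exists_tangent_ne_zero q
  obtain ⟨-, -, d44, -⟩ := H.matDeriv_diagonal hq v
  have d14 := H.matDeriv_one_four hq v
  obtain ⟨a, b, c, d, a', b', c', d', hc, hφ, hφ'⟩ := H.shape q hq v hv
  obtain ⟨rfl, ha, hb⟩ := H.coefficients hq hφ hφ' hv
  have e := congrFun (congrFun (H.gauge q hq v) i1) i4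
  rw [hφ, hφ'] at e
  simp [Matrix.mul_apply, Fintype.sum_sum_type, Fin.sum_univ_two, adaptedShape, h34, h11] at e
  rw [d44] at d14
  generalize matDeriv h q v i2 i2 = dt at *
  generalize matDeriv h q v i1 i2 = ds at *
  generalize matDeriv h q v i1 i4 = dx at *
  generalize h q i2 i2 = t at *
  generalize h q i4 i4 = i at *
  generalize h q i1 i2 = s at *
  generalize h q i1 i4 = x at *
  generalize h q i1 i3 = y at *
  generalize h q i2 i4 = z at *
  have ht : t ≠ 0 := left_ne_zero_of_mul_eq_one hti
  have hi : i = t⁻¹ := eq_inv_of_mul_eq_one_right hti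
  have hz : z = 4 / 3 * (s * i ^ 2) := by linear_combination h24 / 3
  have hx : x = 2 / 3 * (s ^ 2 * i ^ 3) := by linear_combination h14 / 3
  have hdx : dx = 2 / 3 * (2 * s * ds * i ^ 3 - 3 * s ^ 2 * i ^ 2 * (i ^ 2 * dt)) := by
    linear_combination d14 / 3
  have ha' : a' = a + dt / t - s * c / t / 3 := by
    field_simp
    linear_combination 3 * ha
  subst hi hz hx hdx ha'
  have hb' : b' = (12 * a * s + 3 * b * t + 4 * ds - 4 * s * (a + dt / t - s * c / t / 3)
      - 8 / 3 * s ^ 2 * t⁻¹ * c) / (3 * t ^ 3) := by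
    rw [eq_div_iff (mul_ne_zero three_ne_zero (pow_ne_zero 3 ht))]
    linear_combination hb
  subst hb'
  field_simp
  apply mul_left_cancel₀ hc
  field_simp at e
  linear_combination -e

theorem matDeriv_one_three (H : IsAdaptedTransition W h φ φ') {q : M} (hq : q ∈ W)
    (v : TangentSpace 𝓘(ℂ) q) :
    9 * matDeriv h q v i1 i3 = -2 * (3 * h q i1 i2 ^ 2 * matDeriv h q v i1 i2 * h q i4 i4 ^ 6
      + 6 * h q i1 i2 ^ 3 * h q i4 i4 ^ 5 * matDeriv h q v i4 i4) := by
  have D := H.hasDerivAt hq v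
  have := H.deriv_eq (f := fun B => 9 * B i1 i3) (g := fun B => -2 * (B i1 i2 ^ 3 * B i4 i4 ^ 6))
    (fun q hq => H.entry_one_three hq) hq v ((D _ _).const_mul 9)
    ((((D _ _).fun_pow 3).fun_mul ((D _ _).fun_pow 6)).const_mul (-2))
  rw [coordLine_zero] at this
  linear_combination this

/-- The product `φ¹₃ (φ⁴₂)³` does not depend on the adapted frame: now that `h` is known, the entry
`(1,3)` of `h φ' = φ h + dh` gives `φ¹₃ = t⁶ φ'¹₃`. -/
theorem quartic_eq (H : IsAdaptedTransition W h φ φ') {q : M} (hq : q ∈ W)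
    {v : TangentSpace 𝓘(ℂ) q} (hv : v ≠ 0) :
    φ' q v i1 i3 * φ' q v i4 i2 ^ 3 = φ q v i1 i3 * φ q v i4 i2 ^ 3 := by
  obtain ⟨h21, h34, hti⟩ := H.triangular hq
  obtain ⟨h11, h33, h43, -⟩ := H.diagonal hq
  obtain ⟨h14, h23⟩ := H.entry_one_four hq
  have h13 := H.entry_one_three hq
  obtain ⟨-, -, d44, -⟩ := H.matDeriv_diagonal hq v
  have d13 := H.matDeriv_one_three hq v
  obtain ⟨a, b, c, d, a', b', c', d', hc, hφ, hφ'⟩ := H.shape q hq v hv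
  obtain ⟨rfl, ha, hb⟩ := H.coefficients hq hφ hφ' hv
  have e := congrFun (congrFun (H.gauge q hq v) i1) i3
  rw [hφ, hφ'] at e ⊢
  simp [Matrix.mul_apply, Fintype.sum_sum_type, Fin.sum_univ_two, adaptedShape,
    h11, h33, h43] at e ⊢
  rw [d44] at d13
  generalize matDeriv h q v i2 i2 = dt at *
  generalize matDeriv h q v i1 i2 = ds at *
  generalize matDeriv h q v i1 i3 = dy at *
  generalize h q i2 i2 = t at *
  generalize h q i4 i4 = i at *
  generalize h q i1 i2 = s at *
  generalize h q i1 i4 = x at *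
  generalize h q i1 i3 = y at *
  generalize h q i2 i3 = z at *
  have ht : t ≠ 0 := left_ne_zero_of_mul_eq_one hti
  have hi : i = t⁻¹ := eq_inv_of_mul_eq_one_right hti
  have hz : z = -2 / 3 * (s ^ 2 * i ^ 5) := by linear_combination h23 / 3
  have hx : x = 2 / 3 * (s ^ 2 * i ^ 3) := by linear_combination h14 / 3
  have hy : y = -2 / 9 * (s ^ 3 * i ^ 6) := by linear_combination h13 / 9
  have hdy : dy = -2 / 9 * (3 * s ^ 2 * ds * i ^ 6 - 6 * s ^ 3 * i ^ 5 * (i ^ 2 * dt)) := by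
    linear_combination d13 / 9
  have ha' : a' = a + dt / t - s * c / t / 3 := by
    field_simp
    linear_combination 3 * ha
  subst hi hz hx hy hdy ha'
  have hb' : b' = (12 * a * s + 3 * b * t + 4 * ds - 4 * s * (a + dt / t - s * c / t / 3)
      - 8 / 3 * s ^ 2 * t⁻¹ * c) / (3 * t ^ 3) := by
    rw [eq_div_iff (mul_ne_zero three_ne_zero (pow_ne_zero 3 ht))]
    linear_combination hb
  subst hb'
  field_simp at e
  have hd : d' * t ^ 6 = d := by
    apply mul_left_cancel₀ (pow_ne_zero 4 ht)
    linear_combination e / 324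
  linear_combination c ^ 3 * hd

theorem exists_eq_symRep (H : IsAdaptedTransition W h φ φ') {q : M} (hq : q ∈ W) :
    ∃ x : Borel, h q = symRep (bmat x) := by
  obtain ⟨h21, h34, hti⟩ := H.triangular hq
  obtain ⟨h11, h33, h43, -⟩ := H.diagonal hq
  have h24 := H.entry_two_four hq
  obtain ⟨h14, h23⟩ := H.entry_one_four hq
  have h13 := H.entry_one_three hq
  have l := H.lowerLeft q hq
  have ht : h q i2 i2 ≠ 0 := left_ne_zero_of_mul_eq_one hti
  have h44 : h q i4 i4 = (h q i2 i2)⁻¹ := eq_inv_of_mul_eq_one_right hti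
  obtain ⟨t, h22⟩ : ∃ t, h q i2 i2 = t := ⟨_, rfl⟩
  obtain ⟨s, h12⟩ : ∃ s, h q i1 i2 = s := ⟨_, rfl⟩
  rw [h22] at ht h44 h11
  rw [h44, h12] at h24 h14 h23 h13 h43
  rw [h44] at h33
  have hz : h q i2 i4 = 4 / 3 * (s * t⁻¹ ^ 2) := by linear_combination h24 / 3
  have hx : h q i1 i4 = 2 / 3 * (s ^ 2 * t⁻¹ ^ 3) := by linear_combination h14 / 3
  have hy : h q i2 i3 = -2 / 3 * (s ^ 2 * t⁻¹ ^ 5) := by linear_combination h23 / 3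
  have hw : h q i1 i3 = -2 / 9 * (s ^ 3 * t⁻¹ ^ 6) := by linear_combination h13 / 9
  have hk := cbrt_sixth_ne_zero
  have hk3 := cbrt_sixth_pow
  -- The second entry of `x` is read off from the entry `(1,2)` of the matrix `symRep x`.
  refine ⟨Borel.mk (Units.mk0 t ht) (-(s / (3 * cbrt (1 / 6) * t ^ 2))), ?_⟩
  rw [bmat_mk, symRep_eq]
  generalize cbrt (1 / 6) = k at *
  have hs3 : (s / (3 * k * t ^ 2)) ^ 3 = 2 / 9 * s ^ 3 / t ^ 6 := by
    have : (3 * k * t ^ 2) ^ 3 = 9 / 2 * t ^ 6 := by linear_combination 27 * t ^ 6 * hk3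
    rw [div_pow, this]
    field_simp
  ext i j
  rcases i with i | i <;> rcases j with j | j <;> fin_cases i <;> fin_cases j <;>
    simp [l, h21, h34, h11, h33, h43, hz, hx, hy, hw, h44, h22, h12, neg_pow (s / _), hs3]
  all_goals first | done | (field_simp; done) | (field_simp; norm_num; done) | (field_simp; ring)

end IsAdaptedTransition

end Transition

/-! ### Curves with adapted frames -/

section Frames

variable {E N : Type*} [NormedAddCommGroup E] [NormedSpace ℂ E] [TopologicalSpace N]
  [ChartedSpace E N]

theorem HolAt.inv_of_mem_Sp {A : N → Matrix Ix Ix ℂ} {q : N} (hA : HolAt E A q)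
    (h : ∀ᶠ q' in 𝓝 q, A q' ∈ Sp) : HolAt E (fun q => (A q)⁻¹) q :=
  (((holAt_const _ q).mul hA.transpose).mul (holAt_const _ q)).congr
    (h.mono fun _ h' => inv_eq_of_mem_Sp h')

theorem matDeriv_eq_mul_maurerCartan {A : N → Matrix Ix Ix ℂ} {q : N} (h : A q ∈ Sp)
    (v : TangentSpace 𝓘(ℂ, E) q) : matDeriv A q v = A q * maurerCartan A q v := by
  rw [maurerCartan_eq, Matrix.mul_nonsing_inv_cancel_left _ _ (isUnit_det_of_mem_Sp h)]

/-- The gauge transformation of Maurer-Cartan forms, with the matrix of change `h = A⁻¹ B`. -/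
theorem maurerCartan_gauge {A B : N → Matrix Ix Ix ℂ} {q : N} (hA : HolAt E A q)
    (hB : HolAt E B q) (hAs : ∀ᶠ q' in 𝓝 q, A q' ∈ Sp) (hBs : B q ∈ Sp)
    (v : TangentSpace 𝓘(ℂ, E) q) :
    ((A q)⁻¹ * B q) * maurerCartan B q v
      = maurerCartan A q v * ((A q)⁻¹ * B q) + matDeriv (fun q => (A q)⁻¹ * B q) q v := by
  have hh : HolAt E (fun q => (A q)⁻¹ * B q) q := (hA.inv_of_mem_Sp hAs).mul hB
  have h1 : matDeriv B q v = matDeriv (fun q => A q * ((A q)⁻¹ * B q)) q v :=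
    matDeriv_congr (hAs.mono fun q' h =>
      (Matrix.mul_nonsing_inv_cancel_left _ _ (isUnit_det_of_mem_Sp h)).symm) v
  rw [matDeriv_mul hA hh, matDeriv_eq_mul_maurerCartan hBs,
    matDeriv_eq_mul_maurerCartan hAs.self_of_nhds] at h1
  rw [mul_assoc, h1, mul_add, mul_assoc (A q),
    Matrix.nonsing_inv_mul_cancel_left _ _ (isUnit_det_of_mem_Sp hAs.self_of_nhds),
    Matrix.nonsing_inv_mul_cancel_left _ _ (isUnit_det_of_mem_Sp hAs.self_of_nhds)]

end Frames

section Curve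

variable {M : Type*} [TopologicalSpace M] [ChartedSpace ℂ M]

theorem matDeriv_apply_eq_zero {m n : Type*} {A : M → Matrix m n ℂ} {q : M} (hA : HolAt ℂ A q)
    {i : m} {j : n} (h : ∀ᶠ q' in 𝓝 q, A q' i j = 0) (v : TangentSpace 𝓘(ℂ) q) :
    matDeriv A q v i j = 0 := by
  refine (hA.hasDerivAt v i j).unique ((hasDerivAt_const (0 : ℂ) (0 : ℂ)).congr_of_eventuallyEq ?_)
  exact (tendsto_coordLine q v).eventually h

variable {f : M → Quadric} {U : Set M} {A B : M → Matrix Ix Ix ℂ}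

theorem IsSymplecticFrame.eventually_mem_Sp (hA : IsSymplecticFrame f U A) {q : M} (hq : q ∈ U) :
    ∀ᶠ q' in 𝓝 q, A q' ∈ Sp :=
  Filter.mem_of_superset (hA.1.mem_nhds hq) fun q' hq' => (hA.2.2 q' hq').1

theorem IsSymplecticFrame.lowerLeft (hA : IsSymplecticFrame f U A) (hB : IsSymplecticFrame f U B)
    {q : M} (hq : q ∈ U) (i j : Fin 2) : ((A q)⁻¹ * B q) (Sum.inr i) (Sum.inl j) = 0 :=
  transition_lowerLeft_eq_zero (hA.2.2 q hq).1
    ((hA.2.2 q hq).2.symm.trans (hB.2.2 q hq).2) i j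

theorem IsAdaptedFrame.isAdaptedTransition (hA : IsAdaptedFrame f U A)
    (hB : IsAdaptedFrame f U B) :
    IsAdaptedTransition U (fun q => (A q)⁻¹ * B q) (maurerCartan A) (maurerCartan B) where
  isOpen := hA.1.1
  holo _ hq := ((hA.1.holAt hq).inv_of_mem_Sp (hA.1.eventually_mem_Sp hq)).mul (hB.1.holAt hq)
  mem_Sp q hq := mul_mem_Sp (inv_mem_Sp (hA.1.2.2 q hq).1) (hB.1.2.2 q hq).1
  lowerLeft _ hq := hA.1.lowerLeft hB.1 hq
  shape q hq v hv := ⟨_, _, _, _, _, _, _, _, (hA.2 q hq v).2.2.2.2.2.2 hv,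
    hA.maurerCartan_eq_adaptedShape hq v, hB.maurerCartan_eq_adaptedShape hq v⟩
  gauge q hq v := maurerCartan_gauge (hA.1.holAt hq) (hB.1.holAt hq) (hA.1.eventually_mem_Sp hq)
    (hB.1.2.2 q hq).1 v

theorem IsAdaptedFrame.exists_eq_mul_symRep (hA : IsAdaptedFrame f U A)
    (hB : IsAdaptedFrame f U B) {q : M} (hq : q ∈ U) :
    ∃ x : Borel, B q = A q * symRep (bmat x) := by
  obtain ⟨x, hx⟩ := (hA.isAdaptedTransition hB).exists_eq_symRep hq
  exact ⟨x, by rw [← hx, Matrix.mul_nonsing_inv_cancel_left _ _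
    (isUnit_det_of_mem_Sp (hA.1.2.2 q hq).1)]⟩

theorem IsAdaptedFrame.quartic_eq (hA : IsAdaptedFrame f U A) (hB : IsAdaptedFrame f U B) {q : M}
    (hq : q ∈ U) (v : TangentSpace 𝓘(ℂ) q) :
    maurerCartan B q v i1 i3 * maurerCartan B q v i4 i2 ^ 3
      = maurerCartan A q v i1 i3 * maurerCartan A q v i4 i2 ^ 3 := by
  -- The shape of the forms is known only on nonzero vectors.
  by_cases hv : v = 0
  · have h0 : ∀ C : M → Matrix Ix Ix ℂ, maurerCartan C q v i1 i3 = 0 := by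
      intro C
      have : matDeriv C q v = 0 := by
        ext i j
        rw [hv]
        exact map_zero (show ℂ →L[ℂ] ℂ from mfderiv 𝓘(ℂ) 𝓘(ℂ) (fun q' => C q' i j) q)
      rw [maurerCartan_eq, this, mul_zero]
      rfl
    rw [h0, h0, zero_mul, zero_mul]
  · exact (hA.isAdaptedTransition hB).quartic_eq hq hv

/-- A curve that has adapted frames is null for the conformal structure: in every symplectic frame,
the lower left block of the Maurer-Cartan form is a symmetric matrix of rank at most one. -/
theorem IsAdaptedFrame.null (hB : IsAdaptedFrame f U B) (hA : IsSymplecticFrame f U A) {q : M}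
    (hq : q ∈ U) (v : TangentSpace 𝓘(ℂ) q) :
    maurerCartan A q v i3 i1 * maurerCartan A q v i4 i2 - maurerCartan A q v i4 i1 ^ 2 = 0 := by
  have hh : HolAt ℂ (fun q => (B q)⁻¹ * A q) q :=
    ((hB.1.holAt hq).inv_of_mem_Sp (hB.1.eventually_mem_Sp hq)).mul (hA.holAt hq)
  have l := hB.1.lowerLeft hA hq
  have dl : ∀ i j : Fin 2,
      matDeriv (fun q => (B q)⁻¹ * A q) q v (Sum.inr i) (Sum.inl j) = 0 := fun i j =>
    matDeriv_apply_eq_zero hh (Filter.mem_of_superset (hA.1.mem_nhds hq) fun q' hq' =>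
      hB.1.lowerLeft hA hq' i j) v
  have hg := maurerCartan_gauge (hB.1.holAt hq) (hA.holAt hq) (hB.1.eventually_mem_Sp hq)
    (hA.2.2 q hq).1 v
  obtain ⟨s1, s2, s3, s4, -⟩ := symplectic_relations_of_lowerLeft
    (mul_mem_Sp (inv_mem_Sp (hB.1.2.2 q hq).1) (hA.2.2 q hq).1) l
  rw [hB.maurerCartan_eq_adaptedShape hq v] at hg
  generalize matDeriv (fun q => (B q)⁻¹ * A q) q v = dh at *
  generalize (B q)⁻¹ * A q = h at *
  generalize maurerCartan A q v = φ at *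
  generalize maurerCartan B q v i4 i2 = w at *
  have e1 := congrFun (congrFun hg i3) i1
  have e2 := congrFun (congrFun hg i4) i1
  have e3 := congrFun (congrFun hg i3) i2
  have e4 := congrFun (congrFun hg i4) i2
  simp [Matrix.mul_apply, Fintype.sum_sum_type, Fin.sum_univ_two, adaptedShape, l, dl]
    at e1 e2 e3 e4
  -- The lower left block of `φ` is `w` times the square of the second row of `h`.
  have c1 : φ i3 i1 = w * h i2 i1 ^ 2 := by
    linear_combination h i1 i1 * e1 + h i2 i1 * e2 - φ i3 i1 * s1 - φ i4 i1 * s2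
  have c2 : φ i4 i1 = w * h i2 i1 * h i2 i2 := by
    linear_combination h i1 i2 * e1 + h i2 i2 * e2 - φ i3 i1 * s3 - φ i4 i1 * s4
  have c3 : φ i4 i2 = w * h i2 i2 ^ 2 := by
    linear_combination h i1 i2 * e3 + h i2 i2 * e4 - φ i3 i2 * s3 - φ i4 i2 * s4
  rw [c1, c2, c3]
  ring

/-- The planes of a curve that has an adapted frame have no common nonzero vector: if `c = A⁻¹ ξ` is
the vector of the coordinates of `ξ`, then `c³ = c⁴ = 0` and `dc = -φ c`, and the equations
`φ⁴₂ ≠ 0` and `φ²₁ = φ⁴₂` force `c² = 0` and `c¹ = 0`. -/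
theorem IsAdaptedFrame.eq_zero_of_mem (hA : IsAdaptedFrame f U A) {q₀ : M} (hq₀ : q₀ ∈ U)
    {ξ : Ix → ℂ} (hξ : ∀ q ∈ U, ξ ∈ (f q).1) : ξ = 0 := by
  -- The coordinates of `ξ` in the frame are written as a matrix with one column.
  let c : M → Matrix Ix Unit ℂ := fun q => (A q)⁻¹ * Matrix.replicateCol Unit ξ
  have hc : ∀ q ∈ U, HolAt ℂ c q := fun q hq =>
    ((hA.1.holAt hq).inv_of_mem_Sp (hA.1.eventually_mem_Sp hq)).mul (holAt_const _ q)
  have hAc : ∀ q ∈ U, A q * c q = Matrix.replicateCol Unit ξ := fun q hq =>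
    Matrix.mul_nonsing_inv_cancel_left _ _ (isUnit_det_of_mem_Sp (hA.1.2.2 q hq).1)
  have hlow : ∀ q ∈ U, ∀ i, c q (Sum.inr i) () = 0 := by
    intro q hq i
    have h1 := hξ q hq
    rw [(hA.1.2.2 q hq).2] at h1
    obtain ⟨a, b, rfl⟩ := Submodule.mem_span_pair.1 h1
    have h2 := Matrix.nonsing_inv_mul (A q) (isUnit_det_of_mem_Sp (hA.1.2.2 q hq).1)
    have e1 := congrFun (congrFun h2 (Sum.inr i)) i1
    have e2 := congrFun (congrFun h2 (Sum.inr i)) i2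
    rw [Matrix.mul_apply] at e1 e2
    simp only [c, Matrix.mul_apply, Matrix.replicateCol_apply, Pi.add_apply, Pi.smul_apply,
      smul_eq_mul, mul_add, Finset.sum_add_distrib, mul_left_comm _ a, mul_left_comm _ b,
      ← Finset.mul_sum, e1, e2]
    simp
  have hd : ∀ q ∈ U, ∀ v : TangentSpace 𝓘(ℂ) q, matDeriv c q v = -(maurerCartan A q v * c q) := by
    intro q hq v
    have hu := isUnit_det_of_mem_Sp (hA.1.2.2 q hq).1
    have h0 : matDeriv (fun q => A q * c q) q v = 0 := by
      rw [← matDeriv_const (N := M) (Matrix.replicateCol Unit ξ) q v]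
      exact matDeriv_congr (Filter.mem_of_superset (hA.1.1.mem_nhds hq) hAc) v
    rw [matDeriv_mul (hA.1.holAt hq) (hc q hq), matDeriv_eq_mul_maurerCartan (hA.1.2.2 q hq).1,
      Matrix.mul_assoc, ← Matrix.mul_add] at h0
    have h1 := congrArg ((A q)⁻¹ * ·) h0
    simp only [Matrix.nonsing_inv_mul_cancel_left _ _ hu, Matrix.mul_zero] at h1
    exact eq_neg_of_add_eq_zero_right h1
  have hzero : ∀ i, (∀ q ∈ U, c q i () = 0) → ∀ q ∈ U, ∀ v : TangentSpace 𝓘(ℂ) q,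
      (maurerCartan A q v * c q) i () = 0 := by
    intro i h q hq v
    have := matDeriv_apply_eq_zero (hc q hq) (Filter.mem_of_superset (hA.1.1.mem_nhds hq) h) v
    rw [hd q hq v] at this
    simpa using this
  have h2 : ∀ q ∈ U, c q i2 () = 0 := by
    intro q hq
    obtain ⟨v, hv⟩ := exists_tangent_ne_zero q
    have h := hzero i4 (fun q hq => hlow q hq 1) q hq v
    obtain ⟨-, e2, -, -, -, -, e7⟩ := hA.2 q hq v
    simpa [Matrix.mul_apply, Fintype.sum_sum_type, Fin.sum_univ_two, hlow q hq, e2, e7 hv] using h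
  have h1 : ∀ q ∈ U, c q i1 () = 0 := by
    intro q hq
    obtain ⟨v, hv⟩ := exists_tangent_ne_zero q
    have h := hzero i2 h2 q hq v
    obtain ⟨-, -, e3, -, -, -, e7⟩ := hA.2 q hq v
    simpa [Matrix.mul_apply, Fintype.sum_sum_type, Fin.sum_univ_two, hlow q hq, h2 q hq,
      sub_eq_zero.1 e3, e7 hv] using h
  have hc0 : c q₀ = 0 := by
    ext i j
    rcases i with i | i
    · fin_cases i
      · exact h1 q₀ hq₀
      · exact h2 q₀ hq₀
    · exact hlow q₀ hq₀ i
  have h := hAc q₀ hq₀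
  rw [hc0, Matrix.mul_zero] at h
  ext i
  exact (congrFun (congrFun h i) ()).symm

end Curve

/-! ### The plane spanned by the first two vectors of a symplectic frame -/

theorem finrank_span_columns {A : Matrix Ix Ix ℂ} (hA : A ∈ Sp) :
    Module.finrank ℂ (Submodule.span ℂ {(fun i => A i i1), (fun i => A i i2)}) = 2 := by
  have h1 : LinearIndependent ℂ A.col :=
    Matrix.linearIndependent_cols_of_isUnit ((Matrix.isUnit_iff_isUnit_det A).2
      (isUnit_det_of_mem_Sp hA))
  have h2 := h1.comp (Sum.inl : Fin 2 → Ix) Sum.inl_injective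
  have h3 := finrank_span_eq_card h2
  have h4 : Set.range (A.col ∘ Sum.inl) = {(fun i => A i i1), (fun i => A i i2)} := by
    have : A.col ∘ Sum.inl = ![(fun i => A i i1), (fun i => A i i2)] := by
      ext j i
      fin_cases j <;> rfl
    rw [this, Matrix.range_cons_cons_empty]
  rwa [h4, Fintype.card_fin] at h3

/-- The Lagrangian plane spanned by the first two columns of a symplectic matrix. -/
def plane (A : Matrix Ix Ix ℂ) (hA : A ∈ Sp) : Quadric :=
  ⟨Submodule.span ℂ {(fun i => A i i1), (fun i => A i i2)}, finrank_span_columns hA, by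
    intro x hx y hy
    obtain ⟨a, b, rfl⟩ := Submodule.mem_span_pair.1 hx
    obtain ⟨c, d, rfl⟩ := Submodule.mem_span_pair.1 hy
    have h := sympl_columns hA i1 i2
    simp [sympl, Matrix.J] at h ⊢
    linear_combination (a * d - b * c) * h⟩

theorem span_columns_mul_symRep {A : Matrix Ix Ix ℂ} (hA : A ∈ Sp) (x : Borel) :
    Submodule.span ℂ {(fun i => (A * symRep (bmat x)) i i1), (fun i => (A * symRep (bmat x)) i i2)}
      = Submodule.span ℂ {(fun i => A i i1), (fun i => A i i2)} := by
  have hB := mul_mem_Sp hA (symRep_bmat_mem x)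
  refine Submodule.eq_of_le_of_finrank_eq ?_
    ((finrank_span_columns hB).trans (finrank_span_columns hA).symm)
  have key : ∀ j : Fin 2, (fun i => (A * symRep (bmat x)) i (Sum.inl j))
      ∈ Submodule.span ℂ {(fun i => A i i1), (fun i => A i i2)} := by
    intro j
    refine Submodule.mem_span_pair.2 ⟨symRep (bmat x) i1 (Sum.inl j),
      symRep (bmat x) i2 (Sum.inl j), ?_⟩
    ext i
    fin_cases j <;>
    simp [Matrix.mul_apply, Fintype.sum_sum_type, Fin.sum_univ_two, symRep_eq,
      bmat_one_zero] <;> ring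
  rw [Submodule.span_le]
  rintro u (rfl | rfl)
  · exact key 0
  · exact key 1

/-! ### Parallel frames are adapted -/

section LocalFrames

variable {S : Type*} [TopologicalSpace S] [ChartedSpace ℂ S]
  {P : Type*} [TopologicalSpace P] [ChartedSpace (Fin 3 → ℂ) P]
  [IsManifold 𝓘(ℂ, Fin 3 → ℂ) ω P] {U : Set S} {T : ProjectiveStructure S P U}
  {δ : QuarticDifferential S}

theorem frameConn_adaptedForm {η : Matrix (Fin 2) (Fin 2) ℂ} (h : η.trace = 0) (d : ℂ) :
    frameConn (adaptedForm η d) = η := by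
  rw [Matrix.trace_fin_two] at h
  have hk := cbrt_sixth_pow
  rw [adaptedForm_eq, frameConn, cbrt_three_thirtyseconds]
  generalize cbrt (1 / 6) = k at *
  ext i j
  fin_cases i <;> fin_cases j <;> simp
  · linear_combination h
  · linear_combination 6 * η 0 1 * hk
  · linear_combination 6 * η 1 0 * hk
  · linear_combination -2 * h

theorem trace_conn (T : ProjectiveStructure S P U) (y : P)
    (v : TangentSpace 𝓘(ℂ, Fin 3 → ℂ) y) : (T.conn y v).trace = 0 :=
  (T.conn_range y _).1 ⟨v, rfl⟩

theorem frameConn_spForm (y : P) (v : TangentSpace 𝓘(ℂ, Fin 3 → ℂ) y) :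
    frameConn (spForm T δ y v) = T.conn y v :=
  frameConn_adaptedForm (trace_conn T y v) _

theorem spForm_adapted (y : P) (v : TangentSpace 𝓘(ℂ, Fin 3 → ℂ) y) :
    let φ := spForm T δ y v
    φ i3 i1 = 0 ∧ φ i4 i1 = 0 ∧ φ i2 i1 - φ i4 i2 = 0 ∧ φ i1 i1 - 3 * φ i2 i2 = 0 ∧
      4 * φ i1 i2 - 3 * φ i2 i4 = 0 ∧ φ i1 i4 = 0 := by
  have h := trace_conn T y v
  rw [Matrix.trace_fin_two] at h
  intro φ
  simp only [φ, spForm, adaptedForm_eq]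
  simp
  constructor
  · linear_combination -3 * h
  · ring

theorem spForm_four_two (y : P) (v : TangentSpace 𝓘(ℂ, Fin 3 → ℂ) y) :
    spForm T δ y v i4 i2 = -(6 * cbrt (1 / 6) ^ 2 * T.conn y v 1 0) := by
  rw [spForm, adaptedForm_eq]
  simp

theorem spForm_four_two_ne_zero {y : P} {v : TangentSpace 𝓘(ℂ, Fin 3 → ℂ) y}
    (h : mfderiv 𝓘(ℂ, Fin 3 → ℂ) 𝓘(ℂ) T.proj y v ≠ 0) : spForm T δ y v i4 i2 ≠ 0 := by
  rw [spForm_four_two]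
  have h1 : T.conn y v 1 0 ≠ 0 := fun h0 => h (T.mfderiv_proj_eq_zero h0)
  exact neg_ne_zero.2 (mul_ne_zero (mul_ne_zero (by norm_num)
    (pow_ne_zero 2 cbrt_sixth_ne_zero)) h1)

/-- This holds on vertical vectors too, where both sides are zero. -/
theorem spForm_quartic (y : P) (v : TangentSpace 𝓘(ℂ, Fin 3 → ℂ) y) :
    spForm T δ y v i1 i3 * spForm T δ y v i4 i2 ^ 3
      = δ.toFun (T.proj y) (mfderiv 𝓘(ℂ, Fin 3 → ℂ) 𝓘(ℂ) T.proj y v) := by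
  have h13 : spForm T δ y v i1 i3
      = δ.toFun (T.proj y) (mfderiv 𝓘(ℂ, Fin 3 → ℂ) 𝓘(ℂ) T.proj y v) /
        spForm T δ y v i4 i2 ^ 3 := by
    rw [spForm_four_two]
    conv_lhs => rw [spForm, adaptedForm_eq]
    simp
  by_cases h0 : spForm T δ y v i4 i2 = 0
  · have hv : mfderiv 𝓘(ℂ, Fin 3 → ℂ) 𝓘(ℂ) T.proj y v = 0 := by
      by_contra h
      exact spForm_four_two_ne_zero h h0
    rw [h0, hv, δ.toFun_zero]
    ring
  · rw [h13, div_mul_cancel₀ _ (pow_ne_zero 3 h0)]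

theorem ParallelAt.maurerCartan_eq {E N : Type*} [NormedAddCommGroup E] [NormedSpace ℂ E]
    [TopologicalSpace N] [ChartedSpace E N] {F : N → Matrix Ix Ix ℂ} {τ : N → P} {q : N}
    (h : ParallelAt (E := E) T δ F τ q) (hF : F q ∈ Sp) (v : TangentSpace 𝓘(ℂ, E) q) :
    maurerCartan F q v
      = spForm T δ (τ q) (mfderiv 𝓘(ℂ, E) 𝓘(ℂ, Fin 3 → ℂ) τ q v) := by
  rw [IsoCurve.maurerCartan_eq, h v,
    Matrix.nonsing_inv_mul_cancel_left _ _ (isUnit_det_of_mem_Sp hF)]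

variable {M : Type*} [TopologicalSpace M] [ChartedSpace ℂ M] {p : M → S} {V : Set S} {σ : S → P}
  {g : P → Borel} {F : S → Matrix Ix Ix ℂ}

theorem IsParallelFrame.parallelAt_pullback (hF : IsParallelFrame T δ V σ g F)
    (hp : ContMDiff 𝓘(ℂ) 𝓘(ℂ) ω p) (x : Borel) {q : M} (hq : p q ∈ V) :
    ParallelAt (E := ℂ) T δ (fun q => F (p q) * symRep (bmat x))
      (fun q => T.act (σ (p q)) x) q :=
  ((hF.parallel _ hq).comp (hF.frame_holo _ hq) ((hF.holo _ hq).mdifferentiableAt (by simp))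
    (hp.contMDiffAt.mdifferentiableAt (by simp))).act (x := fun _ => x)
    ((hF.frame_holo _ hq).comp hp.contMDiffAt) ((hF.holo _ hq).comp q hp.contMDiffAt)
    (holAt_const _ _)

/-- The map `q ↦ σ (p q) · x`, over which a pulled back frame is parallel, covers `p`. -/
theorem IsParallelFrame.mfderiv_proj_pullback (hF : IsParallelFrame T δ V σ g F)
    (hp : ContMDiff 𝓘(ℂ) 𝓘(ℂ) ω p) (x : Borel) {q : M} (hq : p q ∈ V)
    (v : TangentSpace 𝓘(ℂ) q) :
    (mfderiv 𝓘(ℂ, Fin 3 → ℂ) 𝓘(ℂ) T.proj (T.act (σ (p q)) x)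
      (mfderiv 𝓘(ℂ) 𝓘(ℂ, Fin 3 → ℂ) (fun q => T.act (σ (p q)) x) q v) : ℂ)
      = mfderiv 𝓘(ℂ) 𝓘(ℂ) p q v := by
  have hτ : ContMDiffAt 𝓘(ℂ) 𝓘(ℂ, Fin 3 → ℂ) ω (fun q => T.act (σ (p q)) x) q :=
    T.contMDiffAt_act (x := fun _ => x) ((hF.holo _ hq).comp q hp.contMDiffAt) (holAt_const _ _)
  have h1 := mfderiv_comp_apply q (T.proj_holo.mdifferentiableAt (x := T.act (σ (p q)) x) (by simp))
    (hτ.mdifferentiableAt (by simp)) v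
  have h2 : (T.proj ∘ fun q => T.act (σ (p q)) x) =ᶠ[𝓝 q] p := by
    filter_upwards [(hF.isOpen.preimage hp.continuous).mem_nhds hq] with q' hq'
    exact (T.proj_act _ _).trans (hF.proj_section _ hq')
  have h3 : (show ℂ →L[ℂ] ℂ from mfderiv 𝓘(ℂ) 𝓘(ℂ) (T.proj ∘ fun q => T.act (σ (p q)) x) q)
      = mfderiv 𝓘(ℂ) 𝓘(ℂ) p q := h2.mfderiv_eq
  exact h1.symm.trans (congrArg (fun L : ℂ →L[ℂ] ℂ => L v) h3)

/-- The pull-back of a parallel frame by an immersion `p`, translated by an element of `H₁`, is an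
adapted frame along the curve that it spans. -/
theorem IsParallelFrame.isAdaptedFrame (hF : IsParallelFrame T δ V σ g F)
    (hp : ContMDiff 𝓘(ℂ) 𝓘(ℂ) ω p)
    (hdp : ∀ (q : M) (v : TangentSpace 𝓘(ℂ) q), v ≠ 0 → mfderiv 𝓘(ℂ) 𝓘(ℂ) p q v ≠ 0)
    {f : M → Quadric} {W : Set M} (hW : IsOpen W) (hWV : ∀ q ∈ W, p q ∈ V)
    (hf : ∀ q ∈ W, (f q).1
      = Submodule.span ℂ {(fun i => F (p q) i i1), (fun i => F (p q) i i2)}) (x : Borel) :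
    IsAdaptedFrame f W (fun q => F (p q) * symRep (bmat x)) := by
  have hmem : ∀ q ∈ W, F (p q) * symRep (bmat x) ∈ Sp := fun q hq =>
    mul_mem_Sp (hF.frame_mem _ (hWV q hq)) (symRep_bmat_mem x)
  refine ⟨⟨hW, fun i j q hq => ?_, fun q hq => ⟨hmem q hq, ?_⟩⟩, fun q hq v => ?_⟩
  · exact ((((hF.frame_holo _ (hWV q hq)).comp hp.contMDiffAt).mul (holAt_const (E := ℂ) _ q))
      i j).contMDiffWithinAt
  · rw [hf q hq]
    exact (span_columns_mul_symRep (hF.frame_mem _ (hWV q hq)) x).symm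
  · have hmc := (hF.parallelAt_pullback hp x (hWV q hq)).maurerCartan_eq (hmem q hq) v
    intro φ
    obtain ⟨e1, e2, e3, e4, e5, e6⟩ := spForm_adapted (T := T) (δ := δ) (T.act (σ (p q)) x)
      (mfderiv 𝓘(ℂ) 𝓘(ℂ, Fin 3 → ℂ) (fun q => T.act (σ (p q)) x) q v)
    rw [← hmc] at e1 e2 e3 e4 e5 e6
    refine ⟨e1, e2, e3, e4, e5, e6, fun hv => ?_⟩
    have h7 : spForm T δ (T.act (σ (p q)) x)
        (mfderiv 𝓘(ℂ) 𝓘(ℂ, Fin 3 → ℂ) (fun q => T.act (σ (p q)) x) q v) i4 i2 ≠ 0 := by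
      refine spForm_four_two_ne_zero fun h0 => hdp q v hv ?_
      exact (hF.mfderiv_proj_pullback hp x (hWV q hq) v).symm.trans h0
    rwa [← hmc] at h7

theorem IsParallelFrame.quartic_pullback (hF : IsParallelFrame T δ V σ g F)
    (hp : ContMDiff 𝓘(ℂ) 𝓘(ℂ) ω p) (x : Borel) {q : M} (hq : p q ∈ V)
    (v : TangentSpace 𝓘(ℂ) q) :
    maurerCartan (fun q => F (p q) * symRep (bmat x)) q v i1 i3 *
        maurerCartan (fun q => F (p q) * symRep (bmat x)) q v i4 i2 ^ 3
      = pullbackQuartic p δ q v := by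
  rw [(hF.parallelAt_pullback hp x hq).maurerCartan_eq
    (mul_mem_Sp (hF.frame_mem _ hq) (symRep_bmat_mem x)) v, spForm_quartic]
  exact δ.toFun_congr ((T.proj_act _ _).trans (hF.proj_section _ hq))
    (hF.mfderiv_proj_pullback hp x hq v)

theorem QuarticDifferential.toFun_ne_zero (δ : QuarticDifferential S) {s : S}
    (hs : s ∉ δ.divisorSupport) {w : TangentSpace 𝓘(ℂ) s} (hw : w ≠ 0) : δ.toFun s w ≠ 0 := by
  intro h0
  have h : ∀ c : ℂ, δ.toFun s c = 0 := by
    intro c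
    have h1 := δ.homogeneous s (c / (show ℂ from w)) w
    rw [h0, mul_zero] at h1
    have h2 : (c / (show ℂ from w)) * (show ℂ from w) = c := div_mul_cancel₀ c hw
    exact (δ.toFun_congr rfl h2.symm).trans h1
  refine δ.quarticCoeff_ne_zero hs ?_
  have hinv : (chartAt ℂ s).symm (chartAt ℂ s s) = s :=
    (chartAt ℂ s).left_inv (mem_chart_source ℂ s)
  exact (δ.toFun_congr hinv rfl).trans (h _)

end LocalFrames

/-! ### Holomorphic coverings -/

section Covering

variable {S : Type*} [TopologicalSpace S] [ChartedSpace ℂ S]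
  {M : Type*} [TopologicalSpace M] [ChartedSpace ℂ M]

theorem IsUniversalCovering.mfderiv_ne_zero {p : M → S} {X : Set S} (hp : IsUniversalCovering p X)
    (q : M) (v : TangentSpace 𝓘(ℂ) q) (hv : v ≠ 0) : mfderiv 𝓘(ℂ) 𝓘(ℂ) p q v ≠ 0 := by
  have hq : p q ∈ X := hp.range_eq ▸ Set.mem_range_self q
  obtain ⟨e, hqe, he⟩ := hp.covering.isLocalHomeomorphOn q hq
  let E : OpenPartialHomeomorph ℂ ℂ := (chartAt ℂ q).symm ≫ₕ (e ≫ₕ chartAt ℂ (p q))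
  have hE : ∀ z, E z = chartAt ℂ (p q) (p ((chartAt ℂ q).symm z)) := fun z =>
    congrArg (fun k : M → S => chartAt ℂ (p q) (k ((chartAt ℂ q).symm z))) he.symm
  have hsource : chartAt ℂ q q ∈ E.source := by
    have h1 : chartAt ℂ (p q) = chartAt ℂ (e q) := by rw [he]
    simp [E, hqe, h1]
  have hd := (contMDiffAt_iff.1 (hp.holomorphic.contMDiffAt (x := q))).2
  have hw : writtenInExtChartAt 𝓘(ℂ) 𝓘(ℂ) q p = E := by
    ext z
    rw [hE]
    rfl
  have han : AnalyticAt ℂ E (chartAt ℂ q q) := by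
    have hd' : ContDiffWithinAt ℂ ω (writtenInExtChartAt 𝓘(ℂ) 𝓘(ℂ) q p) (Set.range 𝓘(ℂ))
      (chartAt ℂ q q) := hd
    rw [hw, ModelWithCorners.range_eq_univ, contDiffWithinAt_univ] at hd'
    exact hd'.analyticAt
  have hne := deriv_ne_zero_of_openPartialHomeomorph E hsource han
  have hmd : MDifferentiableAt 𝓘(ℂ) 𝓘(ℂ) p q := hp.holomorphic.mdifferentiableAt (by simp)
  have heq : (show ℂ →L[ℂ] ℂ from mfderiv 𝓘(ℂ) 𝓘(ℂ) p q) = fderiv ℂ E (chartAt ℂ q q) := by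
    have h1 : HasFDerivAt (writtenInExtChartAt 𝓘(ℂ) 𝓘(ℂ) q p)
        (show ℂ →L[ℂ] ℂ from mfderiv 𝓘(ℂ) 𝓘(ℂ) p q) (chartAt ℂ q q) := by
      rw [← hasFDerivWithinAt_univ, ← ModelWithCorners.range_eq_univ 𝓘(ℂ)]
      exact hmd.hasMFDerivAt.2
    rw [hw] at h1
    exact h1.fderiv.symm
  have hval : (mfderiv 𝓘(ℂ) 𝓘(ℂ) p q v : ℂ) = (fun w : ℂ => w * deriv E (chartAt ℂ q q)) v :=
    (congrArg (fun L : ℂ →L[ℂ] ℂ => L v) heq).trans ((fun w : ℂ => by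
      rw [fderiv_eq_smul_deriv, smul_eq_mul] :
        ∀ w : ℂ, fderiv ℂ E (chartAt ℂ q q) w = w * deriv E (chartAt ℂ q q)) v)
  intro h0
  exact mul_ne_zero (M₀ := ℂ) hv hne (hval.symm.trans h0)

end Covering

/-! ### The curve spanned by the global frame -/

theorem symRep_one : symRep 1 = 1 := by
  rw [symRep_eq]
  ext i j
  rcases i with i | i <;> rcases j with j | j <;> fin_cases i <;> fin_cases j <;> simp

theorem symRep_bmat_injective {x x' : Borel} (h : symRep (bmat x) = symRep (bmat x')) : x = x' := by
  have h1 : symRep (bmat (x * x'⁻¹)) = symRep (bmat (x' * x'⁻¹)) := by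
    rw [bmat_mul, bmat_mul, symRep_mul, symRep_mul, h]
  rw [mul_inv_cancel, bmat_one, symRep_one] at h1
  exact mul_inv_eq_one.1 (eq_one_of_symRep_eq_one h1)

section Global

variable {S : Type*} [TopologicalSpace S] [ChartedSpace ℂ S]
  {P : Type*} [TopologicalSpace P] [ChartedSpace (Fin 3 → ℂ) P]
  [IsManifold 𝓘(ℂ, Fin 3 → ℂ) ω P] {U : Set S}
  {M : Type*} [TopologicalSpace M]

/-- The equivariant frame `Ψ` spans the curve `f`, and near every point of `M` it is given by a
parallel frame. -/
def IsFrameOfCurve (T : ProjectiveStructure S P U) (δ : QuarticDifferential S) (p : M → S)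
    (Ψ : M → P → Matrix Ix Ix ℂ) (f : M → Quadric) : Prop :=
  ∀ q₀, ∃ W V σ g F, IsOpen W ∧ q₀ ∈ W ∧ (∀ q ∈ W, p q ∈ V) ∧ IsParallelFrame T δ V σ g F ∧
    (∀ q ∈ W, ∀ y, T.proj y = p q → Ψ q y = F (p q) * symRep (bmat (g y))) ∧
    ∀ q ∈ W, (f q).1 = Submodule.span ℂ {(fun i => F (p q) i i1), (fun i => F (p q) i i2)}

theorem exists_isFrameOfCurve [IsManifold 𝓘(ℂ) ω S] [SimplyConnectedSpace M]
    [LocallyPathConnectedSpace M] (T : ProjectiveStructure S P U) (δ : QuarticDifferential S)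
    {p : M → S} (hp : Continuous p) (hU : ∀ q, p q ∈ U) (hδ : ∀ q, p q ∉ δ.divisorSupport) :
    ∃ Ψ f, IsFrameOfCurve T δ p Ψ f := by
  obtain ⟨Ψ, hΨ⟩ := exists_global_frame T δ hp hU hδ
  have hmem : ∀ q y, T.proj y = p q → Ψ q y ∈ Sp := by
    intro q y hy
    obtain ⟨V, σ, g, F, hq, hF, h⟩ := hΨ q
    rw [h.self_of_nhds y hy]
    exact mul_mem_Sp (hF.frame_mem _ hq) (symRep_bmat_mem _)
  have hy : ∀ q, ∃ y, T.proj y = p q := by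
    intro q
    obtain ⟨V, σ, g, F, hq, hF, -⟩ := hΨ q
    exact ⟨σ (p q), hF.proj_section _ hq⟩
  choose y hy using hy
  refine ⟨Ψ, fun q => plane (Ψ q (y q)) (hmem q _ (hy q)), fun q₀ => ?_⟩
  obtain ⟨V, σ, g, F, hq₀, hF, h⟩ := hΨ q₀
  obtain ⟨W, hW, hWo, hqW⟩ := eventually_nhds_iff.1
    (h.and ((hF.isOpen.preimage hp).mem_nhds hq₀))
  refine ⟨W, V, σ, g, F, hWo, hqW, fun q hq => (hW q hq).2, hF, fun q hq => (hW q hq).1,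
    fun q hq => ?_⟩
  change Submodule.span ℂ {(fun i => Ψ q (y q) i i1), (fun i => Ψ q (y q) i i2)} = _
  rw [(hW q hq).1 _ (hy q)]
  exact span_columns_mul_symRep (hF.frame_mem _ (hW q hq).2) _

namespace IsFrameOfCurve

variable {T : ProjectiveStructure S P U} {δ : QuarticDifferential S} {p : M → S}
  {Ψ : M → P → Matrix Ix Ix ℂ} {f : M → Quadric}

theorem map_act (H : IsFrameOfCurve T δ p Ψ f) {q : M} {y : P} (x : Borel)
    (hy : T.proj y = p q) : Ψ q (T.act y x) = Ψ q y * symRep (bmat x) := by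
  obtain ⟨W, V, σ, g, F, hW, hq, hWV, hF, hΨ, hf⟩ := H q
  rw [hΨ q hq _ ((T.proj_act _ _).trans hy), hΨ q hq y hy,
    hF.coord_act (by rw [hy]; exact hWV q hq), bmat_mul, symRep_mul, mul_assoc]

variable [ChartedSpace ℂ M]

theorem isIsotropicCurve [Nonempty M] (H : IsFrameOfCurve T δ p Ψ f)
    (hp : ContMDiff 𝓘(ℂ) 𝓘(ℂ) ω p)
    (hdp : ∀ (q : M) (v : TangentSpace 𝓘(ℂ) q), v ≠ 0 → mfderiv 𝓘(ℂ) 𝓘(ℂ) p q v ≠ 0) :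
    IsIsotropicCurve f := by
  have hnull : ¬ ∃ ξ : Ix → ℂ, ξ ≠ 0 ∧ ∀ q, ξ ∈ (f q).1 := by
    rintro ⟨ξ, hξ, h⟩
    obtain ⟨W, V, σ, g, F, hW, hq, hWV, hF, -, hf⟩ := H (Classical.arbitrary M)
    exact hξ ((hF.isAdaptedFrame hp hdp hW hWV hf 1).eq_zero_of_mem hq fun q _ => h q)
  refine ⟨fun q₀ => ?_, ?_, fun U A hA q hq v => ?_, hnull⟩
  · obtain ⟨W, V, σ, g, F, hW, hq, hWV, hF, -, hf⟩ := H q₀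
    refine ⟨W, fun q i => F (p q) i i1, fun q i => F (p q) i i2, hW, hq, fun i q hq => ?_,
      fun i q hq => ?_, hf⟩
    · exact ((hF.frame_holo _ (hWV q hq)).comp hp.contMDiffAt i i1).contMDiffWithinAt
    · exact ((hF.frame_holo _ (hWV q hq)).comp hp.contMDiffAt i i2).contMDiffWithinAt
  · -- The vectors of a constant plane would be common to all the planes.
    by_contra! hconst
    have q₀ := Classical.arbitrary M
    have hne : (f q₀).1 ≠ ⊥ := by
      intro h0
      have h2 := (f q₀).2.1
      rw [h0, finrank_bot] at h2
      exact absurd h2 (by norm_num)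
    obtain ⟨ξ, hξ, h0⟩ := Submodule.exists_mem_ne_zero_of_ne_bot hne
    exact hnull ⟨ξ, h0, fun q => by rwa [hconst q q₀]⟩
  · obtain ⟨W, V, σ, g, F, hW, hqW, hWV, hF, -, hf⟩ := H q
    have hB := (hF.isAdaptedFrame hp hdp hW hWV hf 1).mono (hA.1.inter hW) Set.inter_subset_right
    exact hB.null (hA.mono (hA.1.inter hW) Set.inter_subset_left) ⟨hq, hqW⟩ v

theorem isQuarticDifferentialOf (H : IsFrameOfCurve T δ p Ψ f)
    (hp : ContMDiff 𝓘(ℂ) 𝓘(ℂ) ω p)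
    (hdp : ∀ (q : M) (v : TangentSpace 𝓘(ℂ) q), v ≠ 0 → mfderiv 𝓘(ℂ) 𝓘(ℂ) p q v ≠ 0) :
    IsQuarticDifferentialOf f (pullbackQuartic p δ) := by
  intro U A hA q hq v
  obtain ⟨W, V, σ, g, F, hW, hqW, hWV, hF, -, hf⟩ := H q
  have hB := (hF.isAdaptedFrame hp hdp hW hWV hf 1).mono (hA.1.1.inter hW) Set.inter_subset_right
  rw [← hF.quartic_pullback hp 1 (hWV q hqW) v]
  exact (hA.mono (hA.1.1.inter hW) Set.inter_subset_left).quartic_eq hB ⟨hq, hqW⟩ v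

theorem isGeneralType [Nonempty M] (H : IsFrameOfCurve T δ p Ψ f)
    (hp : ContMDiff 𝓘(ℂ) 𝓘(ℂ) ω p)
    (hdp : ∀ (q : M) (v : TangentSpace 𝓘(ℂ) q), v ≠ 0 → mfderiv 𝓘(ℂ) 𝓘(ℂ) p q v ≠ 0)
    (hδ : ∀ q, p q ∉ δ.divisorSupport) : IsGeneralType f := by
  have q := Classical.arbitrary M
  obtain ⟨W, V, σ, g, F, hW, hqW, hWV, hF, -, hf⟩ := H q
  obtain ⟨v, hv⟩ := exists_tangent_ne_zero q
  refine ⟨W, _, hF.isAdaptedFrame hp hdp hW hWV hf 1, q, hqW, v, ?_⟩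
  rw [hF.quartic_pullback hp 1 (hWV q hqW) v]
  exact δ.toFun_ne_zero (hδ q) (hdp q v hv)

/-- Injectivity holds because the action on `P` is free and `symRep` is faithful on `SL(2,ℂ)₁`;
surjectivity is the uniqueness of adapted frames up to `H₁`. -/
theorem bijOn (H : IsFrameOfCurve T δ p Ψ f) (hp : ContMDiff 𝓘(ℂ) 𝓘(ℂ) ω p)
    (hdp : ∀ (q : M) (v : TangentSpace 𝓘(ℂ) q), v ≠ 0 → mfderiv 𝓘(ℂ) 𝓘(ℂ) p q v ≠ 0) (q : M) :
    Set.BijOn (Ψ q) {y | T.proj y = p q} (adaptedFibre f q) := by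
  obtain ⟨W, V, σ, g, F, hW, hq, hWV, hF, hΨ, hf⟩ := H q
  have hadapted := hF.isAdaptedFrame hp hdp hW hWV hf
  refine ⟨fun y hy => ?_, fun y hy y' hy' h => ?_, ?_⟩
  · rw [hΨ q hq y hy]
    exact ⟨W, _, hadapted (g y), hq, rfl⟩
  · have hact : ∀ y, T.proj y = p q → T.act (σ (p q)) (g y) = y := by
      intro y hy
      have := hF.act_coord y (by rw [hy]; exact hWV q hq)
      rwa [hy] at this
    rw [hΨ q hq y hy, hΨ q hq y' hy'] at h
    have h1 := congrArg ((F (p q))⁻¹ * ·) h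
    simp only [Matrix.nonsing_inv_mul_cancel_left _ _
      (isUnit_det_of_mem_Sp (hF.frame_mem _ (hWV q hq)))] at h1
    rw [← hact y hy, ← hact y' hy', symRep_bmat_injective h1]
  · rintro B ⟨U, A, hA, hqU, rfl⟩
    obtain ⟨x, hx⟩ := ((hadapted 1).mono (hA.1.1.inter hW)
      Set.inter_subset_right).exists_eq_mul_symRep
      (hA.mono (hA.1.1.inter hW) Set.inter_subset_left) ⟨hqU, hq⟩
    have hproj : T.proj (T.act (σ (p q)) x) = p q :=
      (T.proj_act _ _).trans (hF.proj_section _ (hWV q hq))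
    have hg : g (T.act (σ (p q)) x) = x := by
      apply T.act_injective (σ (p q))
      have := hF.act_coord (T.act (σ (p q)) x) (by rw [hproj]; exact hWV q hq)
      rwa [hproj] at this
    refine ⟨T.act (σ (p q)) x, hproj, ?_⟩
    rw [hΨ q hq _ hproj, hg, hx, bmat_one, symRep_one, mul_one]

/-- As a function on the total space `P`, with `q = r (proj y)` for a local inverse `r` of `p`, the
frame `Ψ` is holomorphic and parallel over the identity; so it carries `η_f` back to the Cartan
connection. -/
theorem holAt_and_frameConn (H : IsFrameOfCurve T δ p Ψ f) {V : Set S} {r : S → M}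
    (hV : IsOpen V) (hr : ContMDiffOn 𝓘(ℂ) 𝓘(ℂ) ω r V) (hpr : ∀ s ∈ V, p (r s) = s) {y₀ : P}
    (hy₀ : T.proj y₀ ∈ V) :
    HolAt (Fin 3 → ℂ) (fun y => Ψ (r (T.proj y)) y) y₀ ∧
      ∀ v : TangentSpace 𝓘(ℂ, Fin 3 → ℂ) y₀,
        frameConn (maurerCartan (fun y => Ψ (r (T.proj y)) y) y₀ v) = T.conn y₀ v := by
  obtain ⟨W, V', σ, g, F, hW, hq, hWV, hF, hΨ, hf⟩ := H (r (T.proj y₀))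
  have hproj : ContMDiffAt 𝓘(ℂ, Fin 3 → ℂ) 𝓘(ℂ) ω T.proj y₀ := T.proj_holo.contMDiffAt
  have hy₀' : T.proj y₀ ∈ V' := by
    have := hWV _ hq
    rwa [hpr _ hy₀] at this
  have hev : (fun y => Ψ (r (T.proj y)) y)
      =ᶠ[𝓝 y₀] fun y => F (T.proj y) * symRep (bmat (g y)) := by
    have h1 : ContinuousAt (fun y => r (T.proj y)) y₀ :=
      (hr.continuousOn.continuousAt (hV.mem_nhds hy₀)).comp hproj.continuousAt
    filter_upwards [h1.eventually (hW.mem_nhds hq),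
      hproj.continuousAt.eventually (hV.mem_nhds hy₀)] with y hyW hyV
    rw [hΨ _ hyW y (hpr _ hyV).symm, hpr _ hyV]
  have hhol : HolAt (Fin 3 → ℂ) (fun y => F (T.proj y) * symRep (bmat (g y))) y₀ :=
    ((hF.frame_holo _ hy₀').comp hproj).mul (hF.coord_holo y₀ hy₀').symRep
  refine ⟨hhol.congr hev, fun v => ?_⟩
  have hpar : ParallelAt (E := Fin 3 → ℂ) T δ (fun y => Ψ (r (T.proj y)) y) id y₀ := by
    refine (((hF.parallel _ hy₀').comp (hF.frame_holo _ hy₀')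
      ((hF.holo _ hy₀').mdifferentiableAt (by simp))
      (hproj.mdifferentiableAt (by simp))).act (x := g) ((hF.frame_holo _ hy₀').comp hproj)
      ((hF.holo _ hy₀').comp y₀ hproj) (hF.coord_holo y₀ hy₀')).congr hev ?_
    filter_upwards [hproj.continuousAt.eventually (hF.isOpen.mem_nhds hy₀')] with y hy
    exact (hF.act_coord y hy).symm
  have hmem : Ψ (r (T.proj y₀)) y₀ ∈ Sp := by
    rw [show Ψ (r (T.proj y₀)) y₀ = _ from hev.self_of_nhds]
    exact mul_mem_Sp (hF.frame_mem _ hy₀') (symRep_bmat_mem _)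
  rw [hpar.maurerCartan_eq hmem, frameConn_spForm]
  exact congrArg (fun L : (Fin 3 → ℂ) →L[ℂ] (Fin 3 → ℂ) => T.conn y₀ (L v)) mfderiv_id

theorem isEquivalentToPullback (H : IsFrameOfCurve T δ p Ψ f) (hp : ContMDiff 𝓘(ℂ) 𝓘(ℂ) ω p)
    (hdp : ∀ (q : M) (v : TangentSpace 𝓘(ℂ) q), v ≠ 0 → mfderiv 𝓘(ℂ) 𝓘(ℂ) p q v ≠ 0) :
    IsEquivalentToPullback T p f :=
  ⟨Ψ, H.bijOn hp hdp, fun _ _ x hy => H.map_act x hy, fun _ _ hV hr hpr =>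
    ⟨fun i j _ hy => ((H.holAt_and_frameConn hV hr hpr hy).1 i j).contMDiffWithinAt,
      fun _ hy v => (H.holAt_and_frameConn hV hr hpr hy).2 v⟩⟩

end IsFrameOfCurve

end Global

end IsoCurve

theorem mainTheorem9
    {S : Type*} [TopologicalSpace S] [T2Space S] [ConnectedSpace S]
    [ChartedSpace ℂ S] [IsManifold 𝓘(ℂ) ω S]
    {P : Type*} [TopologicalSpace P]
    [ChartedSpace (Fin 3 → ℂ) P] [IsManifold 𝓘(ℂ, Fin 3 → ℂ) ω P]
    {D : Set S} (T : MeromorphicProjectiveStructure S P D)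
    (δ : QuarticDifferential S) (hδ : δ.IsNonzero)
    {M : Type*} [TopologicalSpace M] [ChartedSpace ℂ M] [IsManifold 𝓘(ℂ) ω M]
    (p : M → S) (hp : IsUniversalCovering p (D ∪ δ.divisorSupport)ᶜ) :
    ∃ f : M → Quadric,
      IsIsotropicCurve f ∧ IsGeneralType f ∧
      IsEquivalentToPullback T.toProjectiveStructure p f ∧
      IsQuarticDifferentialOf f (pullbackQuartic p δ) := by
  have := hp.simplyConnected
  have : LocallyPathConnectedSpace M := ChartedSpace.locallyPathConnectedSpace ℂ M
  have hmem : ∀ q, p q ∈ (D ∪ δ.divisorSupport)ᶜ := fun q => hp.range_eq ▸ Set.mem_range_self q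
  have hδp : ∀ q, p q ∉ δ.divisorSupport := fun q h => hmem q (Or.inr h)
  obtain ⟨Ψ, f, H⟩ := exists_isFrameOfCurve T.toProjectiveStructure δ hp.holomorphic.continuous
    (fun q h => hmem q (Or.inl h)) hδp
  exact ⟨f, H.isIsotropicCurve hp.holomorphic hp.mfderiv_ne_zero,
    H.isGeneralType hp.holomorphic hp.mfderiv_ne_zero hδp,
    H.isEquivalentToPullback hp.holomorphic hp.mfderiv_ne_zero,
    H.isQuarticDifferentialOf hp.holomorphic hp.mfderiv_ne_zero⟩
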